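/- **Notation.** $\mathbb N=\{1,2,\dots\}$; $c_{00}$ is the space of finitely supported real sequences with unit vectors $e_n$; for $f,x\in c_{00}$ put $f(x)=\sum_i f(i)x(i)$. For nonzero $f,g\in c_{00}$ write $f<g$ if $\max\operatorname{supp}f<\min\operatorname{supp}g$; $\operatorname{ran}f$ is the smallest interval containing $\operatorname{supp} f$; $Ef$ is the restriction of $f$ to $E$. A block sequence is a sequence of nonzero vectors $x_1<x_2<\cdots$ in $c_{00}$. The Schreier families are $\mathcal S_0=\{\{n\}\}$, $\mathcal S_1=\{F:\#F\le\min F\}$, $\mathcal S_{n+1}=\{\bigcup_{j\le k}F_j: F_1<\dots<F_k\in\mathcal S_n,\ k\le\min F_1\}$; vectors $f_1<\dots<f_d$ are $\mathcal S_n$-admissible if $\{\min\operatorname{supp}f_i\}\in\mathcal S_n$. A sequence of averages $f_1<f_2<\cdots$ with sizes $s(f_j)$ is very fast growing if $s(f_j)>2^{\max\operatorname{supp}f_{j-1}}$ and $s(f_j)>s(f_{j-1})$ for $j>1$. **Choices.** Let $(D_k)_k$ be a dense sequence in the unit sphere of $C[0,1]$, let $\|\sum a_ku_k\|_u=\max_F\|\sum_{k\in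 F}a_kD_k\|$ on $c_{00}$ (Pełczyński's unconditional basis $(u_k)$), and let $(u_k^*)$ be its biorthogonal functionals, with the dual norm. Let $L_0=\{\ell_1<\ell_2<\cdots\}\subset\mathbb N$ with $\ell_1>9$, $\ell_{k+1}>2^{2\ell_k}$, $\sum_k2^{-\ell_k}<1/1000$, be partitioned into infinite sets $L_1,L_2,L_3$. Let $\sigma$ be an injection into $L_2$ from the set of all finite nonempty block sequences $(f_1,\dots,f_m)$ of vectors with rational coordinates, such that $\sigma(f_1,\dots,f_m)>2^{1/\|f_m\|_\infty}\max\operatorname{supp}f_m$. **Norming set.** $W$ is the smallest subset of $c_{00}$ that contains every $\pm e_n$, is closed under $f\mapsto -f$, under restrictions to intervals and under rational convex combinations, and contains all functionals of types I$_\alpha$, I$_\beta$, II$_+$, II$_-$, where ($E$ always denotes an interval of $\mathbb N$): * An $\alpha$-average of size $s\in\mathbb N$ is an $f\in W$ of the form $\frac1s\sum_{j=1}^df_j$ with $d\le s$ and $f_1<\dots<f_d$ in $W$. A functional of type I$_\alpha$ of weight $n\in\mathbb N$ is any $\pm E\big(2^{-n}\sum_{q=1}^d\alpha_q\big)$ with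 $(\alpha_q)_{q\le d}$ an $\mathcal S_n$-admissible very fast growing sequence of $\alpha$-averages. * A special sequence is a sequence of pairs $(f_q,g_q)_{q=1}^d$ ($d\ge1$) with $f_1<g_1<f_2<\dots<f_d<g_d$, such that $f_q,g_q$ are of type I$_\alpha$ of a common weight $w_q$, $w_1\in L_1$, and $w_q=\sigma(f_1,g_1,\dots,f_{q-1},g_{q-1})$ for $q>1$. A special branch is an infinite sequence $(f_q,g_q)_{q=1}^\infty$ all of whose initial segments are special sequences (with the same weights). * For a special sequence $(f_q,g_q)_{q=1}^d$ and nonempty $F\subset\{1,\dots,d\}$ with $2\,\#F\le\min\operatorname{supp}f_{\min F}$: $\pm E\big(\frac12\sum_{q\in F}(f_q+g_q)\big)$ is of type II$_+$, with weight set $\{w_q:q\in F,\ \operatorname{ran}(f_q+g_q)\cap E\ne\varnothing\}$; and, for rational $\lambda_q$ with $\|\sum_{q\in F}\lambda_qu_q^*\|_u\le1$, $\pm E\big(\frac12\sum_{q\in F}\lambda_q(f_q-g_q)\big)$ is of type II$_-$, with weight set $\{w_q:q\in F,\ \operatorname{ran}(f_q-g_q)\cap E\ne\varnothing\}$. Type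 II means II$_+$ or II$_-$. * A $\beta$-average of size $s\in\mathbb N$ is an $f\in W$ of the form $\frac1s\sum_{j=1}^df_j$ with $d\le s$ and $f_j\in W$ of type II with pairwise disjoint weight sets. A functional of type I$_\beta$ of weight $n\in\mathbb N$ is any $\pm E\big(2^{-n}\sum_{q=1}^d\beta_q\big)$ with $(\beta_q)_{q\le d}$ an $\mathcal S_n$-admissible very fast growing sequence of $\beta$-averages. (A functional may have several weights, according to its representations.) The space $\mathfrak X$ is the completion of $c_{00}$ under $\|x\|=\sup\{f(x):f\in W\}$. **Indices.** Let $(x_k)_k$ be a block sequence. Its $\alpha$-index (resp. $\beta$-index) is zero if for every $n\in\mathbb N$, every very fast growing sequence $(h_q)_{q\in\mathbb N}$ of $\alpha$-averages (resp. $\beta$-averages), all finite sets $F_1<F_2<\cdots$ of naturals such that each $(h_q)_{q\in F_k}$ is $\mathcal S_n$-admissible, and every subsequence $(x_{n_k})_k$, one has $\lim_k\sum_{q\in F_k}|h_q(x_{n_k})|=0$. Its branch index $\mathcal B$ is zero if for every special branch $(f_q,g_q)_q$ and every $\varepsilon>0$ there are $k_0,q_0$ with $|(f_q+g_q)(x_k)|<\varepsilon$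 and $|(f_q-g_q)(x_k)|<\varepsilon$ for all $k\ge k_0$, $q\ge q_0$. **Spreading models.** A sequence $(y_k)_k$ in a normed space generates a $c_0$ spreading model if there are a seminorm $N$ on $c_{00}$ and positive $\delta_n\downarrow0$ such that $\big|\,\|\sum_{i=1}^na_iy_{k_i}\|-N(\sum_{i=1}^na_ie_i)\big|<\delta_n$ for all $n\le k_1<\dots<k_n$ and $a_i\in[-1,1]$, and $c\|a\|_\infty\le N(a)\le C\|a\|_\infty$ on $c_{00}$ for some constants $c,C>0$. **Proposition.** Let $(x_k)_k$ be a seminormalized block sequence in $\mathfrak X$ (that is, $\inf_k\|x_k\|>0$) with $\|x_k\|\le1$ for all $k$, whose $\alpha$-index, $\beta$-index and branch index are all zero. Then it has a subsequence, again denoted $(x_k)_k$, such that: 1. $(x_k)_k$ generates a $c_0$ spreading model, and $\big\|\sum_{i=1}^nx_{k_i}\big\|\le5$ whenever $n\le k_1<\dots<k_n$; 2. there is a strictly increasing sequence of naturals $(j_n)_n$ such that $\big|f\big(\sum_{i=1}^nx_{k_i}\big)\big|<\dfrac5{2^j}$ whenever $n\le k_1<\dots<k_n$ and $f$ is a functional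 of type I$_\alpha$ of weight $j<j_n$. -/

import Mathlib

open Filter Topology

noncomputable section

/-! ### Finitely supported vectors, indexed by `ℕ = {1, 2, …}` -/

/-- The space `c₀₀` of finitely supported real sequences; used both for vectors and functionals. -/
abbrev Vec : Type := ℕ+ →₀ ℝ

/-- The action `f(x) = ∑ f(i) x(i)`. -/
def act (f x : Vec) : ℝ := f.sum fun i c => c * x i

/-- The supremum norm of a finitely supported sequence. -/
def supNorm {ι : Type} (a : ι →₀ ℝ) : ℝ := ⨆ i, |a i|

/-- `f < g`, that is, `max supp f < min supp g`. -/
def Before (f g : Vec) : Prop := ∀ a ∈ f.support, ∀ b ∈ g.support, a < b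

/-- A block family: nonzero vectors with successive supports. -/
def IsBlock {ι : Type} [LT ι] (f : ι → Vec) : Prop :=
  (∀ i, f i ≠ 0) ∧ ∀ i j, i < j → Before (f i) (f j)

/-- The restriction `Ef`. -/
def restrict (E : Set ℕ+) (f : Vec) : Vec := by
  classical exact f.filter (· ∈ E)

/-- The range of a vector: the smallest interval containing its support. -/
def ran (f : Vec) : Set ℕ+ := {n | ∃ a ∈ f.support, ∃ b ∈ f.support, a ≤ n ∧ n ≤ b}

/-- `g = ± E f` for some sign and some interval `E`. -/
def IsSignedRestriction (E : Set ℕ+) (f g : Vec) : Prop :=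
  E.OrdConnected ∧ (g = restrict E f ∨ g = -restrict E f)

/-! ### Schreier families -/

/-- The Schreier families (their nonempty members). The first step of the recursion produces
`{F : #F ≤ min F}`, see `mem_schreier_one`. -/
def schreier : ℕ → Set (Finset ℕ+)
  | 0 => {F | ∃ n, F = {n}}
  | n + 1 => {F | ∃ (k : ℕ) (G : Fin k → Finset ℕ+), 0 < k ∧ (∀ j, G j ∈ schreier n) ∧
      (∀ i j, i < j → ∀ a ∈ G i, ∀ b ∈ G j, a < b) ∧
      (∀ j, ∀ a ∈ G j, k ≤ (a : ℕ)) ∧ F = Finset.univ.biUnion G}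

theorem mem_schreier_one (F : Finset ℕ+) :
    F ∈ schreier 1 ↔ F.Nonempty ∧ ∀ a ∈ F, F.card ≤ (a : ℕ) := by
  constructor
  · rintro ⟨k, G, hk, hG, -, hmin, rfl⟩
    choose m hm using hG
    refine ⟨⟨m ⟨0, hk⟩, Finset.mem_biUnion.2 ⟨⟨0, hk⟩, Finset.mem_univ _, by simp [hm]⟩⟩, ?_⟩
    intro a ha
    obtain ⟨j, -, hj⟩ := Finset.mem_biUnion.1 ha
    refine le_trans ?_ (hmin j a hj)
    refine le_trans Finset.card_biUnion_le ?_
    simp [hm]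
  · rintro ⟨hne, h⟩
    refine ⟨F.card, fun j => {F.orderEmbOfFin rfl j}, hne.card_pos, fun j => ⟨_, rfl⟩, ?_, ?_, ?_⟩
    · intro i j hij a ha b hb
      rw [Finset.mem_singleton] at ha hb
      subst ha hb
      exact (F.orderEmbOfFin rfl).strictMono hij
    · intro j a ha
      rw [Finset.mem_singleton] at ha
      subst ha
      exact h _ (F.orderEmbOfFin_mem rfl j)
    · ext a
      constructor
      · intro ha
        have : a ∈ Set.range (F.orderEmbOfFin rfl) := by
          rw [Finset.range_orderEmbOfFin]; exact ha
        obtain ⟨j, hj⟩ := this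
        exact Finset.mem_biUnion.2 ⟨j, Finset.mem_univ _, by simp [hj]⟩
      · intro ha
        obtain ⟨j, -, hj⟩ := Finset.mem_biUnion.1 ha
        rw [Finset.mem_singleton] at hj
        subst hj
        exact F.orderEmbOfFin_mem rfl j

/-- The family `(f q)_{q ∈ F}` is `𝒮ₙ`-admissible: the set of the numbers `min supp f q`, `q ∈ F`,
belongs to `𝒮ₙ`. -/
def Admissible {ι : Type} (n : ℕ) (F : Finset ι) (f : ι → Vec) : Prop :=
  ∃ m : ι → ℕ+, (∀ q ∈ F, IsLeast ((f q).support : Set ℕ+) (m q)) ∧ F.image m ∈ schreier n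

/-- The block family `f` with sizes `s` is very fast growing. -/
def VeryFastGrowing {ι : Type} [LT ι] (f : ι → Vec) (s : ι → ℕ) : Prop :=
  IsBlock f ∧ ∀ i j, i < j → s i < s j ∧ ∀ a ∈ (f i).support, 2 ^ (a : ℕ) < s j

/-! ### The choices made before the construction -/

/-- The domain of the coding function: nonempty finite block sequences of vectors with rational
coordinates. -/
def IsCodable (l : List Vec) : Prop :=
  l ≠ [] ∧ (∀ f ∈ l, f ≠ 0 ∧ ∀ i, ∃ r : ℚ, f i = (r : ℝ)) ∧ l.Pairwise Before

/-- The data on which the space depends: a dense sequence in the unit sphere of `C[0,1]`, the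
lacunary set `L₀ = {ℓ₁ < ℓ₂ < …}` split into infinite sets `L₁, L₂, L₃`, and the coding
function `σ`. -/
structure Setup where
  D : ℕ → C(unitInterval, ℝ)
  D_norm : ∀ k, ‖D k‖ = 1
  D_dense : Metric.sphere (0 : C(unitInterval, ℝ)) 1 ⊆ closure (Set.range D)
  ell : ℕ → ℕ
  ell_zero : 9 < ell 0
  ell_succ : ∀ k, 2 ^ (2 * ell k) < ell (k + 1)
  ell_sum : ∑' k, (1 : ℝ) / 2 ^ ell k < 1 / 1000
  L₁ : Set ℕ
  L₂ : Set ℕ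
  L₃ : Set ℕ
  L_union : L₁ ∪ L₂ ∪ L₃ = Set.range ell
  L_disj₁₂ : Disjoint L₁ L₂
  L_disj₁₃ : Disjoint L₁ L₃
  L_disj₂₃ : Disjoint L₂ L₃
  L₁_inf : L₁.Infinite
  L₂_inf : L₂.Infinite
  L₃_inf : L₃.Infinite
  σ : List Vec → ℕ
  σ_mem : ∀ l, IsCodable l → σ l ∈ L₂
  σ_inj : Set.InjOn σ {l | IsCodable l}
  σ_growth : ∀ (l : List Vec) (f : Vec), IsCodable (l ++ [f]) →
    ∀ a ∈ f.support, (2 : ℝ) ^ (1 / supNorm f) * ((a : ℕ) : ℝ) < (σ (l ++ [f]) : ℝ)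

/-- The norm `‖∑ aₖ uₖ‖_u` defining Pełczyński's universal suppression unconditional basis: the
maximum of `‖∑_{k ∈ F} aₖ Dₖ‖` over finite sets `F` (it suffices to take `F` within the
support). -/
def Setup.uNorm (P : Setup) (a : ℕ →₀ ℝ) : ℝ :=
  a.support.powerset.sup' ⟨∅, Finset.empty_mem_powerset _⟩ fun F => ‖∑ k ∈ F, a k • P.D k‖

/-- `‖∑_{q ∈ F} c_q u_q^*‖ ≤ 1` in the dual norm of `‖·‖_u`. -/
def Setup.DualBall (P : Setup) (F : Finset ℕ) (c : ℕ → ℚ) : Prop :=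
  ∀ a : ℕ →₀ ℝ, |∑ q ∈ F, (c q : ℝ) * a q| ≤ P.uNorm a

/-! ### The kinds of functionals built over a set `G ⊆ c₀₀` -/

/-- `f` is an `α`-average of size `s`. -/
def IsAlphaAverage (G : Set Vec) (s : ℕ) (f : Vec) : Prop :=
  0 < s ∧ f ∈ G ∧ ∃ d : ℕ, d ≤ s ∧ ∃ h : Fin d → Vec,
    IsBlock h ∧ (∀ i, h i ∈ G) ∧ f = (1 / s : ℝ) • ∑ i, h i

/-- Functionals of type I and weight `n`, where `avg s f` says that `f` is an average of size `s`
of the kind under consideration. -/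
def IsTypeI (avg : ℕ → Vec → Prop) (n : ℕ) (g : Vec) : Prop :=
  1 ≤ n ∧ ∃ (d : ℕ) (h : Fin d → Vec) (s : Fin d → ℕ), (∀ q, avg (s q) (h q)) ∧
    VeryFastGrowing h s ∧ Admissible n Finset.univ h ∧
    ∃ E : Set ℕ+, IsSignedRestriction E ((1 / 2 ^ n : ℝ) • ∑ q, h q) g

/-- `g` is a functional of type `I_α` of weight `n`. -/
def IsTypeIAlpha (G : Set Vec) (n : ℕ) (g : Vec) : Prop := IsTypeI (IsAlphaAverage G) n g

/-- The finite sequence `(f₀, g₀, …, f_{q-1}, g_{q-1})`. -/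
def pairList (f g : ℕ → Vec) (q : ℕ) : List Vec := (List.range q).flatMap fun i => [f i, g i]

/-- The pairs `(f q, g q)`, `q < d`, form a special sequence with weights `w q`. -/
def IsSpecial (P : Setup) (G : Set Vec) (d : ℕ) (f g : ℕ → Vec) (w : ℕ → ℕ) : Prop :=
  1 ≤ d ∧
  (∀ q < d, f q ≠ 0 ∧ g q ≠ 0 ∧ Before (f q) (g q)) ∧
  (∀ q, q + 1 < d → Before (g q) (f (q + 1))) ∧
  (∀ q < d, IsTypeIAlpha G (w q) (f q) ∧ IsTypeIAlpha G (w q) (g q)) ∧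
  w 0 ∈ P.L₁ ∧
  ∀ q, 1 ≤ q → q < d → P.σ (pairList f g q) = w q

/-- `h` is a functional of type `II₊` whose set of weights is `A`. -/
def IsTypeIIPlus (P : Setup) (G : Set Vec) (A : Set ℕ) (h : Vec) : Prop :=
  ∃ (d : ℕ) (f g : ℕ → Vec) (w : ℕ → ℕ) (F : Finset ℕ) (E : Set ℕ+),
    IsSpecial P G d f g w ∧ F.Nonempty ∧ (∀ q ∈ F, q < d) ∧
    (∀ q ∈ F, ∀ a ∈ (f q).support, 2 * F.card ≤ (a : ℕ)) ∧
    IsSignedRestriction E ((1 / 2 : ℝ) • ∑ q ∈ F, (f q + g q)) h ∧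
    A = {n | ∃ q ∈ F, n = w q ∧ (ran (f q + g q) ∩ E).Nonempty}

/-- `h` is a functional of type `II₋` whose set of weights is `A`. -/
def IsTypeIIMinus (P : Setup) (G : Set Vec) (A : Set ℕ) (h : Vec) : Prop :=
  ∃ (d : ℕ) (f g : ℕ → Vec) (w : ℕ → ℕ) (F : Finset ℕ) (c : ℕ → ℚ) (E : Set ℕ+),
    IsSpecial P G d f g w ∧ F.Nonempty ∧ (∀ q ∈ F, q < d) ∧
    (∀ q ∈ F, ∀ a ∈ (f q).support, 2 * F.card ≤ (a : ℕ)) ∧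
    P.DualBall F c ∧
    IsSignedRestriction E ((1 / 2 : ℝ) • ∑ q ∈ F, (c q : ℝ) • (f q - g q)) h ∧
    A = {n | ∃ q ∈ F, n = w q ∧ (ran (f q - g q) ∩ E).Nonempty}

/-- `h` is a functional of type II whose set of weights is `A`. -/
def IsTypeII (P : Setup) (G : Set Vec) (A : Set ℕ) (h : Vec) : Prop :=
  IsTypeIIPlus P G A h ∨ IsTypeIIMinus P G A h

/-- `f` is a `β`-average of size `s`. -/
def IsBetaAverage (P : Setup) (G : Set Vec) (s : ℕ) (f : Vec) : Prop :=
  0 < s ∧ f ∈ G ∧ ∃ d : ℕ, d ≤ s ∧ ∃ (h : Fin d → Vec) (A : Fin d → Set ℕ),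
    (∀ i, h i ∈ G ∧ IsTypeII P G (A i) (h i)) ∧
    (∀ i j, i ≠ j → Disjoint (A i) (A j)) ∧ f = (1 / s : ℝ) • ∑ i, h i

/-- `g` is a functional of type `I_β` of weight `n`. -/
def IsTypeIBeta (P : Setup) (G : Set Vec) (n : ℕ) (g : Vec) : Prop :=
  IsTypeI (IsBetaAverage P G) n g

/-! ### The norming set and the space -/

/-- The closure properties defining the norming set. -/
structure IsClosedUnderOps (P : Setup) (G : Set Vec) : Prop where
  basis_mem : ∀ n, Finsupp.single n 1 ∈ G
  neg_mem : ∀ f ∈ G, -f ∈ G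
  restrict_mem : ∀ f ∈ G, ∀ E : Set ℕ+, E.OrdConnected → restrict E f ∈ G
  convex_mem : ∀ f ∈ G, ∀ g ∈ G, ∀ r : ℚ, 0 ≤ r → r ≤ 1 → (r : ℝ) • f + (1 - r : ℝ) • g ∈ G
  alpha_mem : ∀ n f, IsTypeIAlpha G n f → f ∈ G
  beta_mem : ∀ n f, IsTypeIBeta P G n f → f ∈ G
  plus_mem : ∀ A f, IsTypeIIPlus P G A f → f ∈ G
  minus_mem : ∀ A f, IsTypeIIMinus P G A f → f ∈ G

/-- The norming set `W`: the smallest subset of `c₀₀` closed under the operations. -/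
def Setup.W (P : Setup) : Set Vec := ⋂₀ {G | IsClosedUnderOps P G}

/-- `‖x‖ = sup {f(x) : f ∈ W}`. -/
def Setup.normW (P : Setup) (x : Vec) : ℝ := sSup ((fun f => act f x) '' P.W)

/-! Boundedness of `W`, needed for the norm to be finite. -/

theorem abs_sum_le_one_of_disjoint {ι : Type} (F : Finset ι) (h : ι → Vec) (a : ℕ+)
    (hd : ∀ i ∈ F, ∀ j ∈ F, i ≠ j → h i a ≠ 0 → h j a = 0) (hb : ∀ i ∈ F, |h i a| ≤ 1) :
    |(∑ i ∈ F, h i) a| ≤ 1 := by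
  rw [Finsupp.finsetSum_apply]
  by_cases hex : ∃ i ∈ F, h i a ≠ 0
  · obtain ⟨i, hi, hne⟩ := hex
    rw [Finset.sum_eq_single_of_mem i hi fun j hj hji => hd i hi j hj hji.symm hne]
    exact hb i hi
  · push Not at hex
    rw [Finset.sum_eq_zero hex]
    simp

theorem Before.apply_eq_zero {f g : Vec} (h : Before f g) {a : ℕ+} (ha : f a ≠ 0) : g a = 0 := by
  by_contra hg
  exact lt_irrefl a (h a (Finsupp.mem_support_iff.2 ha) a (Finsupp.mem_support_iff.2 hg))

theorem Before.apply_eq_zero' {f g : Vec} (h : Before f g) {a : ℕ+} (ha : g a ≠ 0) : f a = 0 := by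
  by_contra hg
  exact lt_irrefl a (h a (Finsupp.mem_support_iff.2 hg) a (Finsupp.mem_support_iff.2 ha))

theorem Before.trans' {f g h : Vec} (hfg : Before f g) (hg : g ≠ 0) (hgh : Before g h) :
    Before f h := by
  intro a ha b hb
  obtain ⟨c, hc⟩ := Finsupp.support_nonempty_iff.2 hg
  exact (hfg a ha c hc).trans (hgh c hc b hb)

theorem abs_restrict_le (E : Set ℕ+) (f : Vec) (a : ℕ+) : |restrict E f a| ≤ |f a| := by
  classical
  unfold restrict
  by_cases h : a ∈ E
  · simp [h]
  · simp [h]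

theorem IsSignedRestriction.abs_le {E : Set ℕ+} {f g : Vec} (h : IsSignedRestriction E f g)
    (a : ℕ+) : |g a| ≤ |f a| := by
  rcases h.2 with rfl | rfl
  · exact abs_restrict_le E f a
  · simpa using abs_restrict_le E f a

theorem IsTypeI.abs_le {avg : ℕ → Vec → Prop} {n : ℕ} {g : Vec} (h : IsTypeI avg n g)
    (havg : ∀ s f, avg s f → ∀ a, |f a| ≤ 1) (a : ℕ+) : |g a| ≤ 1 := by
  obtain ⟨-, d, h, s, hs, hv, -, E, hE⟩ := h
  refine (hE.abs_le a).trans ?_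
  have h1 : |(∑ q, h q) a| ≤ 1 := by
    refine abs_sum_le_one_of_disjoint _ h a ?_ fun i _ => havg _ _ (hs i) a
    intro i _ j _ hij hne
    rcases lt_or_gt_of_ne hij with hlt | hlt
    · exact (hv.1.2 i j hlt).apply_eq_zero hne
    · exact (hv.1.2 j i hlt).apply_eq_zero' hne
  rw [Finsupp.smul_apply, smul_eq_mul, abs_mul]
  have h2 : |(1 / 2 ^ n : ℝ)| ≤ 1 := by
    rw [abs_of_nonneg (by positivity), div_le_one (by positivity)]
    exact one_le_pow₀ (by norm_num)
  exact mul_le_one₀ h2 (abs_nonneg _) h1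

theorem IsSpecial.before {P : Setup} {G : Set Vec} {d : ℕ} {f g : ℕ → Vec} {w : ℕ → ℕ}
    (h : IsSpecial P G d f g w) {p q : ℕ} (hpq : p < q) (hq : q < d) : Before (g p) (f q) := by
  obtain ⟨-, h1, h2, -⟩ := h
  induction q, hpq using Nat.le_induction with
  | base => exact h2 p hq
  | succ q hpq ih =>
    have hq' : q < d := by omega
    exact ((ih hq').trans' (h1 q hq').1 (h1 q hq').2.2).trans' (h1 q hq').2.1 (h2 q hq)

theorem IsSpecial.abs_sum_le {P : Setup} {G : Set Vec} {d : ℕ} {f g : ℕ → Vec} {w : ℕ → ℕ}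
    (h : IsSpecial P G d f g w) (hG : ∀ n f, IsTypeIAlpha G n f → ∀ a, |f a| ≤ 1)
    (F : Finset ℕ) (hF : ∀ q ∈ F, q < d) (c e : ℕ → ℝ) (hc : ∀ q ∈ F, |c q| ≤ 1)
    (he : ∀ q ∈ F, |e q| ≤ 1) (a : ℕ+) : |(∑ q ∈ F, (c q • f q + e q • g q)) a| ≤ 1 := by
  have key : ∀ p q, p < q → q < d → (f p a ≠ 0 ∨ g p a ≠ 0) → f q a = 0 ∧ g q a = 0 := by
    intro p q hpq hq hne
    have hp : p < d := hpq.trans hq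
    have b1 := h.before hpq hq
    have b2 := b1.trans' (h.2.1 q hq).1 (h.2.1 q hq).2.2
    have b3 := (h.2.1 p hp).2.2.trans' (h.2.1 p hp).2.1 b1
    have b4 := (h.2.1 p hp).2.2.trans' (h.2.1 p hp).2.1 b2
    rcases hne with hne | hne
    · exact ⟨b3.apply_eq_zero hne, b4.apply_eq_zero hne⟩
    · exact ⟨b1.apply_eq_zero hne, b2.apply_eq_zero hne⟩
  refine abs_sum_le_one_of_disjoint F _ a ?_ ?_
  · intro i hi j hj hij hne
    have hne' : f i a ≠ 0 ∨ g i a ≠ 0 := by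
      by_contra hcon
      push Not at hcon
      exact hne (by simp [hcon.1, hcon.2])
    have hz : f j a = 0 ∧ g j a = 0 := by
      rcases lt_or_gt_of_ne hij with hlt | hlt
      · exact key i j hlt (hF j hj) hne'
      · by_contra hcon
        have hcon' : f j a ≠ 0 ∨ g j a ≠ 0 := by tauto
        have := key j i hlt (hF i hi) hcon'
        tauto
    simp [hz.1, hz.2]
  · intro q hq
    have hqd := hF q hq
    have hf := hG _ _ (h.2.2.2.1 q hqd).1 a
    have hg := hG _ _ (h.2.2.2.1 q hqd).2 a
    simp only [Finsupp.add_apply, Finsupp.smul_apply, smul_eq_mul]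
    by_cases h0 : f q a = 0
    · rw [h0, mul_zero, zero_add, abs_mul]
      exact mul_le_one₀ (he q hq) (abs_nonneg _) hg
    · rw [(h.2.1 q hqd).2.2.apply_eq_zero h0, mul_zero, add_zero, abs_mul]
      exact mul_le_one₀ (hc q hq) (abs_nonneg _) hf

theorem Setup.DualBall.abs_le_one {P : Setup} {F : Finset ℕ} {c : ℕ → ℚ} (h : P.DualBall F c)
    {q : ℕ} (hq : q ∈ F) : |(c q : ℝ)| ≤ 1 := by
  have h1 := h (Finsupp.single q 1)
  rw [Finset.sum_eq_single_of_mem q hq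
    (fun b _ hb => by rw [Finsupp.single_eq_of_ne hb, mul_zero]),
    Finsupp.single_eq_same, mul_one] at h1
  refine h1.trans (Finset.sup'_le _ _ fun A hA => ?_)
  rw [Finset.mem_powerset] at hA
  have hA' : A ⊆ {q} := hA.trans Finsupp.support_single_subset
  rcases Finset.subset_singleton_iff.1 hA' with rfl | rfl
  · simp
  · simp [P.D_norm]

theorem isClosedUnderOps_bounded (P : Setup) :
    IsClosedUnderOps P {f : Vec | ∀ a, |f a| ≤ 1} := by
  have hα : ∀ n f, IsTypeIAlpha {f : Vec | ∀ a, |f a| ≤ 1} n f → ∀ a, |f a| ≤ 1 :=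
    fun n f hf => hf.abs_le fun s f hf => hf.2.1
  have half : ∀ t : ℝ, |t| ≤ 1 → |(1 / 2 : ℝ) * t| ≤ 1 := by
    intro t ht
    rw [abs_mul, abs_of_nonneg (by norm_num : (0 : ℝ) ≤ 1 / 2)]
    linarith
  refine ⟨?_, ?_, ?_, ?_, hα, ?_, ?_, ?_⟩
  · intro n a
    rw [Finsupp.single_apply]
    split_ifs <;> simp
  · intro f hf a
    simpa using hf a
  · intro f hf E _ a
    exact (abs_restrict_le E f a).trans (hf a)
  · intro f hf g hg r h0 h1 a
    have h0' : (0 : ℝ) ≤ r := by exact_mod_cast h0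
    have h1' : (r : ℝ) ≤ 1 := by exact_mod_cast h1
    have hfa := abs_le.1 (hf a)
    have hga := abs_le.1 (hg a)
    simp only [Finsupp.add_apply, Finsupp.smul_apply, smul_eq_mul]
    rw [abs_le]
    constructor <;> nlinarith
  · exact fun n f hf => hf.abs_le fun s f hf => hf.2.1
  · rintro A h ⟨d, f, g, w, F, E, hs, -, hF, -, hE, -⟩ a
    refine (hE.abs_le a).trans ?_
    have := hs.abs_sum_le hα F hF (fun _ => 1) (fun _ => 1) (by simp) (by simp) a
    simp only [one_smul] at this
    exact half _ this
  · rintro A h ⟨d, f, g, w, F, c, E, hs, -, hF, -, hc, hE, -⟩ a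
    refine (hE.abs_le a).trans ?_
    have := hs.abs_sum_le hα F hF (fun q => (c q : ℝ)) (fun q => -(c q : ℝ))
      (fun q hq => hc.abs_le_one hq) (fun q hq => by simpa using hc.abs_le_one hq) a
    simp only [neg_smul, ← sub_eq_add_neg, ← smul_sub] at this
    exact half _ this

theorem Setup.abs_le_one_of_mem_W {P : Setup} {f : Vec} (hf : f ∈ P.W) (a : ℕ+) : |f a| ≤ 1 :=
  hf _ (isClosedUnderOps_bounded P) a

theorem act_add (f x y : Vec) : act f (x + y) = act f x + act f y := by
  simp [act, mul_add, Finsupp.sum_add]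

theorem act_smul (f : Vec) (c : ℝ) (x : Vec) : act f (c • x) = c * act f x := by
  simp only [act, Finsupp.sum, Finset.mul_sum, Finsupp.smul_apply, smul_eq_mul]
  exact Finset.sum_congr rfl fun i _ => by ring

theorem act_neg_left (f x : Vec) : act (-f) x = -act f x := by
  simp [act, Finsupp.sum]

theorem act_comm (f x : Vec) : act f x = act x f := by
  have h : ∀ u v : Vec, act u v = ∑ i ∈ f.support ∪ x.support, u i * v i →
    act v u = ∑ i ∈ f.support ∪ x.support, v i * u i → act u v = act v u := by
    intro u v h1 h2
    rw [h1, h2]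
    exact Finset.sum_congr rfl fun i _ => mul_comm _ _
  refine h f x ?_ ?_
  · exact Finsupp.sum_of_support_subset _ Finset.subset_union_left _ (by simp)
  · exact Finsupp.sum_of_support_subset _ Finset.subset_union_right _ (by simp)

theorem Setup.neg_mem_W {P : Setup} {f : Vec} (hf : f ∈ P.W) : -f ∈ P.W :=
  fun _ hG => hG.neg_mem f (hf _ hG)

theorem Setup.single_mem_W (P : Setup) (n : ℕ+) : Finsupp.single n 1 ∈ P.W :=
  fun _ hG => hG.basis_mem n

theorem Setup.bddAbove_act (P : Setup) (x : Vec) : BddAbove ((fun f => act f x) '' P.W) := by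
  refine ⟨∑ i ∈ x.support, |x i|, ?_⟩
  rintro _ ⟨f, hf, rfl⟩
  change act f x ≤ _
  rw [act_comm]
  refine Finset.sum_le_sum fun i _ => ?_
  refine (le_abs_self _).trans ?_
  rw [abs_mul]
  exact mul_le_of_le_one_right (abs_nonneg _) (P.abs_le_one_of_mem_W hf i)

theorem Setup.abs_act_le (P : Setup) {f : Vec} (hf : f ∈ P.W) (x : Vec) :
    |act f x| ≤ P.normW x := by
  refine abs_le'.2 ⟨le_csSup (P.bddAbove_act x) ⟨f, hf, rfl⟩, ?_⟩
  exact le_csSup (P.bddAbove_act x) ⟨-f, P.neg_mem_W hf, act_neg_left f x⟩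

theorem Setup.normW_le (P : Setup) {x : Vec} {C : ℝ} (h : ∀ f ∈ P.W, act f x ≤ C) :
    P.normW x ≤ C := by
  refine csSup_le ⟨_, Finsupp.single 1 1, P.single_mem_W 1, rfl⟩ ?_
  rintro _ ⟨f, hf, rfl⟩
  exact h f hf

theorem Setup.normW_nonneg (P : Setup) (x : Vec) : 0 ≤ P.normW x :=
  (abs_nonneg _).trans (P.abs_act_le (P.single_mem_W 1) x)

theorem Setup.normW_add_le (P : Setup) (x y : Vec) : P.normW (x + y) ≤ P.normW x + P.normW y := by
  refine P.normW_le fun f hf => ?_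
  rw [act_add]
  exact add_le_add ((le_abs_self _).trans (P.abs_act_le hf x))
    ((le_abs_self _).trans (P.abs_act_le hf y))

theorem Setup.normW_eq_zero_iff (P : Setup) (x : Vec) : P.normW x = 0 ↔ x = 0 := by
  constructor
  · intro h
    ext n
    have h1 := P.abs_act_le (P.single_mem_W n) x
    have h2 : act (Finsupp.single n 1) x = x n := by simp [act]
    rw [h2, h] at h1
    exact abs_nonpos_iff.1 h1
  · rintro rfl
    exact le_antisymm (P.normW_le fun f _ => by simp [act]) (P.normW_nonneg 0)

theorem Setup.normW_smul (P : Setup) (c : ℝ) (x : Vec) : P.normW (c • x) = |c| * P.normW x := by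
  have hle : ∀ (c : ℝ) (x : Vec), P.normW (c • x) ≤ |c| * P.normW x := by
    intro c x
    refine P.normW_le fun f hf => ?_
    rw [act_smul]
    refine (le_abs_self _).trans ?_
    rw [abs_mul]
    exact mul_le_mul_of_nonneg_left (P.abs_act_le hf x) (abs_nonneg _)
  refine le_antisymm (hle c x) ?_
  rcases eq_or_ne c 0 with rfl | hc
  · rw [abs_zero, zero_mul]
    exact P.normW_nonneg _
  · have h := hle c⁻¹ (c • x)
    rw [inv_smul_smul₀ hc, abs_inv, inv_mul_eq_div, le_div_iff₀ (abs_pos.2 hc)] at h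
    rw [mul_comm]
    exact h

/-- `c₀₀` carrying the norm induced by `W`. -/
def C00 (_ : Setup) : Type := Vec

instance (P : Setup) : AddCommGroup (C00 P) := inferInstanceAs (AddCommGroup Vec)

instance (P : Setup) : Module ℝ (C00 P) := inferInstanceAs (Module ℝ Vec)

instance (P : Setup) : Norm (C00 P) := ⟨fun x => P.normW x⟩

theorem C00.core (P : Setup) : NormedSpace.Core ℝ (C00 P) where
  norm_nonneg x := P.normW_nonneg x
  norm_smul c x := P.normW_smul c x
  norm_triangle x y := P.normW_add_le x y
  norm_eq_zero_iff x := P.normW_eq_zero_iff x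

instance (P : Setup) : NormedAddCommGroup (C00 P) := NormedAddCommGroup.ofCore (C00.core P)

instance (P : Setup) : NormedSpace ℝ (C00 P) := NormedSpace.ofCore (C00.core P)

/-- The Banach space `𝔛`, the completion of `(c₀₀, ‖·‖)`. -/
abbrev Setup.X (P : Setup) : Type := UniformSpace.Completion (C00 P)

/-- The inclusion of `c₀₀` in `𝔛`. -/
def Setup.incl (P : Setup) (x : Vec) : P.X := ((show C00 P from x : C00 P) : P.X)

theorem Setup.norm_incl (P : Setup) (x : Vec) : ‖P.incl x‖ = P.normW x :=
  UniformSpace.Completion.norm_coe _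

theorem Setup.incl_add (P : Setup) (x y : Vec) : P.incl (x + y) = P.incl x + P.incl y :=
  UniformSpace.Completion.coe_add (α := C00 P) x y

theorem Setup.incl_smul (P : Setup) (c : ℝ) (x : Vec) : P.incl (c • x) = c • P.incl x :=
  UniformSpace.Completion.coe_smul (X := C00 P) c x

/-! ### The three indices of a block sequence -/

/-- The index of `x` with respect to the averages `avg` is zero. -/
def IndexZero (avg : ℕ → Vec → Prop) (x : ℕ → Vec) : Prop :=
  ∀ n : ℕ, 1 ≤ n → ∀ (h : ℕ → Vec) (s : ℕ → ℕ), (∀ q, avg (s q) (h q)) → VeryFastGrowing h s →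
    ∀ F : ℕ → Finset ℕ, (∀ k l, k < l → ∀ a ∈ F k, ∀ b ∈ F l, a < b) →
      (∀ k, Admissible n (F k) h) → ∀ φ : ℕ → ℕ, StrictMono φ →
        Tendsto (fun k => ∑ q ∈ F k, |act (h q) (x (φ k))|) atTop (𝓝 0)

/-- The `α`-index of `x` is zero. -/
def AlphaIndexZero (P : Setup) (x : ℕ → Vec) : Prop := IndexZero (IsAlphaAverage P.W) x

/-- The `β`-index of `x` is zero. -/
def BetaIndexZero (P : Setup) (x : ℕ → Vec) : Prop := IndexZero (IsBetaAverage P P.W) x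

/-- `(f q, g q)_q` is a special branch. -/
def IsSpecialBranch (P : Setup) (f g : ℕ → Vec) : Prop :=
  ∃ w : ℕ → ℕ, ∀ d, 1 ≤ d → IsSpecial P P.W d f g w

/-- The branch index of `x` is zero. -/
def BranchIndexZero (P : Setup) (x : ℕ → Vec) : Prop :=
  ∀ f g : ℕ → Vec, IsSpecialBranch P f g → ∀ ε : ℝ, 0 < ε → ∃ k₀ q₀ : ℕ, ∀ k ≥ k₀, ∀ q ≥ q₀,
    |act (f q + g q) (x k)| < ε ∧ |act (f q - g q) (x k)| < ε

/-! ### Spreading models -/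

/-- The sequence `x` generates the unit vector basis of `(c₀₀, N)` as a spreading model. Here `x k`
is the term with number `k + 1`, so that `n ≤ k i + 1` says that all chosen terms have number at
least `n`. -/
def GeneratesSpreadingModel {E : Type} [NormedAddCommGroup E] [NormedSpace ℝ E] (x : ℕ → E)
    (N : Seminorm ℝ (ℕ →₀ ℝ)) : Prop :=
  ∃ δ : ℕ → ℝ, (∀ n, 0 < δ n) ∧ Antitone δ ∧ Tendsto δ atTop (𝓝 0) ∧
    ∀ (n : ℕ) (k : Fin n → ℕ), StrictMono k → (∀ i, n ≤ k i + 1) →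
      ∀ a : Fin n → ℝ, (∀ i, |a i| ≤ 1) →
        |‖∑ i, a i • x (k i)‖ - N (∑ i : Fin n, Finsupp.single i.val (a i))| < δ n

/-- The sequence `x` generates a spreading model equivalent to the unit vector basis of `c₀`. -/
def GeneratesC0SpreadingModel {E : Type} [NormedAddCommGroup E] [NormedSpace ℝ E]
    (x : ℕ → E) : Prop :=
  ∃ N : Seminorm ℝ (ℕ →₀ ℝ), GeneratesSpreadingModel x N ∧
    ∃ c C : ℝ, 0 < c ∧ ∀ a : ℕ →₀ ℝ, c * supNorm a ≤ N a ∧ N a ≤ C * supNorm a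

end

/-! ### Restrictions and the duality pairing -/

/-! The heart of the matter is an upper estimate: along a suitable subsequence `z`, every functional
of `W` is at most 4 on `∑ i ∈ I, c i • z i` when `|c i| ≤ 1` and `#I ≤ min I + 1`. Since `W` is the
least set closed under the operations, it is enough that the functionals of `W` all of whose
interval restrictions obey this bound form a closed set (`IsRapid.isClosedUnderOps_boundedOnSums`).

Type I, weight `n`. Index zero, made uniform in `IndexZero.exists_smallOn`, says that averages of
large size in an admissible very fast growing family have small total action on late terms. Very
fast growth makes every average after the first one that reaches the vector large, and the first is
controlled by the induction. So the terms late relative to `n` contribute about `4 / 2 ^ n`. On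
terms early relative to `n` the coefficients, of size at most `1 / 2 ^ n`, are negligible, except
possibly on the last such term, which contributes at most 1.

Type II. Let `z k` be the first term acted upon. The number of pairs used is at most half of
`maxSupp (z k)`. Among the later terms at most one is cut by the interval, and at most one is hit
substantially by a pair of high weight. On the other terms, high-weight pairs act negligibly, and
low-weight pairs are handled as in type I, their contributions being summable over the weights
(`IsRapid.abs_act_le_of_isSpecial`).

That no special sequence hits two terms at different places is where the branch index enters
(`Setup.eventually_not_doubleHit`). A zero β-index bounds the number of weights whose pairs hit a
given far term (`SmallOn.card_le_of_subset_hitWeights`). If double hits were generic, an ultrafilter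
could therefore choose one weight for each far term consistently; as a weight codes all pairs before
it, the sequences leading to these weights converge to a special branch that hits terms at
arbitrarily late places, against a zero branch index.

A diagonal choice gives the subsequence (`Setup.exists_isRapid_subsequence`), and Ramsey's theorem a
further one with a spreading model (`exists_generatesSpreadingModel`). The lower `c₀` estimate is
free, since `W` is stable under interval restrictions. The estimate for late terms in the type I
case, now known for all of `W`, is the second assertion. -/

theorem restrict_apply (E : Set ℕ+) (f : Vec) (a : ℕ+) :
    restrict E f a = E.indicator f a := by
  classical
  unfold restrict
  rw [Finsupp.filter_apply, Set.indicator_apply]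

theorem restrict_apply_of_mem {E : Set ℕ+} {a : ℕ+} (ha : a ∈ E) (f : Vec) :
    restrict E f a = f a := by
  rw [restrict_apply, Set.indicator_of_mem ha]

theorem restrict_apply_of_notMem {E : Set ℕ+} {a : ℕ+} (ha : a ∉ E) (f : Vec) :
    restrict E f a = 0 := by
  rw [restrict_apply, Set.indicator_of_notMem ha]

/-- Restriction to a set as a linear map. -/
noncomputable def restrictLinear (E : Set ℕ+) : Vec →ₗ[ℝ] Vec where
  toFun := restrict E
  map_add' f g := by
    ext a
    by_cases ha : a ∈ E <;> simp [restrict_apply, ha]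
  map_smul' c f := by
    ext a
    by_cases ha : a ∈ E <;> simp [restrict_apply, ha]

theorem restrict_add (E : Set ℕ+) (f g : Vec) :
    restrict E (f + g) = restrict E f + restrict E g := (restrictLinear E).map_add f g

theorem restrict_neg (E : Set ℕ+) (f : Vec) : restrict E (-f) = -restrict E f :=
  (restrictLinear E).map_neg f

theorem restrict_smul (E : Set ℕ+) (c : ℝ) (f : Vec) : restrict E (c • f) = c • restrict E f :=
  (restrictLinear E).map_smul c f

theorem restrict_sum {ι : Type*} (E : Set ℕ+) (s : Finset ι) (f : ι → Vec) :
    restrict E (∑ i ∈ s, f i) = ∑ i ∈ s, restrict E (f i) := map_sum (restrictLinear E) f s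

theorem restrict_restrict (E E' : Set ℕ+) (f : Vec) :
    restrict E (restrict E' f) = restrict (E ∩ E') f := by
  ext a
  by_cases ha : a ∈ E <;> by_cases hb : a ∈ E' <;> simp [restrict_apply, ha, hb]

theorem restrict_univ (f : Vec) : restrict Set.univ f = f := by
  ext a
  simp [restrict_apply]

theorem mem_support_restrict {E : Set ℕ+} {f : Vec} {a : ℕ+} :
    a ∈ (restrict E f).support ↔ a ∈ E ∧ a ∈ f.support := by
  by_cases ha : a ∈ E <;> simp [restrict_apply, ha]

theorem IsSignedRestriction.restrict {E E' : Set ℕ+} {f g : Vec}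
    (h : IsSignedRestriction E f g) (hE : E'.OrdConnected) :
    IsSignedRestriction (E' ∩ E) f (restrict E' g) := by
  refine ⟨hE.inter h.1, ?_⟩
  rcases h.2 with rfl | rfl
  · exact Or.inl (restrict_restrict _ _ _)
  · exact Or.inr (by rw [restrict_neg, restrict_restrict])

theorem Before.restrict {f g : Vec} (h : Before f g) (E : Set ℕ+) :
    Before (restrict E f) (restrict E g) := fun a ha b hb =>
  h a (mem_support_restrict.1 ha).2 b (mem_support_restrict.1 hb).2

theorem act_eq_sum (f x : Vec) {S : Finset ℕ+} (hS : x.support ⊆ S) :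
    act f x = ∑ a ∈ S, f a * x a := by
  rw [act_comm]
  refine (Finsupp.sum_of_support_subset x hS (fun i c => c * f i) (by simp)).trans ?_
  exact Finset.sum_congr rfl fun i _ => mul_comm _ _

/-- The pairing as a linear functional of its first argument. -/
noncomputable def actLeft (x : Vec) : Vec →ₗ[ℝ] ℝ where
  toFun f := act f x
  map_add' f g := by rw [act_comm, act_add, act_comm x, act_comm x]
  map_smul' c f := by rw [act_comm, act_smul, act_comm x]; rfl

/-- The pairing as a linear functional of its second argument. -/
noncomputable def actRight (f : Vec) : Vec →ₗ[ℝ] ℝ where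
  toFun x := act f x
  map_add' := act_add f
  map_smul' := act_smul f

theorem act_add_left (f g x : Vec) : act (f + g) x = act f x + act g x := (actLeft x).map_add f g

theorem act_sub_left (f g x : Vec) : act (f - g) x = act f x - act g x := (actLeft x).map_sub f g

theorem act_smul_left (c : ℝ) (f x : Vec) : act (c • f) x = c * act f x :=
  (actLeft x).map_smul c f

theorem act_zero_left (x : Vec) : act 0 x = 0 := (actLeft x).map_zero

theorem act_zero_right (f : Vec) : act f 0 = 0 := (actRight f).map_zero

theorem act_sum_left {ι : Type*} (s : Finset ι) (f : ι → Vec) (x : Vec) :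
    act (∑ i ∈ s, f i) x = ∑ i ∈ s, act (f i) x := map_sum (actLeft x) f s

theorem act_sum_right {ι : Type*} (s : Finset ι) (f : Vec) (x : ι → Vec) :
    act f (∑ i ∈ s, x i) = ∑ i ∈ s, act f (x i) := map_sum (actRight f) x s

theorem act_congr_left {f g x : Vec} (h : ∀ a ∈ x.support, f a = g a) : act f x = act g x := by
  rw [act_eq_sum f x subset_rfl, act_eq_sum g x subset_rfl]
  exact Finset.sum_congr rfl fun a ha => by rw [h a ha]

theorem act_restrict_of_subset {E : Set ℕ+} {x : Vec} (h : ∀ a ∈ x.support, a ∈ E) (f : Vec) :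
    act (restrict E f) x = act f x :=
  act_congr_left fun a ha => restrict_apply_of_mem (h a ha) f

theorem act_restrict_eq_zero {E : Set ℕ+} {x : Vec} (h : ∀ a ∈ x.support, a ∉ E) (f : Vec) :
    act (restrict E f) x = 0 := by
  rw [← act_zero_left x]
  exact act_congr_left fun a ha => by rw [restrict_apply_of_notMem (h a ha)]; rfl

theorem exists_mem_support_of_act_ne_zero {f x : Vec} (h : act f x ≠ 0) :
    ∃ a, a ∈ f.support ∧ a ∈ x.support := by
  rw [act_eq_sum f x subset_rfl] at h
  obtain ⟨a, ha, hne⟩ := Finset.exists_ne_zero_of_sum_ne_zero h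
  exact ⟨a, Finsupp.mem_support_iff.2 (left_ne_zero_of_mul hne), ha⟩

theorem abs_act_le_mul_card {f x : Vec} {c : ℝ} (hf : ∀ a, |f a| ≤ c) (hx : ∀ a, |x a| ≤ 1) :
    |act f x| ≤ c * x.support.card := by
  rw [act_eq_sum f x subset_rfl]
  refine (Finset.abs_sum_le_sum_abs _ _).trans ?_
  rw [mul_comm, ← nsmul_eq_mul]
  refine Finset.sum_le_card_nsmul _ _ _ fun a _ => ?_
  rw [abs_mul]
  exact (mul_le_of_le_one_right (abs_nonneg _) (hx a)).trans (hf a)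

theorem mem_ran_of_mem_support {f : Vec} {a : ℕ+} (ha : a ∈ f.support) : a ∈ ran f :=
  ⟨a, ha, a, ha, le_rfl, le_rfl⟩

theorem ordConnected_ran (f : Vec) : (ran f).OrdConnected := by
  refine ⟨fun a ⟨a₁, h₁, _, _, ha, _⟩ b ⟨_, _, b₂, h₂, _, hb⟩ c hc => ?_⟩
  exact ⟨a₁, h₁, b₂, h₂, ha.trans hc.1, hc.2.trans hb⟩

theorem Before.le_ran {f g : Vec} (h : Before f g) {a b : ℕ+} (ha : a ∈ ran f) (hb : b ∈ ran g) :
    a < b := by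
  obtain ⟨_, _, a₂, h₂, _, ha⟩ := ha
  obtain ⟨b₁, h₁, _, _, hb, _⟩ := hb
  exact ha.trans_lt ((h _ h₂ _ h₁).trans_le hb)

theorem IsBlock.lt_of_mem_support {x : ℕ → Vec} (hx : IsBlock x) (k : ℕ) {a : ℕ+}
    (ha : a ∈ (x k).support) : k < (a : ℕ) := by
  induction k generalizing a with
  | zero => exact a.pos
  | succ k ih =>
    obtain ⟨b, hb⟩ := Finsupp.support_nonempty_iff.2 (hx.1 k)
    have h1 : (b : ℕ) < a := hx.2 k (k + 1) (Nat.lt_succ_self k) b hb a ha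
    have h2 := ih hb
    omega

/-! ### Monotonicity in the generating set -/

theorem IsAlphaAverage.mono {G G' : Set Vec} (hG : G ⊆ G') {s : ℕ} {f : Vec}
    (h : IsAlphaAverage G s f) : IsAlphaAverage G' s f := by
  obtain ⟨h0, h1, d, hd, u, hb, hu, hf⟩ := h
  exact ⟨h0, hG h1, d, hd, u, hb, fun i => hG (hu i), hf⟩

theorem IsTypeI.mono {avg avg' : ℕ → Vec → Prop} (h : ∀ s f, avg s f → avg' s f) {n : ℕ} {g : Vec}
    (hg : IsTypeI avg n g) : IsTypeI avg' n g := by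
  obtain ⟨hn, d, u, s, hu, hrest⟩ := hg
  exact ⟨hn, d, u, s, fun q => h _ _ (hu q), hrest⟩

theorem IsTypeIAlpha.mono {G G' : Set Vec} (hG : G ⊆ G') {n : ℕ} {f : Vec}
    (h : IsTypeIAlpha G n f) : IsTypeIAlpha G' n f :=
  IsTypeI.mono (fun _ _ => IsAlphaAverage.mono hG) h

theorem IsSpecial.mono {P : Setup} {G G' : Set Vec} (hG : G ⊆ G') {d : ℕ} {f g : ℕ → Vec}
    {w : ℕ → ℕ} (h : IsSpecial P G d f g w) : IsSpecial P G' d f g w := by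
  obtain ⟨h0, h1, h2, h3, h4⟩ := h
  exact ⟨h0, h1, h2, fun q hq => ⟨(h3 q hq).1.mono hG, (h3 q hq).2.mono hG⟩, h4⟩

theorem IsTypeIIPlus.mono {P : Setup} {G G' : Set Vec} (hG : G ⊆ G') {A : Set ℕ} {f : Vec}
    (h : IsTypeIIPlus P G A f) : IsTypeIIPlus P G' A f := by
  obtain ⟨d, u, v, w, F, E, hs, hrest⟩ := h
  exact ⟨d, u, v, w, F, E, hs.mono hG, hrest⟩

theorem IsTypeIIMinus.mono {P : Setup} {G G' : Set Vec} (hG : G ⊆ G') {A : Set ℕ} {f : Vec}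
    (h : IsTypeIIMinus P G A f) : IsTypeIIMinus P G' A f := by
  obtain ⟨d, u, v, w, F, c, E, hs, hrest⟩ := h
  exact ⟨d, u, v, w, F, c, E, hs.mono hG, hrest⟩

theorem IsTypeII.mono {P : Setup} {G G' : Set Vec} (hG : G ⊆ G') {A : Set ℕ} {f : Vec}
    (h : IsTypeII P G A f) : IsTypeII P G' A f :=
  h.imp (IsTypeIIPlus.mono hG) (IsTypeIIMinus.mono hG)

theorem IsBetaAverage.mono {P : Setup} {G G' : Set Vec} (hG : G ⊆ G') {s : ℕ} {f : Vec}
    (h : IsBetaAverage P G s f) : IsBetaAverage P G' s f := by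
  obtain ⟨h0, h1, d, hd, u, A, hu, hA, hf⟩ := h
  exact ⟨h0, hG h1, d, hd, u, A, fun i => ⟨hG (hu i).1, (hu i).2.mono hG⟩, hA, hf⟩

theorem IsTypeIBeta.mono {P : Setup} {G G' : Set Vec} (hG : G ⊆ G') {n : ℕ} {f : Vec}
    (h : IsTypeIBeta P G n f) : IsTypeIBeta P G' n f :=
  IsTypeI.mono (fun _ _ => IsBetaAverage.mono hG) h

theorem Setup.W_subset {P : Setup} {G : Set Vec} (hG : IsClosedUnderOps P G) : P.W ⊆ G :=
  Set.sInter_subset_of_mem hG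

theorem Setup.isClosedUnderOps_W (P : Setup) : IsClosedUnderOps P P.W where
  basis_mem n _ hG := hG.basis_mem n
  neg_mem f hf _ hG := hG.neg_mem f (hf _ hG)
  restrict_mem f hf E hE _ hG := hG.restrict_mem f (hf _ hG) E hE
  convex_mem f hf g hg r h0 h1 _ hG := hG.convex_mem f (hf _ hG) g (hg _ hG) r h0 h1
  alpha_mem n f hf _ hG := hG.alpha_mem n f (hf.mono (P.W_subset hG))
  beta_mem n f hf _ hG := hG.beta_mem n f (hf.mono (P.W_subset hG))
  plus_mem A f hf _ hG := hG.plus_mem A f (hf.mono (P.W_subset hG))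
  minus_mem A f hf _ hG := hG.minus_mem A f (hf.mono (P.W_subset hG))

/-! ### Restrictions of functionals -/

theorem IsTypeI.restrict {avg : ℕ → Vec → Prop} {n : ℕ} {g : Vec} (h : IsTypeI avg n g)
    {E : Set ℕ+} (hE : E.OrdConnected) : IsTypeI avg n (restrict E g) := by
  obtain ⟨hn, d, u, s, hu, hv, ha, E', hE'⟩ := h
  exact ⟨hn, d, u, s, hu, hv, ha, E ∩ E', hE'.restrict hE⟩

theorem IsTypeIIPlus.restrict {P : Setup} {G : Set Vec} {A : Set ℕ} {f : Vec}
    (h : IsTypeIIPlus P G A f) {E : Set ℕ+} (hE : E.OrdConnected) :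
    ∃ A' ⊆ A, IsTypeIIPlus P G A' (restrict E f) := by
  obtain ⟨d, u, v, w, F, E', hs, hne, hF, hmin, hE', rfl⟩ := h
  refine ⟨_, ?_, d, u, v, w, F, E ∩ E', hs, hne, hF, hmin, hE'.restrict hE, rfl⟩
  rintro n ⟨q, hq, hn, hr⟩
  exact ⟨q, hq, hn, hr.mono (Set.inter_subset_inter_right _ Set.inter_subset_right)⟩

theorem IsTypeIIMinus.restrict {P : Setup} {G : Set Vec} {A : Set ℕ} {f : Vec}
    (h : IsTypeIIMinus P G A f) {E : Set ℕ+} (hE : E.OrdConnected) :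
    ∃ A' ⊆ A, IsTypeIIMinus P G A' (restrict E f) := by
  obtain ⟨d, u, v, w, F, c, E', hs, hne, hF, hmin, hc, hE', rfl⟩ := h
  refine ⟨_, ?_, d, u, v, w, F, c, E ∩ E', hs, hne, hF, hmin, hc, hE'.restrict hE, rfl⟩
  rintro n ⟨q, hq, hn, hr⟩
  exact ⟨q, hq, hn, hr.mono (Set.inter_subset_inter_right _ Set.inter_subset_right)⟩

theorem IsTypeII.restrict {P : Setup} {G : Set Vec} {A : Set ℕ} {f : Vec}
    (h : IsTypeII P G A f) {E : Set ℕ+} (hE : E.OrdConnected) :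
    ∃ A' ⊆ A, IsTypeII P G A' (restrict E f) := by
  rcases h with h | h
  · obtain ⟨A', hA', h'⟩ := h.restrict hE
    exact ⟨A', hA', Or.inl h'⟩
  · obtain ⟨A', hA', h'⟩ := h.restrict hE
    exact ⟨A', hA', Or.inr h'⟩

theorem IsBetaAverage.restrict {P : Setup} {s : ℕ} {f : Vec} (h : IsBetaAverage P P.W s f)
    {E : Set ℕ+} (hE : E.OrdConnected) : IsBetaAverage P P.W s (restrict E f) := by
  obtain ⟨h0, h1, d, hd, u, A, hu, hA, rfl⟩ := h
  have hW := P.isClosedUnderOps_W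
  choose A' hsub hA' using fun i => (hu i).2.restrict hE
  refine ⟨h0, hW.restrict_mem _ h1 E hE, d, hd, fun i => _root_.restrict E (u i), A',
    fun i => ⟨hW.restrict_mem _ (hu i).1 E hE, hA' i⟩,
    fun i j hij => (hA i j hij).mono (hsub i) (hsub j), ?_⟩
  rw [restrict_smul, restrict_sum]

/-- A block family has no zero members, so the pieces killed by `E` are dropped and the others
renumbered. The size `s` is unaffected, because it only bounds the number of pieces from above. -/
theorem IsAlphaAverage.restrict {P : Setup} {s : ℕ} {f : Vec} (h : IsAlphaAverage P.W s f)
    {E : Set ℕ+} (hE : E.OrdConnected) : IsAlphaAverage P.W s (restrict E f) := by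
  classical
  obtain ⟨h0, h1, d, hd, u, hb, hu, rfl⟩ := h
  have hW := P.isClosedUnderOps_W
  let S : Finset (Fin d) := Finset.univ.filter fun i => _root_.restrict E (u i) ≠ 0
  let e := S.orderEmbOfFin rfl
  have hS : ∀ i, e i ∈ S := S.orderEmbOfFin_mem rfl
  refine ⟨h0, hW.restrict_mem _ h1 E hE, S.card, ?_, fun i => _root_.restrict E (u (e i)), ⟨?_, ?_⟩,
    fun i => hW.restrict_mem _ (hu _) E hE, ?_⟩
  · exact ((Finset.card_le_univ S).trans (by simp)).trans hd
  · exact fun i => (Finset.mem_filter.1 (hS i)).2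
  · exact fun i j hij => (hb.2 _ _ (e.strictMono hij)).restrict E
  · rw [restrict_smul, restrict_sum]
    congr 1
    have h2 : ∑ i, _root_.restrict E (u i) = ∑ i ∈ S, _root_.restrict E (u i) :=
      (Finset.sum_filter_ne_zero _).symm
    exact h2.trans ((Finset.sum_congr (Finset.image_orderEmbOfFin_univ S rfl).symm
      fun _ _ => rfl).trans (Finset.sum_image fun i _ j _ hij => e.injective hij))

/-- The averages have disjoint supports, so at each coordinate only one of them counts. This is what
makes functionals of high weight negligible on a fixed vector. -/
theorem IsTypeI.abs_le_inv_two_pow {avg : ℕ → Vec → Prop} {n : ℕ} {g : Vec} (h : IsTypeI avg n g)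
    (havg : ∀ s f, avg s f → ∀ a, |f a| ≤ 1) (a : ℕ+) : |g a| ≤ 1 / 2 ^ n := by
  obtain ⟨-, d, h, s, hs, hv, -, E, hE⟩ := h
  refine (hE.abs_le a).trans ?_
  have h1 : |(∑ q, h q) a| ≤ 1 := by
    refine abs_sum_le_one_of_disjoint _ h a ?_ fun i _ => havg _ _ (hs i) a
    intro i _ j _ hij hne
    rcases lt_or_gt_of_ne hij with hlt | hlt
    · exact (hv.1.2 i j hlt).apply_eq_zero hne
    · exact (hv.1.2 j i hlt).apply_eq_zero' hne
  rw [Finsupp.smul_apply, smul_eq_mul, abs_mul, abs_of_nonneg (by positivity)]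
  exact mul_le_of_le_one_right (by positivity) h1

theorem IsTypeIAlpha.abs_le_inv_two_pow {P : Setup} {n : ℕ} {g : Vec}
    (h : IsTypeIAlpha P.W n g) (a : ℕ+) : |g a| ≤ 1 / 2 ^ n :=
  IsTypeI.abs_le_inv_two_pow h (fun _ _ hf => P.abs_le_one_of_mem_W hf.2.1) a

/-! ### Rationality of the norming set -/

/-- All coordinates are rational. -/
def IsRational (f : Vec) : Prop := ∀ a, ∃ r : ℚ, f a = (r : ℝ)

theorem IsRational.add {f g : Vec} (hf : IsRational f) (hg : IsRational g) :
    IsRational (f + g) := fun a => by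
  obtain ⟨r, hr⟩ := hf a
  obtain ⟨s, hs⟩ := hg a
  exact ⟨r + s, by simp [hr, hs]⟩

theorem IsRational.smul {f : Vec} (hf : IsRational f) (c : ℚ) : IsRational ((c : ℝ) • f) :=
  fun a => by
    obtain ⟨r, hr⟩ := hf a
    exact ⟨c * r, by simp [hr]⟩

theorem IsRational.neg {f : Vec} (hf : IsRational f) : IsRational (-f) := fun a => by
  obtain ⟨r, hr⟩ := hf a
  exact ⟨-r, by simp [hr]⟩

theorem IsRational.restrict {f : Vec} (hf : IsRational f) (E : Set ℕ+) :
    IsRational (restrict E f) := fun a => by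
  by_cases ha : a ∈ E
  · rw [restrict_apply_of_mem ha]
    exact hf a
  · exact ⟨0, by rw [restrict_apply_of_notMem ha, Rat.cast_zero]⟩

theorem IsRational.sum {ι : Type*} (s : Finset ι) {f : ι → Vec} (hf : ∀ i ∈ s, IsRational (f i)) :
    IsRational (∑ i ∈ s, f i) :=
  Finset.sum_induction f IsRational (fun _ _ => IsRational.add)
    (fun _ => ⟨0, by simp⟩) hf

theorem IsSignedRestriction.isRational {E : Set ℕ+} {f g : Vec} (h : IsSignedRestriction E f g)
    (hf : IsRational f) : IsRational g := by
  rcases h.2 with rfl | rfl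
  · exact hf.restrict E
  · exact (hf.restrict E).neg

theorem IsTypeI.isRational {avg : ℕ → Vec → Prop} {n : ℕ} {g : Vec} (h : IsTypeI avg n g)
    (havg : ∀ s f, avg s f → IsRational f) : IsRational g := by
  obtain ⟨-, d, h, s, hs, -, -, E, hE⟩ := h
  refine hE.isRational ?_
  have := (IsRational.sum Finset.univ fun q _ => havg _ _ (hs q)).smul (1 / 2 ^ n)
  simpa using this

/-- The coding function is controlled only on block sequences with rational coordinates; rationality
of `W` makes every initial segment of a special sequence codable. -/
theorem isClosedUnderOps_isRational (P : Setup) : IsClosedUnderOps P {f | IsRational f} where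
  basis_mem n a := by
    rcases eq_or_ne a n with rfl | h
    · exact ⟨1, by simp⟩
    · exact ⟨0, by simp [h]⟩
  neg_mem f hf := IsRational.neg hf
  restrict_mem f hf E _ := IsRational.restrict hf E
  convex_mem f hf g hg r _ _ := by
    have := (IsRational.smul hf r).add (IsRational.smul hg (1 - r))
    simpa using this
  alpha_mem n f hf := hf.isRational fun _ _ h => h.2.1
  beta_mem n f hf := hf.isRational fun _ _ h => h.2.1
  plus_mem A h := by
    rintro ⟨d, f, g, w, F, E, hs, -, hF, -, hE, -⟩
    have h1 : ∀ q ∈ F, IsRational (f q + g q) := fun q hq =>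
      ((hs.2.2.2.1 q (hF q hq)).1.isRational fun _ _ h => h.2.1).add
        ((hs.2.2.2.1 q (hF q hq)).2.isRational fun _ _ h => h.2.1)
    have := (IsRational.sum F h1).smul (1 / 2)
    refine hE.isRational ?_
    simpa using this
  minus_mem A h := by
    rintro ⟨d, f, g, w, F, c, E, hs, -, hF, -, -, hE, -⟩
    have h1 : ∀ q ∈ F, IsRational ((c q : ℝ) • (f q - g q)) := fun q hq => by
      rw [sub_eq_add_neg]
      exact (((hs.2.2.2.1 q (hF q hq)).1.isRational fun _ _ h => h.2.1).add
        ((hs.2.2.2.1 q (hF q hq)).2.isRational fun _ _ h => h.2.1).neg).smul _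
    have := (IsRational.sum F h1).smul (1 / 2)
    refine hE.isRational ?_
    simpa using this

theorem Setup.isRational_of_mem_W {P : Setup} {f : Vec} (hf : f ∈ P.W) : IsRational f :=
  P.W_subset (isClosedUnderOps_isRational P) hf

/-! ### Schreier families are hereditary and spreading -/

theorem image_mem_schreier_of_le {ι : Type*} (n : ℕ) {F : Finset ℕ+} (hF : F ∈ schreier n)
    {T : Finset ι} (hT : T.Nonempty) {m m' : ι → ℕ+} (hm : ∀ q ∈ T, m q ∈ F)
    (hlt : ∀ q ∈ T, ∀ r ∈ T, m q < m r → m' q < m' r)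
    (heq : ∀ q ∈ T, ∀ r ∈ T, m q = m r → m' q = m' r) (hle : ∀ q ∈ T, m q ≤ m' q) :
    T.image m' ∈ schreier n := by
  classical
  induction n generalizing F T with
  | zero =>
    obtain ⟨a, rfl⟩ := hF
    obtain ⟨q, hq⟩ := hT
    refine ⟨m' q, Finset.eq_singleton_iff_unique_mem.2 ⟨Finset.mem_image_of_mem _ hq, ?_⟩⟩
    intro b hb
    obtain ⟨r, hr, rfl⟩ := Finset.mem_image.1 hb
    exact heq r hr q hq
      ((Finset.mem_singleton.1 (hm r hr)).trans (Finset.mem_singleton.1 (hm q hq)).symm)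
  | succ n ih =>
    obtain ⟨k, G, -, hG, hlt', hmin, rfl⟩ := hF
    let T' : Fin k → Finset ι := fun j => T.filter fun q => m q ∈ G j
    let S : Finset (Fin k) := Finset.univ.filter fun j => (T' j).Nonempty
    let e := S.orderEmbOfFin rfl
    have heS : ∀ j, e j ∈ S := S.orderEmbOfFin_mem rfl
    have hT' : ∀ j q, q ∈ T' j → q ∈ T ∧ m q ∈ G j := fun j q hq => Finset.mem_filter.1 hq
    have hcov : ∀ q ∈ T, ∃ j, q ∈ T' (e j) := by
      intro q hq
      obtain ⟨j, -, hj⟩ := Finset.mem_biUnion.1 (hm q hq)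
      have hqj : q ∈ T' j := Finset.mem_filter.2 ⟨hq, hj⟩
      have hjS : j ∈ S := Finset.mem_filter.2 ⟨Finset.mem_univ _, q, hqj⟩
      rw [← Finset.mem_coe, ← Finset.range_orderEmbOfFin S rfl] at hjS
      obtain ⟨i, rfl⟩ := hjS
      exact ⟨i, hqj⟩
    have hcard : S.card ≤ k := (Finset.card_le_univ S).trans (by simp)
    refine ⟨S.card, fun j => (T' (e j)).image m', ?_, ?_, ?_, ?_, ?_⟩
    · obtain ⟨q, hq⟩ := hT
      obtain ⟨j, -⟩ := hcov q hq
      exact j.pos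
    · intro j
      refine ih (hG (e j)) (Finset.mem_filter.1 (heS j)).2 (fun q hq => (hT' _ _ hq).2)
        (fun q hq r hr => hlt q (hT' _ _ hq).1 r (hT' _ _ hr).1)
        (fun q hq r hr => heq q (hT' _ _ hq).1 r (hT' _ _ hr).1)
        (fun q hq => hle q (hT' _ _ hq).1)
    · intro i j hij a ha b hb
      obtain ⟨q, hq, rfl⟩ := Finset.mem_image.1 ha
      obtain ⟨r, hr, rfl⟩ := Finset.mem_image.1 hb
      exact hlt q (hT' _ _ hq).1 r (hT' _ _ hr).1
        (hlt' _ _ (e.strictMono hij) _ (hT' _ _ hq).2 _ (hT' _ _ hr).2)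
    · intro j a ha
      obtain ⟨q, hq, rfl⟩ := Finset.mem_image.1 ha
      refine hcard.trans ((hmin _ _ (hT' _ _ hq).2).trans ?_)
      exact_mod_cast hle q (hT' _ _ hq).1
    · ext b
      simp only [Finset.mem_image, Finset.mem_biUnion, Finset.mem_univ, true_and]
      constructor
      · rintro ⟨q, hq, rfl⟩
        obtain ⟨j, hj⟩ := hcov q hq
        exact ⟨j, q, hj, rfl⟩
      · rintro ⟨j, q, hq, rfl⟩
        exact ⟨q, (hT' _ _ hq).1, rfl⟩

theorem singleton_mem_schreier_one (a : ℕ+) : {a} ∈ schreier 1 := by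
  rw [mem_schreier_one]
  refine ⟨Finset.singleton_nonempty a, fun b hb => ?_⟩
  rw [Finset.mem_singleton.1 hb, Finset.card_singleton]
  exact a.pos

/-! ### The index of a block sequence -/

theorem exists_strictMono_enumeration {ι : Type*} {S : Set ι} {m : ι → ℕ} (hm : Set.InjOn m S)
    (hS : S.Infinite) :
    ∃ p : ℕ → ι, (∀ i, p i ∈ S) ∧ StrictMono (m ∘ p) ∧ ∀ t ∈ S, ∃ i, p i = t := by
  have hinf : Infinite (m '' S) := (hS.image hm).to_subtype
  classical
  let e := Nat.Subtype.orderIsoOfNat (m '' S)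
  choose p hp using fun i => (e i).2
  refine ⟨p, fun i => (hp i).1, fun i j hij => ?_, fun t ht => ?_⟩
  · simp only [Function.comp_apply, (hp i).2, (hp j).2]
    exact e.strictMono hij
  · refine ⟨e.symm ⟨m t, t, ht, rfl⟩, hm (hp _).1 ht ?_⟩
    rw [(hp _).2, OrderIso.apply_symm_apply]

/-- The averages with sizes above `K` occurring in `𝒮ₙ`-admissible very fast growing families
act on `z` with total absolute value below `ε`. -/
def SmallOn (avg : ℕ → Vec → Prop) (n K : ℕ) (ε : ℝ) (z : Vec) : Prop :=
  ∀ (d : ℕ) (h : Fin d → Vec) (s : Fin d → ℕ), (∀ q, avg (s q) (h q)) → VeryFastGrowing h s →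
    Admissible n Finset.univ h → ∀ E : Set ℕ+, E.OrdConnected → ∀ T : Finset (Fin d),
      (∀ q ∈ T, K < s q) → ∑ q ∈ T, |act (restrict E (h q)) z| < ε

theorem exists_isLeast_support {f : Vec} (hf : f ≠ 0) : ∃ m : ℕ+, IsLeast (f.support : Set ℕ+) m :=
  ⟨_, Finset.isLeast_min' f.support (Finsupp.support_nonempty_iff.2 hf)⟩

/-- A gliding hump. If the claim fails, each `K` has a bad family, with sizes above `K`, acting on a
term beyond `K`. Bad families for a rapidly growing sequence of thresholds, cut down to the ranges
of their terms, merge into a single infinite very fast growing sequence that contradicts the index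
being zero. -/
theorem IndexZero.exists_smallOn {avg : ℕ → Vec → Prop}
    (havg : ∀ s f, avg s f → ∀ E : Set ℕ+, E.OrdConnected → avg s (restrict E f))
    {x : ℕ → Vec} (hx : IsBlock x) (hzero : IndexZero avg x) {n : ℕ} (hn : 1 ≤ n) {ε : ℝ}
    (hε : 0 < ε) : ∃ K, ∀ l ≥ K, SmallOn avg n K ε (x l) := by
  classical
  by_contra hcon
  simp only [SmallOn] at hcon
  push Not at hcon
  choose l hl d h s hav hvfg hadm E hE T hTs hT using hcon
  -- The next threshold exceeds the term used, all sizes of its family and `2 ^ a` for `a` in its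
  -- support, which is all that very fast growth asks between two consecutive groups.
  let bound : ℕ → ℕ := fun K => l K + 1 + ∑ q, s K q + ∑ a ∈ (x (l K)).support, 2 ^ (a : ℕ)
  have hb_l : ∀ K, l K < bound K := fun K => by simp only [bound]; omega
  have hb_s : ∀ K q, s K q < bound K := fun K q => by
    have := Finset.single_le_sum (f := s K) (fun _ _ => Nat.zero_le _) (Finset.mem_univ q)
    simp only [bound]; omega
  have hb_x : ∀ K, ∀ a ∈ (x (l K)).support, 2 ^ (a : ℕ) < bound K := fun K a ha => by
    have := Finset.single_le_sum (f := fun a : ℕ+ => 2 ^ (a : ℕ)) (fun _ _ => Nat.zero_le _) ha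
    simp only [bound]; omega
  let K : ℕ → ℕ := fun i => bound^[i] 0
  have hK : ∀ i, K (i + 1) = bound (K i) := fun i => Function.iterate_succ_apply' _ _ _
  have hKmono : StrictMono K := strictMono_nat_of_lt_succ fun i => by
    rw [hK]; exact (hl _).trans_lt (hb_l _)
  have hKle : ∀ i j, i < j → bound (K i) ≤ K j := fun i j hij => by
    rw [← hK]; exact hKmono.monotone hij
  let φ : ℕ → ℕ := fun i => l (K i)
  have hφ : StrictMono φ := strictMono_nat_of_lt_succ fun i =>
    (hb_l (K i)).trans_le ((hKle i (i + 1) (Nat.lt_succ_self i)).trans (hl _))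
  -- Cutting to the range of the term leaves the action on it unchanged and makes different groups
  -- successive.
  let R : ℕ → Set ℕ+ := fun i => E (K i) ∩ ran (x (φ i))
  have hR : ∀ i, (R i).OrdConnected := fun i => (hE _).inter (ordConnected_ran _)
  let ι := Σ i : ℕ, Fin (d (K i))
  let H : ι → Vec := fun t => restrict (R t.1) (h (K t.1) t.2)
  let Sz : ι → ℕ := fun t => s (K t.1) t.2
  let I : Set ι := {t | t.2 ∈ T (K t.1) ∧ H t ≠ 0}
  have hH_avg : ∀ t, avg (Sz t) (H t) := fun t => havg _ _ (hav _ _) _ (hR _)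
  have hH_supp : ∀ t, ∀ a ∈ (H t).support, a ∈ ran (x (φ t.1)) := fun t a ha =>
    (mem_support_restrict.1 ha).1.2
  have hsize : ∀ t ∈ I, K t.1 < Sz t := fun t ht => hTs _ _ ht.1
  have hran : ∀ i, ∀ a ∈ ran (x (φ i)), 2 ^ (a : ℕ) < bound (K i) := by
    rintro i a ⟨_, _, b, hb, _, hab⟩
    exact (Nat.pow_le_pow_right two_pos hab).trans_lt (hb_x _ _ hb)
  -- The lexicographic order on (group, member). On the surviving members it coincides with the
  -- order of the minima of supports, by which they are enumerated below.
  let rel : ι → ι → Prop := fun t t' => t.1 < t'.1 ∨ ∃ e : t.1 = t'.1, e ▸ t.2 < t'.2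
  have hrel : ∀ t ∈ I, ∀ t' ∈ I, rel t t' →
      Before (H t) (H t') ∧ Sz t < Sz t' ∧ ∀ a ∈ (H t).support, 2 ^ (a : ℕ) < Sz t' := by
    rintro ⟨i, q⟩ ht ⟨j, r⟩ ht' (hij | ⟨e, hqr⟩)
    · refine ⟨?_, ?_, ?_⟩
      · exact fun a ha b hb => (hx.2 _ _ (hφ hij)).le_ran (hH_supp _ a ha) (hH_supp _ b hb)
      · exact (hb_s (K i) q).trans ((hKle i j hij).trans_lt (hsize _ ht'))
      · exact fun a ha => (hran i a (hH_supp _ a ha)).trans ((hKle i j hij).trans_lt (hsize _ ht'))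
    · dsimp only at e
      subst e
      have h1 := (hvfg (K i)).2 q r hqr
      exact ⟨((hvfg (K i)).1.2 q r hqr).restrict _, h1.1,
        fun a ha => h1.2 a (mem_support_restrict.1 ha).2⟩
  have htri : ∀ t t' : ι, t = t' ∨ rel t t' ∨ rel t' t := by
    rintro ⟨i, q⟩ ⟨j, r⟩
    rcases lt_trichotomy i j with hij | rfl | hij
    · exact Or.inr (Or.inl (Or.inl hij))
    · rcases lt_trichotomy q r with hqr | rfl | hqr
      · exact Or.inr (Or.inl (Or.inr ⟨rfl, hqr⟩))
      · exact Or.inl rfl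
      · exact Or.inr (Or.inr (Or.inr ⟨rfl, hqr⟩))
    · exact Or.inr (Or.inr (Or.inl hij))
  have hmin : ∀ t : ι, ∃ m : ℕ+, t ∈ I → IsLeast ((H t).support : Set ℕ+) m := fun t => by
    by_cases ht : t ∈ I
    · obtain ⟨m, hm⟩ := exists_isLeast_support ht.2
      exact ⟨m, fun _ => hm⟩
    · exact ⟨1, fun h => absurd h ht⟩
  choose m hm using hmin
  have hm_rel : ∀ t ∈ I, ∀ t' ∈ I, rel t t' → m t < m t' := fun t ht t' ht' hr =>
    (hrel t ht t' ht' hr).1 _ (hm t ht).1 _ (hm t' ht').1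
  have hrel_of_lt : ∀ t ∈ I, ∀ t' ∈ I, m t < m t' → rel t t' := by
    intro t ht t' ht' hlt
    rcases htri t t' with rfl | hr | hr
    · exact absurd hlt (lt_irrefl _)
    · exact hr
    · exact absurd hlt (hm_rel t' ht' t ht hr).asymm
  have hm_inj : Set.InjOn (fun t => (m t : ℕ)) I := by
    intro t ht t' ht' he
    have he' : m t = m t' := PNat.coe_injective he
    rcases htri t t' with h | hr | hr
    · exact h
    · exact absurd he' (hm_rel t ht t' ht' hr).ne
    · exact absurd he' (hm_rel t' ht' t ht hr).ne'
  let T' : ∀ i, Finset (Fin (d (K i))) := fun i => (T (K i)).filter fun q => H ⟨i, q⟩ ≠ 0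
  have hT' : ∀ i q, q ∈ T' i → (⟨i, q⟩ : ι) ∈ I := fun i q hq => Finset.mem_filter.1 hq
  have hsum : ∀ i, ε ≤ ∑ q ∈ T' i, |act (H ⟨i, q⟩) (x (φ i))| := by
    intro i
    refine (hT (K i)).trans (le_of_eq ?_)
    rw [Finset.sum_filter_of_ne]
    · refine Finset.sum_congr rfl fun q _ => ?_
      have : H ⟨i, q⟩ = restrict (ran (x (φ i))) (restrict (E (K i)) (h (K i) q)) := by
        rw [restrict_restrict, Set.inter_comm]
      rw [this, act_restrict_of_subset fun a ha => mem_ran_of_mem_support ha]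
    · intro q _ hne h0
      rw [h0, act_zero_left, abs_zero] at hne
      exact hne rfl
  have hT'ne : ∀ i, (T' i).Nonempty := fun i => by
    rw [Finset.nonempty_iff_ne_empty]
    intro h0
    have := hsum i
    rw [h0, Finset.sum_empty] at this
    linarith
  have hIinf : I.Infinite := by
    choose q hq using hT'ne
    refine Set.infinite_of_injective_forall_mem (f := fun i => (⟨i, q i⟩ : ι)) ?_
      fun i => hT' i _ (hq i)
    exact fun i j hij => congrArg Sigma.fst hij
  obtain ⟨p, hpI, hpmono, hpsurj⟩ := exists_strictMono_enumeration hm_inj hIinf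
  have hpos : ∀ t : ι, ∃ i, t ∈ I → p i = t := fun t => by
    by_cases ht : t ∈ I
    · obtain ⟨i, hi⟩ := hpsurj t ht
      exact ⟨i, fun _ => hi⟩
    · exact ⟨0, fun h => absurd h ht⟩
  choose pos hpos using hpos
  have hprel : ∀ i j, i < j → rel (p i) (p j) := fun i j hij =>
    hrel_of_lt _ (hpI i) _ (hpI j) (hpmono hij)
  have hvfgH : VeryFastGrowing (H ∘ p) (Sz ∘ p) :=
    ⟨⟨fun i => (hpI i).2, fun i j hij => (hrel _ (hpI i) _ (hpI j) (hprel i j hij)).1⟩,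
      fun i j hij => (hrel _ (hpI i) _ (hpI j) (hprel i j hij)).2⟩
  have hposinj : ∀ i, Set.InjOn (fun q => pos ⟨i, q⟩) (T' i) := by
    intro i q hq r hr he
    have h1 := hpos _ (hT' i q hq)
    have h2 := hpos _ (hT' i r hr)
    dsimp only at he
    rw [he, h2] at h1
    exact eq_of_heq (Sigma.mk.inj h1.symm).2
  have key := hzero n hn (H ∘ p) (Sz ∘ p) (fun i => hH_avg _) hvfgH
    (fun i => (T' i).image fun q => pos ⟨i, q⟩) ?_ ?_ φ hφ
  · have h1 := key.eventually (gt_mem_nhds hε)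
    obtain ⟨i, hi⟩ := h1.exists
    rw [Finset.sum_image (hposinj i)] at hi
    refine absurd (hsum i) (not_le.2 (lt_of_eq_of_lt (Finset.sum_congr rfl fun q hq => ?_) hi))
    rw [Function.comp_apply, hpos _ (hT' i q hq)]
  · intro i j hij a ha b hb
    obtain ⟨q, hq, rfl⟩ := Finset.mem_image.1 ha
    obtain ⟨r, hr, rfl⟩ := Finset.mem_image.1 hb
    rw [← hpmono.lt_iff_lt]
    simp only [Function.comp_apply]
    rw [hpos _ (hT' i q hq), hpos _ (hT' j r hr)]
    exact hm_rel _ (hT' i q hq) _ (hT' j r hr) (Or.inl hij)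
  · intro i
    refine ⟨m ∘ p, fun q _ => hm _ (hpI q), ?_⟩
    obtain ⟨m₀, hm₀, hsch⟩ := hadm (K i)
    have himg : (((T' i).image fun q => pos ⟨i, q⟩).image (m ∘ p)) =
        (T' i).image fun q => m ⟨i, q⟩ := by
      rw [Finset.image_image]
      refine Finset.image_congr fun q hq => ?_
      simp only [Function.comp_apply]
      rw [hpos _ (hT' i q hq)]
    rw [himg]
    have hm₀lt : ∀ q r, q < r → m₀ q < m₀ r := fun q r hqr =>
      (hvfg (K i)).1.2 q r hqr _ (hm₀ q (Finset.mem_univ _)).1 _ (hm₀ r (Finset.mem_univ _)).1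
    have hm₀mono : StrictMono m₀ := fun q r => hm₀lt q r
    -- Cutting and discarding keep the group admissible: some members are lost, and the minima of
    -- the others can only move to the right.
    refine image_mem_schreier_of_le n hsch (hT'ne i) (m := m₀)
      (fun q _ => Finset.mem_image_of_mem _ (Finset.mem_univ q)) ?_ ?_ ?_
    · exact fun q hq r hr hlt => hm_rel _ (hT' i q hq) _ (hT' i r hr)
        (Or.inr ⟨rfl, hm₀mono.lt_iff_lt.1 hlt⟩)
    · exact fun q hq r hr he => by rw [hm₀mono.injective he]
    · exact fun q hq => (hm₀ q (Finset.mem_univ _)).2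
        (mem_support_restrict.1 (hm _ (hT' i q hq)).1).2

theorem Setup.exists_smallOn_alpha {P : Setup} {x : ℕ → Vec} (hx : IsBlock x)
    (hα : AlphaIndexZero P x) {n : ℕ} (hn : 1 ≤ n) {ε : ℝ} (hε : 0 < ε) :
    ∃ K, ∀ l ≥ K, SmallOn (IsAlphaAverage P.W) n K ε (x l) :=
  IndexZero.exists_smallOn (fun _ _ hf _ hE => hf.restrict hE) hx hα hn hε

theorem Setup.exists_smallOn_beta {P : Setup} {x : ℕ → Vec} (hx : IsBlock x)
    (hβ : BetaIndexZero P x) {n : ℕ} (hn : 1 ≤ n) {ε : ℝ} (hε : 0 < ε) :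
    ∃ K, ∀ l ≥ K, SmallOn (IsBetaAverage P P.W) n K ε (x l) :=
  IndexZero.exists_smallOn (fun _ _ hf _ hE => hf.restrict hE) hx hβ hn hε

theorem SmallOn.mono {avg : ℕ → Vec → Prop} {n K K' : ℕ} {ε : ℝ} {z : Vec}
    (h : SmallOn avg n K ε z) (hK : K ≤ K') : SmallOn avg n K' ε z :=
  fun d u s hu hv ha E hE T hT => h d u s hu hv ha E hE T fun q hq => hK.trans_lt (hT q hq)

/-- Only the first average that reaches a vector supported beyond `K` can act on it
substantially. -/
theorem abs_sum_act_le {avg : ℕ → Vec → Prop} {n K d : ℕ} {h : Fin d → Vec} {s : Fin d → ℕ}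
    (havg : ∀ q, avg (s q) (h q)) (hv : VeryFastGrowing h s) (ha : Admissible n Finset.univ h)
    {E : Set ℕ+} (hE : E.OrdConnected) {ι : Type*} {I : Finset ι} {z : ι → Vec} {ε B : ℝ}
    (hK : ∀ i ∈ I, ∀ b ∈ (z i).support, K ≤ (b : ℕ)) (hz : ∀ i ∈ I, SmallOn avg n K ε (z i))
    {c : ι → ℝ} (hc : ∀ i ∈ I, |c i| ≤ 1) (hB : 0 ≤ B)
    (hle : ∀ q, |act (restrict E (h q)) (∑ i ∈ I, c i • z i)| ≤ B) :
    |∑ q, act (restrict E (h q)) (∑ i ∈ I, c i • z i)| ≤ B + I.card * ε := by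
  classical
  -- `SmallOn` with the empty selection `∅` gives `0 < ε` as soon as `I` has an element.
  have hI0 : 0 ≤ (I.card : ℝ) * ε := by
    rw [← nsmul_eq_mul]
    refine (Finset.sum_nonneg fun i hi => ?_).trans (Finset.sum_const (s := I) ε).le
    exact (hz i hi d h s havg hv ha E hE ∅ (by simp)).le
  let reach : Fin d → Prop := fun q => ∃ i ∈ I, ∃ b ∈ (z i).support, ∃ a ∈ (h q).support, b ≤ a
  have hnot : ∀ q, ¬reach q → act (restrict E (h q)) (∑ i ∈ I, c i • z i) = 0 := by
    intro q hq
    rw [act_sum_right]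
    refine Finset.sum_eq_zero fun i hi => ?_
    rw [act_smul]
    by_contra hne
    obtain ⟨a, ha1, ha2⟩ := exists_mem_support_of_act_ne_zero (right_ne_zero_of_mul hne)
    exact hq ⟨i, hi, a, ha2, a, (mem_support_restrict.1 ha1).2, le_rfl⟩
  by_cases hex : ∃ q, reach q
  · obtain ⟨p, hp, hpmin⟩ := WellFounded.has_min (wellFounded_lt (α := Fin d)) {q | reach q} hex
    have hpmin' : ∀ q, q < p → ¬reach q := fun q hq hr => hpmin q hr hq
    let T : Finset (Fin d) := Finset.univ.filter fun q => p < q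
    -- The first reaching average has a support point `a` at or beyond some point `b ≥ K` of a
    -- vector, so every later size exceeds `2 ^ a > K`.
    have hTs : ∀ q ∈ T, K < s q := by
      intro q hq
      obtain ⟨i, hi, b, hb, a, ha', hba⟩ := hp
      have h1 := (hv.2 p q (Finset.mem_filter.1 hq).2).2 a ha'
      have h2 : (a : ℕ) < 2 ^ (a : ℕ) := Nat.lt_two_pow_self
      have h3 : (b : ℕ) ≤ a := hba
      exact (hK i hi b hb).trans_lt (h3.trans_lt (h2.trans h1))
    have hsplit : ∑ q, act (restrict E (h q)) (∑ i ∈ I, c i • z i) =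
        act (restrict E (h p)) (∑ i ∈ I, c i • z i) +
          ∑ q ∈ T, act (restrict E (h q)) (∑ i ∈ I, c i • z i) := by
      have hpT : p ∉ T := by simp [T]
      rw [← Finset.sum_insert (f := fun q => act (restrict E (h q)) (∑ i ∈ I, c i • z i)) hpT]
      refine (Finset.sum_subset (Finset.subset_univ _) fun q _ hq => hnot q (hpmin' q ?_)).symm
      simp only [T, Finset.mem_insert, Finset.mem_filter, Finset.mem_univ, true_and,
        not_or, not_lt] at hq
      exact lt_of_le_of_ne hq.2 hq.1
    have hT : |∑ q ∈ T, act (restrict E (h q)) (∑ i ∈ I, c i • z i)| ≤ I.card * ε := by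
      calc |∑ q ∈ T, act (restrict E (h q)) (∑ i ∈ I, c i • z i)|
          ≤ ∑ q ∈ T, |act (restrict E (h q)) (∑ i ∈ I, c i • z i)| :=
            Finset.abs_sum_le_sum_abs _ _
        _ ≤ ∑ q ∈ T, ∑ i ∈ I, |act (restrict E (h q)) (z i)| := by
            refine Finset.sum_le_sum fun q _ => ?_
            rw [act_sum_right]
            refine (Finset.abs_sum_le_sum_abs _ _).trans (Finset.sum_le_sum fun i hi => ?_)
            rw [act_smul, abs_mul]
            exact mul_le_of_le_one_left (abs_nonneg _) (hc i hi)
        _ = ∑ i ∈ I, ∑ q ∈ T, |act (restrict E (h q)) (z i)| := Finset.sum_comm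
        _ ≤ ∑ i ∈ I, ε := Finset.sum_le_sum fun i hi =>
            (hz i hi d h s havg hv ha E hE T hTs).le
        _ = I.card * ε := by rw [Finset.sum_const, nsmul_eq_mul]
    rw [hsplit]
    exact (abs_add_le _ _).trans (add_le_add (hle p) hT)
  · push Not at hex
    rw [Finset.sum_eq_zero fun q _ => hnot q (hex q), abs_zero]
    positivity

theorem IsTypeI.abs_act_le_of_smallOn {avg : ℕ → Vec → Prop} {n K : ℕ} {g : Vec}
    (hg : IsTypeI avg n g) {ι : Type*} {I : Finset ι} {z : ι → Vec} {ε B : ℝ}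
    (hK : ∀ i ∈ I, ∀ b ∈ (z i).support, K ≤ (b : ℕ)) (hz : ∀ i ∈ I, SmallOn avg n K ε (z i))
    {c : ι → ℝ} (hc : ∀ i ∈ I, |c i| ≤ 1) (hB : 0 ≤ B)
    (hle : ∀ s f, avg s f → ∀ E : Set ℕ+, E.OrdConnected →
      |act (_root_.restrict E f) (∑ i ∈ I, c i • z i)| ≤ B) :
    |act g (∑ i ∈ I, c i • z i)| ≤ 1 / 2 ^ n * (B + I.card * ε) := by
  obtain ⟨-, d, h, s, hs, hv, ha, E, hE, hg⟩ := hg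
  have h1 : |act g (∑ i ∈ I, c i • z i)| =
      1 / 2 ^ n * |∑ q, act (_root_.restrict E (h q)) (∑ i ∈ I, c i • z i)| := by
    have h2 : (0 : ℝ) ≤ 1 / 2 ^ n := by positivity
    rcases hg with rfl | rfl
    · rw [restrict_smul, restrict_sum, act_smul_left, act_sum_left, abs_mul, abs_of_nonneg h2]
    · rw [restrict_smul, restrict_sum, act_neg_left, act_smul_left, act_sum_left, abs_neg, abs_mul,
        abs_of_nonneg h2]
  rw [h1]
  exact mul_le_mul_of_nonneg_left
    (abs_sum_act_le hs hv ha hE hK hz hc hB fun q => hle _ _ (hs q) E hE) (by positivity)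

/-! ### Special sequences -/

theorem IsSpecial.ne_zero {P : Setup} {G : Set Vec} {d : ℕ} {f g : ℕ → Vec} {w : ℕ → ℕ}
    (h : IsSpecial P G d f g w) {q : ℕ} (hq : q < d) : f q ≠ 0 ∧ g q ≠ 0 :=
  ⟨(h.2.1 q hq).1, (h.2.1 q hq).2.1⟩

/-- All vectors of an earlier pair precede all vectors of a later one. -/
theorem IsSpecial.before_all {P : Setup} {G : Set Vec} {d : ℕ} {f g : ℕ → Vec} {w : ℕ → ℕ}
    (h : IsSpecial P G d f g w) {p q : ℕ} (hpq : p < q) (hq : q < d) :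
    Before (f p) (f q) ∧ Before (f p) (g q) ∧ Before (g p) (f q) ∧ Before (g p) (g q) := by
  have hp := hpq.trans hq
  have b1 := h.before hpq hq
  have b2 := b1.trans' (h.2.1 q hq).1 (h.2.1 q hq).2.2
  exact ⟨(h.2.1 p hp).2.2.trans' (h.2.1 p hp).2.1 b1, (h.2.1 p hp).2.2.trans' (h.2.1 p hp).2.1 b2,
    b1, b2⟩

theorem IsSpecial.lt_of_mem_support {P : Setup} {G : Set Vec} {d : ℕ} {f g : ℕ → Vec} {w : ℕ → ℕ}
    (h : IsSpecial P G d f g w) {p q : ℕ} (hpq : p < q) (hq : q < d) {a b : ℕ+}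
    (ha : a ∈ (f p).support ∨ a ∈ (g p).support) (hb : b ∈ (f q).support ∨ b ∈ (g q).support) :
    a < b := by
  obtain ⟨h1, h2, h3, h4⟩ := h.before_all hpq hq
  rcases ha with ha | ha <;> rcases hb with hb | hb
  exacts [h1 a ha b hb, h2 a ha b hb, h3 a ha b hb, h4 a ha b hb]

theorem pairList_succ (f g : ℕ → Vec) (q : ℕ) :
    pairList f g (q + 1) = pairList f g q ++ [f q, g q] := by
  simp [pairList, List.range_succ, List.flatMap_append]

theorem length_pairList (f g : ℕ → Vec) (q : ℕ) : (pairList f g q).length = 2 * q := by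
  induction q with
  | zero => rfl
  | succ q ih => rw [pairList_succ, List.length_append, ih]; simp; ring

theorem mem_pairList {f g : ℕ → Vec} {q : ℕ} {u : Vec} :
    u ∈ pairList f g q ↔ ∃ i < q, u = f i ∨ u = g i := by
  simp [pairList]

theorem pairList_congr {f g f' g' : ℕ → Vec} {q : ℕ} (h : ∀ i < q, f i = f' i ∧ g i = g' i) :
    pairList f g q = pairList f' g' q := by
  induction q with
  | zero => rfl
  | succ q ih =>
    rw [pairList_succ, pairList_succ, ih fun i hi => h i (hi.trans (Nat.lt_succ_self q)),
      (h q (Nat.lt_succ_self q)).1, (h q (Nat.lt_succ_self q)).2]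

theorem eq_of_pairList_eq {f g f' g' : ℕ → Vec} {q : ℕ}
    (h : pairList f g q = pairList f' g' q) : ∀ i < q, f i = f' i ∧ g i = g' i := by
  induction q with
  | zero => exact fun i hi => absurd hi (Nat.not_lt_zero i)
  | succ q ih =>
    rw [pairList_succ, pairList_succ] at h
    obtain ⟨h1, h2⟩ := List.append_inj' h rfl
    intro i hi
    rcases Nat.lt_succ_iff_lt_or_eq.1 hi with hi | rfl
    · exact ih h1 i hi
    · simpa using h2

theorem IsSpecial.isCodable {P : Setup} {d : ℕ} {f g : ℕ → Vec} {w : ℕ → ℕ}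
    (h : IsSpecial P P.W d f g w) {q : ℕ} (hq1 : 1 ≤ q) (hq : q ≤ d) :
    IsCodable (pairList f g q) := by
  refine ⟨?_, ?_, ?_⟩
  · rw [← List.length_pos_iff, length_pairList]
    omega
  · intro u hu
    obtain ⟨i, hi, hui⟩ := mem_pairList.1 hu
    have hid := hi.trans_le hq
    have hW := P.isClosedUnderOps_W
    rcases hui with rfl | rfl
    · exact ⟨(h.ne_zero hid).1, P.isRational_of_mem_W (hW.alpha_mem _ _ (h.2.2.2.1 i hid).1)⟩
    · exact ⟨(h.ne_zero hid).2, P.isRational_of_mem_W (hW.alpha_mem _ _ (h.2.2.2.1 i hid).2)⟩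
  · clear hq1
    induction q with
    | zero => exact List.Pairwise.nil
    | succ q ih =>
      rw [pairList_succ, List.pairwise_append]
      refine ⟨ih (by omega), ?_, ?_⟩
      · simpa using (h.2.1 q (by omega)).2.2
      · intro u hu v hv
        obtain ⟨i, hi, hui⟩ := mem_pairList.1 hu
        obtain ⟨h1, h2, h3, h4⟩ := h.before_all hi (by omega : q < d)
        simp only [List.mem_cons, List.not_mem_nil, or_false] at hv
        rcases hui with rfl | rfl <;> rcases hv with rfl | rfl <;> assumption

theorem IsSpecial.weight_mem {P : Setup} {d : ℕ} {f g : ℕ → Vec} {w : ℕ → ℕ}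
    (h : IsSpecial P P.W d f g w) {q : ℕ} (hq1 : 1 ≤ q) (hq : q < d) : w q ∈ P.L₂ := by
  rw [← h.2.2.2.2.2 q hq1 hq]
  exact P.σ_mem _ (h.isCodable hq1 hq.le)

theorem IsSpecial.weight_mem_range {P : Setup} {d : ℕ} {f g : ℕ → Vec} {w : ℕ → ℕ}
    (h : IsSpecial P P.W d f g w) {q : ℕ} (hq : q < d) : w q ∈ Set.range P.ell := by
  rw [← P.L_union]
  rcases Nat.eq_zero_or_pos q with rfl | hq1
  · exact Or.inl (Or.inl h.2.2.2.2.1)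
  · exact Or.inl (Or.inr (h.weight_mem hq1 hq))

/-- The weight of a pair determines the pairs before it. -/
theorem IsSpecial.eq_of_weight_eq {P : Setup} {d d' : ℕ} {f g f' g' : ℕ → Vec} {w w' : ℕ → ℕ}
    (h : IsSpecial P P.W d f g w) (h' : IsSpecial P P.W d' f' g' w') {q q' : ℕ} (hq : q < d)
    (hq' : q' < d') (hw : w q = w' q') : q = q' ∧ ∀ i < q, f i = f' i ∧ g i = g' i := by
  rcases Nat.eq_zero_or_pos q with rfl | hq1 <;> rcases Nat.eq_zero_or_pos q' with rfl | hq1'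
  · exact ⟨rfl, fun i hi => absurd hi (Nat.not_lt_zero i)⟩
  · exact (Set.disjoint_left.1 P.L_disj₁₂ h.2.2.2.2.1 (hw ▸ h'.weight_mem hq1' hq')).elim
  · exact (Set.disjoint_left.1 P.L_disj₁₂ h'.2.2.2.2.1 (hw ▸ h.weight_mem hq1 hq)).elim
  · have he : pairList f g q = pairList f' g' q' := by
      refine P.σ_inj (h.isCodable hq1 hq.le) (h'.isCodable hq1' hq'.le) ?_
      rw [h.2.2.2.2.2 q hq1 hq, h'.2.2.2.2.2 q' hq1' hq', hw]
    have hqq : q = q' := by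
      have := congrArg List.length he
      rw [length_pairList, length_pairList] at this
      omega
    subst hqq
    exact ⟨rfl, eq_of_pairList_eq he⟩

/-- The weight at place `q ≥ 1` codes a list of length `2 * q`, and the first weight lies in the
disjoint set `L₁`. -/
theorem IsSpecial.weight_injOn {P : Setup} {d : ℕ} {f g : ℕ → Vec} {w : ℕ → ℕ}
    (h : IsSpecial P P.W d f g w) : Set.InjOn w {q | q < d} :=
  fun _ hp _ hq hw => (h.eq_of_weight_eq h hp hq hw).1

/-! ### Pairs of a special sequence that act substantially on a vector -/

/-- The pair `(f q, g q)` acts on `z` by at least `ε`. -/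
def HitsAt (ε : ℝ) (z : Vec) (f g : ℕ → Vec) (q : ℕ) : Prop :=
  (∀ a ∈ (f q).support, 2 ≤ (a : ℕ)) ∧
    (ε ≤ |act (f q + g q) z| ∨ ε ≤ |act (f q - g q) z|)

theorem HitsAt.congr {ε : ℝ} {z : Vec} {f g f' g' : ℕ → Vec} {q : ℕ} (h : HitsAt ε z f g q)
    (hf : f q = f' q) (hg : g q = g' q) : HitsAt ε z f' g' q := by
  unfold HitsAt at h ⊢
  rwa [← hf, ← hg]

theorem HitsAt.anti {ε ε' : ℝ} {z : Vec} {f g : ℕ → Vec} {q : ℕ} (h : HitsAt ε z f g q)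
    (hε : ε' ≤ ε) : HitsAt ε' z f g q :=
  ⟨h.1, h.2.imp hε.trans hε.trans⟩

theorem HitsAt.le_of_abs_le {ε : ℝ} {z : Vec} {f g : ℕ → Vec} {q : ℕ} (h : HitsAt ε z f g q)
    {c : ℝ} (hf : |act (f q) z| ≤ c) (hg : |act (g q) z| ≤ c) : ε ≤ 2 * c := by
  rcases h.2 with h | h
  · rw [act_add_left] at h
    linarith [abs_add_le (act (f q) z) (act (g q) z)]
  · rw [act_sub_left] at h
    linarith [abs_sub (act (f q) z) (act (g q) z)]

theorem HitsAt.exists_mem_support {ε : ℝ} (hε : 0 < ε) {z : Vec} {f g : ℕ → Vec} {q : ℕ}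
    (h : HitsAt ε z f g q) :
    ∃ a ∈ z.support, a ∈ (f q).support ∨ a ∈ (g q).support := by
  by_contra hcon
  push Not at hcon
  have h1 : act (f q) z = 0 := by
    by_contra hne
    obtain ⟨a, ha, hz⟩ := exists_mem_support_of_act_ne_zero hne
    exact (hcon a hz).1 ha
  have h2 : act (g q) z = 0 := by
    by_contra hne
    obtain ⟨a, ha, hz⟩ := exists_mem_support_of_act_ne_zero hne
    exact (hcon a hz).2 ha
  have := h.le_of_abs_le (c := 0) (by simp [h1]) (by simp [h2])
  linarith

/-- The weights of the pairs of special sequences that act on `z` by at least `ε`. -/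
def Setup.hitWeights (P : Setup) (ε : ℝ) (z : Vec) : Set ℕ :=
  {n | ∃ d f g w q, IsSpecial P P.W d f g w ∧ q < d ∧ w q = n ∧ HitsAt ε z f g q}

theorem Setup.abs_le_uNorm (P : Setup) (a : ℕ →₀ ℝ) (q : ℕ) : |a q| ≤ P.uNorm a := by
  unfold Setup.uNorm
  by_cases hq : q ∈ a.support
  · have h1 : ({q} : Finset ℕ) ∈ a.support.powerset :=
      Finset.mem_powerset.2 (Finset.singleton_subset_iff.2 hq)
    refine le_trans ?_ (Finset.le_sup' (fun F => ‖∑ k ∈ F, a k • P.D k‖) h1)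
    rw [Finset.sum_singleton, norm_smul, P.D_norm, mul_one, Real.norm_eq_abs]
  · rw [Finsupp.notMem_support_iff.1 hq, abs_zero]
    refine le_trans ?_ (Finset.le_sup' (fun F => ‖∑ k ∈ F, a k • P.D k‖)
      (Finset.empty_mem_powerset _))
    simp

/-- Membership in `W` is part of the definition of a β-average. Only convex combinations of two
functionals are available, hence the induction with rational coefficients `s / (s + 1)` and `1 / (s
+ 1)`. -/
theorem Setup.average_mem_W (P : Setup) {s : ℕ} (hs : 0 < s) {u : Fin s → Vec}
    (hu : ∀ i, u i ∈ P.W) : (1 / s : ℝ) • ∑ i, u i ∈ P.W := by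
  induction s, hs using Nat.le_induction with
  | base => simpa using hu 0
  | succ s hs ih =>
    have hW := P.isClosedUnderOps_W
    have hs0 : (0 : ℝ) < s := by exact_mod_cast hs
    have := hW.convex_mem _ (ih fun i => hu i.castSucc) _ (hu (Fin.last s)) (s / (s + 1))
      (by positivity) (by rw [div_le_one (by positivity)]; linarith)
    rw [Fin.sum_univ_castSucc, smul_add]
    convert this using 2
    · rw [smul_smul]
      congr 1
      push_cast
      field_simp
    · congr 1
      push_cast
      field_simp
      ring

/-- A single pair, halved and with the right sign, is of type II with `F = {q}`; the clause `2 ≤ a`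
in `HitsAt` is the admissibility condition `2 * F.card ≤ a` for this `F`. -/
theorem exists_isTypeII_of_mem_hitWeights {P : Setup} {ε : ℝ} {z : Vec} {n : ℕ}
    (hn : n ∈ P.hitWeights ε z) :
    ∃ h A, h ∈ P.W ∧ IsTypeII P P.W A h ∧ A ⊆ {n} ∧ ε / 2 ≤ act h z := by
  obtain ⟨d, f, g, w, q, hs, hq, rfl, hmin, hhit⟩ := hn
  have hW := P.isClosedUnderOps_W
  have hsign : ∀ u : Vec, ε ≤ |act u z| →
      ∃ h, IsSignedRestriction Set.univ ((1 / 2 : ℝ) • u) h ∧ ε / 2 ≤ act h z := by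
    intro u hu
    have h1 : act ((1 / 2 : ℝ) • u) z = act u z / 2 := by rw [act_smul_left]; ring
    rcases le_abs.1 hu with h | h
    · exact ⟨_, ⟨Set.ordConnected_univ, Or.inl rfl⟩, by rw [restrict_univ, h1]; linarith⟩
    · exact ⟨_, ⟨Set.ordConnected_univ, Or.inr rfl⟩, by
        rw [restrict_univ, act_neg_left, h1]; linarith⟩
  have hF : ∀ q' ∈ ({q} : Finset ℕ), q' < d := fun q' hq' => Finset.mem_singleton.1 hq' ▸ hq
  have hmin' : ∀ q' ∈ ({q} : Finset ℕ), ∀ a ∈ (f q').support,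
      2 * ({q} : Finset ℕ).card ≤ (a : ℕ) := fun q' hq' a ha => by
    rw [Finset.mem_singleton.1 hq'] at ha
    simpa using hmin a ha
  rcases hhit with hhit | hhit
  · obtain ⟨h, hh, hle⟩ := hsign _ hhit
    have hII : IsTypeIIPlus P P.W _ h := ⟨d, f, g, w, {q}, Set.univ, hs,
      Finset.singleton_nonempty q, hF, hmin', by simpa using hh, rfl⟩
    refine ⟨h, _, hW.plus_mem _ _ hII, Or.inl hII, ?_, hle⟩
    rintro n ⟨q', hq', rfl, -⟩
    rw [Finset.mem_singleton.1 hq']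
    rfl
  · obtain ⟨h, hh, hle⟩ := hsign _ hhit
    have hII : IsTypeIIMinus P P.W _ h := ⟨d, f, g, w, {q}, fun _ => 1, Set.univ, hs,
      Finset.singleton_nonempty q, hF, hmin', fun a => by simpa using P.abs_le_uNorm a q,
      by simpa using hh, rfl⟩
    refine ⟨h, _, hW.minus_mem _ _ hII, Or.inr hII, ?_, hle⟩
    rintro n ⟨q', hq', rfl, -⟩
    rw [Finset.mem_singleton.1 hq']
    rfl

/-- Halved pairs with distinct weights have disjoint weight sets, so their mean is a β-average whose
size is the number of weights; it still acts by `ε / 2`, which is impossible for a size above `K`.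
-/
theorem SmallOn.card_le_of_subset_hitWeights {P : Setup} {K : ℕ} {ε : ℝ} {z : Vec} (hε : 0 < ε)
    (h : SmallOn (IsBetaAverage P P.W) 1 K (ε / 2) z) {B : Finset ℕ}
    (hB : (B : Set ℕ) ⊆ P.hitWeights ε z) : B.card ≤ K := by
  classical
  by_contra hcon
  push Not at hcon
  have hs : 0 < B.card := by omega
  let e := B.orderEmbOfFin rfl
  have he : ∀ i, e i ∈ B := B.orderEmbOfFin_mem rfl
  choose u A huW huII hA hu using fun i => exists_isTypeII_of_mem_hitWeights (hB (he i))
  have hav : IsBetaAverage P P.W B.card ((1 / B.card : ℝ) • ∑ i, u i) :=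
    ⟨hs, P.average_mem_W hs huW, B.card, le_rfl, u, A, fun i => ⟨huW i, huII i⟩,
      fun i j hij => (Set.disjoint_singleton.2 (e.injective.ne hij)).mono (hA i) (hA j), rfl⟩
  have hact : ε / 2 ≤ act ((1 / B.card : ℝ) • ∑ i, u i) z := by
    have hs' : (0 : ℝ) < B.card := by exact_mod_cast hs
    rw [act_smul_left, act_sum_left, one_div, inv_mul_eq_div, le_div_iff₀ hs', mul_comm,
      ← nsmul_eq_mul]
    exact (Finset.card_nsmul_le_sum _ _ _ fun i _ => hu i).trans' (by simp)
  set β : Vec := (1 / B.card : ℝ) • ∑ i, u i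
  have hne : β ≠ 0 := by
    intro h0
    rw [h0, act_zero_left] at hact
    linarith
  obtain ⟨m, hm⟩ := exists_isLeast_support hne
  -- A family with one member is very fast growing and `𝒮₁`-admissible for trivial reasons.
  have := h 1 (fun _ => β) (fun _ => B.card) (fun _ => hav)
    ⟨⟨fun _ => hne, fun i j hij => absurd hij (by omega)⟩,
      fun i j hij => absurd hij (by omega)⟩
    ⟨fun _ => m, fun _ _ => hm, by simpa using singleton_mem_schreier_one m⟩
    Set.univ Set.ordConnected_univ Finset.univ (fun _ _ => hcon)
  simp only [restrict_univ, Finset.univ_unique, Finset.sum_const, Finset.card_singleton,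
    one_smul] at this
  exact absurd (hact.trans (le_abs_self _)) (not_le.2 this)

/-! ### Functionals of type `I_α` on a single term. -/

theorem Setup.abs_apply_le_one {P : Setup} {z : Vec} (hz : P.normW z ≤ 1) (a : ℕ+) :
    |z a| ≤ 1 := by
  have h1 := P.abs_act_le (P.single_mem_W a) z
  have h2 : act (Finsupp.single a 1) z = z a := by simp [act]
  rw [h2] at h1
  exact h1.trans hz

theorem IsTypeIAlpha.abs_act_le_card {P : Setup} {n : ℕ} {f : Vec} (hf : IsTypeIAlpha P.W n f)
    {z : Vec} (hz : P.normW z ≤ 1) : |act f z| ≤ 1 / 2 ^ n * z.support.card :=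
  abs_act_le_mul_card hf.abs_le_inv_two_pow (P.abs_apply_le_one hz)

/-- Functionals of a fixed weight act on the far terms of the sequence by about `2⁻ⁿ` at most. -/
theorem Setup.exists_abs_act_le_of_weight_lt {P : Setup} {x : ℕ → Vec} (hx : IsBlock x)
    (hle : ∀ k, P.normW (x k) ≤ 1) (hα : AlphaIndexZero P x) (M : ℕ) :
    ∃ K, ∀ l ≥ K, ∀ n < M, ∀ f, IsTypeIAlpha P.W n f → |act f (x l)| ≤ 2 * (1 / 2 ^ n) := by
  have h1 : ∀ n, ∃ K, ∀ l ≥ K, ∀ f, IsTypeIAlpha P.W n f → |act f (x l)| ≤ 2 * (1 / 2 ^ n) := by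
    intro n
    rcases Nat.eq_zero_or_pos n with rfl | hn
    · exact ⟨0, fun l _ f hf => absurd hf.1 (by norm_num)⟩
    · obtain ⟨K, hK⟩ := P.exists_smallOn_alpha hx hα hn one_pos
      refine ⟨K, fun l hl f hf => ?_⟩
      have := IsTypeI.abs_act_le_of_smallOn (avg := IsAlphaAverage P.W) hf
        (I := ({l} : Finset ℕ)) (z := x) (ε := 1) (B := 1) (K := K) (c := fun _ => 1)
        (fun i hi b hb => by
          rw [Finset.mem_singleton.1 hi] at hb
          exact hl.le.trans (hx.lt_of_mem_support l hb).le)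
        (fun i hi => by rw [Finset.mem_singleton.1 hi]; exact hK l hl) (by simp) zero_le_one
        (fun s u hu E hE => by
          simp only [one_smul, Finset.sum_singleton]
          exact (P.abs_act_le (P.isClosedUnderOps_W.restrict_mem _ hu.2.1 E hE) _).trans (hle l))
      simp only [one_smul, Finset.sum_singleton, Finset.card_singleton, Nat.cast_one] at this
      linarith
  choose K hK using h1
  refine ⟨∑ n ∈ Finset.range M, K n, fun l hl n hn f hf => hK n l (le_trans ?_ hl) f hf⟩
  exact Finset.single_le_sum (f := K) (fun _ _ => Nat.zero_le _) (Finset.mem_range.2 hn)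

/-- Some special sequence acts by at least `ε` on both `z` and `z'`, at different places, the
first one having weight at least `t`. -/
def Setup.DoubleHit (P : Setup) (ε : ℝ) (t : ℕ) (z z' : Vec) : Prop :=
  ∃ d f g w p q, IsSpecial P P.W d f g w ∧ p < q ∧ q < d ∧ t ≤ w p ∧
    HitsAt ε z f g p ∧ HitsAt ε z' f g q

theorem Ultrafilter.exists_eventually_of_eventually_exists {α ι : Type*} (U : Ultrafilter α)
    {S : Set ι} (hS : S.Finite) {p : ι → α → Prop} (h : ∀ᶠ a in U, ∃ i ∈ S, p i a) :
    ∃ i ∈ S, ∀ᶠ a in U, p i a := by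
  by_contra hcon
  push Not at hcon
  have h1 : ∀ᶠ a in U, ∀ i ∈ S, ¬p i a :=
    (Filter.eventually_all_finite hS).2 hcon
  obtain ⟨a, ⟨i, hi, hp⟩, hn⟩ := (h.and h1).exists
  exact hn i hi hp

theorem eventually_ge_hyperfilter (K : ℕ) : ∀ᶠ k in (hyperfilter ℕ : Filter ℕ), K ≤ k := by
  refine Filter.Eventually.filter_mono (hyperfilter_le_cofinite (α := ℕ)) ?_
  rw [Nat.cofinite_eq_atTop]
  exact eventually_ge_atTop K

/-- Generically, a special sequence does not act substantially on two terms of the sequence. -/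
theorem Setup.eventually_not_doubleHit {P : Setup} {x : ℕ → Vec} (hx : IsBlock x)
    (hle : ∀ k, P.normW (x k) ≤ 1) (hα : AlphaIndexZero P x) (hβ : BetaIndexZero P x)
    (hB : BranchIndexZero P x) {ε : ℝ} (hε : 0 < ε) {t : ℕ} (ht : 4 * (1 / 2 ^ t) < ε) :
    ∀ᶠ k in (hyperfilter ℕ : Filter ℕ), ∀ᶠ l in (hyperfilter ℕ : Filter ℕ),
      ¬P.DoubleHit ε t (x k) (x l) := by
  classical
  set U := hyperfilter ℕ
  by_contra hcon
  rw [← Ultrafilter.eventually_not] at hcon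
  replace hcon : ∀ᶠ k in (U : Filter ℕ), ∀ᶠ l in (U : Filter ℕ), P.DoubleHit ε t (x k) (x l) := by
    filter_upwards [hcon] with k hk
    rw [← Ultrafilter.eventually_not] at hk
    filter_upwards [hk] with l hl using not_not.1 hl
  obtain ⟨N, hN⟩ := P.exists_smallOn_beta hx hβ le_rfl (half_pos hε)
  have hcard : ∀ l ≥ N, ∀ B : Finset ℕ, (B : Set ℕ) ⊆ P.hitWeights ε (x l) → B.card ≤ N :=
    fun l hl B hB => (hN l hl).card_le_of_subset_hitWeights hε hB
  have hfin : ∀ l ≥ N, (P.hitWeights ε (x l)).Finite := by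
    intro l hl
    by_contra hinf
    obtain ⟨B, hB, hc⟩ := Set.Infinite.exists_subset_card_eq hinf (N + 1)
    have := hcard l hl B hB
    omega
  -- Numbering the hit weights of each far term by the same `N` labels turns the choice of a weight
  -- into a choice among finitely many, which the ultrafilter can make uniformly.
  have hcode : ∀ l, ∃ e : ℕ → ℕ, N ≤ l → ∀ n ∈ P.hitWeights ε (x l), ∃ i < N, e i = n := by
    intro l
    by_cases hl : N ≤ l
    · let B := (hfin l hl).toFinset
      refine ⟨fun i => B.toList.getD i 0, fun _ n hn => ?_⟩
      have hnB : n ∈ B.toList := Finset.mem_toList.2 ((hfin l hl).mem_toFinset.2 hn)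
      obtain ⟨i, hi, hin⟩ := List.getElem_of_mem hnB
      refine ⟨i, ?_, (List.getD_eq_getElem _ _ hi).trans hin⟩
      rw [Finset.length_toList] at hi
      exact hi.trans_le (hcard l hl B (by simp [B]))
    · exact ⟨fun _ => 0, fun h => absurd h hl⟩
  choose e he using hcode
  -- `Pos u k p v l`: a special sequence reaching the weight `u l` acts on `x k` at its place `p`.
  let Pos : (ℕ → ℕ) → ℕ → ℕ → ℕ → ℕ → Prop := fun u k p v l =>
    ∃ d f g w q, IsSpecial P P.W d f g w ∧ p < q ∧ q < d ∧ w q = u l ∧ t ≤ w p ∧ w p = v ∧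
      HitsAt ε (x k) f g p
  have hcolour : ∀ᶠ k in (U : Filter ℕ), ∃ i ∈ Set.Iio N, ∃ v, ∀ᶠ l in (U : Filter ℕ),
      ∃ p, Pos (fun l => e l i) k p v l := by
    filter_upwards [hcon, eventually_ge_hyperfilter N] with k hk hkN
    have h1 : ∀ᶠ l in (U : Filter ℕ), ∃ iv ∈ Set.Iio N ×ˢ P.hitWeights ε (x k),
        ∃ p, Pos (fun l => e l iv.1) k p iv.2 l := by
      filter_upwards [hk, eventually_ge_hyperfilter N] with l hl hlN
      obtain ⟨d, f, g, w, p, q, hs, hpq, hq, htw, hp, hq'⟩ := hl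
      obtain ⟨i, hi, hin⟩ := he l hlN (w q) ⟨d, f, g, w, q, hs, hq, rfl, hq'⟩
      exact ⟨(i, w p), ⟨hi, d, f, g, w, p, hs, hpq.trans hq, rfl, hp⟩, p, d, f, g, w, q, hs, hpq,
        hq, hin.symm, htw, rfl, hp⟩
    obtain ⟨⟨i, v⟩, ⟨hi, -⟩, h2⟩ := U.exists_eventually_of_eventually_exists
      ((Set.finite_Iio N).prod (hfin k hkN)) h1
    exact ⟨i, hi, v, h2⟩
  -- From here on the label `i` no longer depends on `k`, so the target weight `u l` depends on `l`
  -- alone.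
  obtain ⟨i, -, hi⟩ := U.exists_eventually_of_eventually_exists (Set.finite_Iio N) hcolour
  set u : ℕ → ℕ := fun l => e l i
  -- The place need not be pigeonholed: the weight `v` found there determines it, by injectivity of
  -- the coding.
  have hpos : ∀ᶠ k in (U : Filter ℕ), ∃ p v, ∀ᶠ l in (U : Filter ℕ), Pos u k p v l := by
    filter_upwards [hi] with k ⟨v, hv⟩
    obtain ⟨l₀, p₀, d₀, f₀, g₀, w₀, q₀, hs₀, hpq₀, hq₀, -, -, hv₀, -⟩ := hv.exists
    refine ⟨p₀, v, ?_⟩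
    filter_upwards [hv] with l ⟨p, d, f, g, w, q, hs, hpq, hq, hwq, htw, hwp, hh⟩
    obtain ⟨rfl, -⟩ := hs.eq_of_weight_eq hs₀ (hpq.trans hq) (hpq₀.trans hq₀) (hwp.trans hv₀.symm)
    exact ⟨d, f, g, w, q, hs, hpq, hq, hwq, htw, hwp, hh⟩
  -- The place of the hit moves strictly to the right when `k` is replaced by a far `k'`. For a
  -- common `l`, both sequences reach the weight `u l` and so agree before it, which allows the two
  -- places to be compared within one sequence.
  have hfar : ∀ Q k₁, ∃ k ≥ k₁, ∃ p ≥ Q, ∃ v, ∀ᶠ l in (U : Filter ℕ), Pos u k p v l := by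
    intro Q
    induction Q with
    | zero =>
      intro k₁
      obtain ⟨k, ⟨p, v, h⟩, hk⟩ := (hpos.and (eventually_ge_hyperfilter k₁)).exists
      exact ⟨k, hk, p, Nat.zero_le p, v, h⟩
    | succ Q ih =>
      intro k₁
      obtain ⟨k, -, p, hp, v, h⟩ := ih k₁
      obtain ⟨M, hM⟩ : ∃ M : ℕ, 2 * (1 / 2 ^ M * ((x k).support.card : ℝ)) < ε := by
        obtain ⟨M, hM⟩ := exists_pow_lt_of_lt_one
          (show (0 : ℝ) < ε / (2 * ((x k).support.card + 1)) by positivity) one_half_lt_one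
        refine ⟨M, ?_⟩
        rw [lt_div_iff₀ (by positivity)] at hM
        have h0 : (0 : ℝ) < (1 / 2) ^ M := by positivity
        rw [one_div_pow] at hM h0
        nlinarith
      obtain ⟨K, hK⟩ := P.exists_abs_act_le_of_weight_lt hx hle hα M
      obtain ⟨k', ⟨p', v', h'⟩, hk'⟩ :=
        (hpos.and (eventually_ge_hyperfilter (k₁ + (k + 1) + K))).exists
      refine ⟨k', by omega, p', ?_, v', h'⟩
      by_contra hlt
      obtain ⟨l, ⟨d, f, g, w, q, hs, hpq, hq, hwq, htw, hwp, hh⟩, d', f', g', w', q', hs', hpq',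
        hq', hwq', htw', hwp', hh'⟩ := (h.and h').exists
      obtain ⟨rfl, hagree⟩ := hs.eq_of_weight_eq hs' hq hq' (hwq.trans hwq'.symm)
      have hp' := hagree p' hpq'
      -- An earlier place would reverse the order of `x k` and `x k'`. At the same place, a weight
      -- of at least `M` is too high for the pair to hit `x k`, while a weight below `M` makes its
      -- action on the far term `x k'` at most `4 * (1 / 2 ^ t) < ε`.
      rcases Nat.lt_or_ge p' p with hpp | hpp
      · obtain ⟨a, ha, ha'⟩ := hh.exists_mem_support hε
        obtain ⟨b, hb, hb'⟩ := hh'.exists_mem_support hε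
        rw [← hp'.1, ← hp'.2] at hb'
        exact (hs.lt_of_mem_support hpp (hpq.trans hq) hb' ha').asymm
          (hx.2 k k' (by omega) a ha b hb)
      · obtain rfl : p = p' := by omega
        have hI := hs'.2.2.2.1 p (hpq.trans hq')
        have hMw : M ≤ w' p := by
          by_contra hlt
          have h1 := hK k' (by omega) _ (not_le.1 hlt) _ hI.1
          have h2 := hK k' (by omega) _ (not_le.1 hlt) _ hI.2
          have h3 := hh'.le_of_abs_le h1 h2
          have h4 : (1 : ℝ) / 2 ^ (w' p) ≤ 1 / 2 ^ t :=
            one_div_le_one_div_of_le (by positivity) (pow_le_pow_right₀ one_le_two htw')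
          linarith
        have h4 : (1 : ℝ) / 2 ^ (w' p) * ((x k).support.card : ℝ) ≤
            1 / 2 ^ M * ((x k).support.card : ℝ) := by
          gcongr
          exact one_le_two
        have h1 := (hI.1.abs_act_le_card (hle k)).trans h4
        have h2 := (hI.2.abs_act_le_card (hle k)).trans h4
        rw [← hp'.1] at h1
        rw [← hp'.2] at h2
        exact absurd (hh.le_of_abs_le h1 h2) (not_le.2 hM)
  -- A hit at a place `p > q` with fixed weight `v` freezes all pairs before `p`, in particular the
  -- `q`-th one.
  have hlimit : ∀ q, ∃ F G, ∀ᶠ l in (U : Filter ℕ), ∃ d f g w n, IsSpecial P P.W d f g w ∧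
      q < n ∧ n < d ∧ w n = u l ∧ f q = F ∧ g q = G := by
    intro q
    obtain ⟨k, -, p, hp, v, h⟩ := hfar (q + 1) 0
    obtain ⟨l₀, d₀, f₀, g₀, w₀, q₀, hs₀, hpq₀, hq₀, -, -, hv₀, -⟩ := h.exists
    refine ⟨f₀ q, g₀ q, ?_⟩
    filter_upwards [h] with l ⟨d, f, g, w, n, hs, hpn, hn, hwn, _, hwp, _⟩
    obtain ⟨-, hagree⟩ := hs.eq_of_weight_eq hs₀ (hpn.trans hn) (hpq₀.trans hq₀)
      (hwp.trans hv₀.symm)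
    exact ⟨d, f, g, w, n, hs, by omega, hn, hwn, (hagree q (by omega)).1, (hagree q (by omega)).2⟩
  choose F G hFG using hlimit
  have hinit : ∀ m, ∀ᶠ l in (U : Filter ℕ), ∃ d f g w n, IsSpecial P P.W d f g w ∧
      m < n ∧ n < d ∧ w n = u l ∧ ∀ q ≤ m, f q = F q ∧ g q = G q := by
    intro m
    have h1 := (Filter.eventually_all_finite (Set.finite_Iic m)).2 fun q _ => hFG q
    filter_upwards [h1] with l hl
    obtain ⟨d, f, g, w, n, hs, hmn, hn, hwn, -⟩ := hl m (Set.mem_Iic.2 le_rfl)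
    refine ⟨d, f, g, w, n, hs, hmn, hn, hwn, fun q hq => ?_⟩
    obtain ⟨d', f', g', w', n', hs', hqn', hn', hwn', hf', hg'⟩ := hl q hq
    have := (hs.eq_of_weight_eq hs' hn hn' (hwn.trans hwn'.symm)).2 q (by omega)
    rw [this.1, this.2]
    exact ⟨hf', hg'⟩
  obtain ⟨-, d₀, f₀, g₀, w₀, n₀, hs₀, hn₀, hnd₀, -, hagree₀⟩ := (hinit 0).exists
  -- All weights but the first are forced by `σ`. The first is taken from one of the approximating
  -- sequences, as a functional may have several weights.
  let W' : ℕ → ℕ := fun q => if q = 0 then w₀ 0 else P.σ (pairList F G q)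
  have hbranch : IsSpecialBranch P F G := by
    refine ⟨W', fun d hd => ?_⟩
    obtain ⟨-, d', f, g, w, n, hs, hdn, hn, -, hagree⟩ := (hinit d).exists
    have hag : ∀ q ≤ d, F q = f q ∧ G q = g q := fun q hq =>
      ⟨(hagree q hq).1.symm, (hagree q hq).2.symm⟩
    refine ⟨hd, ?_, ?_, ?_, ?_, ?_⟩
    · intro q hq
      rw [(hag q hq.le).1, (hag q hq.le).2]
      exact hs.2.1 q (by omega)
    · intro q hq
      rw [(hag q (by omega)).2, (hag (q + 1) hq.le).1]
      exact hs.2.2.1 q (by omega)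
    · intro q hq
      rcases Nat.eq_zero_or_pos q with rfl | hq1
      · have := hs₀.2.2.2.1 0 (by omega)
        rwa [(hagree₀ 0 le_rfl).1, (hagree₀ 0 le_rfl).2] at this
      · have h1 : W' q = w q := by
          simp only [W', hq1.ne', if_false]
          rw [← hs.2.2.2.2.2 q hq1 (by omega),
            pairList_congr fun i hi => hag i (by omega)]
        rw [h1, (hag q hq.le).1, (hag q hq.le).2]
        exact hs.2.2.2.1 q (by omega)
    · exact hs₀.2.2.2.2.1
    · intro q hq1 _
      have : q ≠ 0 := by omega
      simp only [W', this, if_false]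
  -- The limit branch agrees up to place `p` with the sequence that hits `x k` there, and `k` and
  -- `p` can both be taken arbitrarily large.
  obtain ⟨k₀, q₀, hsmall⟩ := hB F G hbranch ε hε
  obtain ⟨k, hk, p, hp, v, h⟩ := hfar q₀ k₀
  obtain ⟨l, ⟨d, f, g, w, q, hs, hpq, hq, hwq, -, -, hh⟩, d', f', g', w', n, hs', hpn, hn, hwn,
    hagree⟩ := (h.and (hinit p)).exists
  have h1 := (hs.eq_of_weight_eq hs' hq hn (hwq.trans hwn.symm)).2 p hpq
  have h2 := hh.congr (h1.1.trans (hagree p le_rfl).1) (h1.2.trans (hagree p le_rfl).2)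
  have h3 := hsmall k hk p hp
  rcases h2.2 with h4 | h4
  · exact absurd h4 (not_le.2 h3.1)
  · exact absurd h4 (not_le.2 h3.2)

/-! ### Spreading models of bounded sequences -/

theorem exists_eventually_eq_of_finite {κ : Type*} [Finite κ] (f : ℕ → κ) :
    ∃ y, ∀ᶠ k in (hyperfilter ℕ : Filter ℕ), f k = y := by
  obtain ⟨y, -, hy⟩ := (hyperfilter ℕ).exists_eventually_of_eventually_exists
    (S := (Set.univ : Set κ)) Set.finite_univ (p := fun y k => f k = y)
    (Eventually.of_forall fun k => ⟨f k, trivial, rfl⟩)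
  exact ⟨y, hy⟩

/-- The generic colour of a list extended by `r` further numbers. -/
noncomputable def genericColour {κ : Type*} [Finite κ] (c : List ℕ → κ) : ℕ → List ℕ → κ
  | 0, l => c l
  | r + 1, l =>
    Classical.choose (exists_eventually_eq_of_finite fun k => genericColour c r (l ++ [k]))

theorem eventually_genericColour {κ : Type*} [Finite κ] (c : List ℕ → κ) (r : ℕ) (l : List ℕ) :
    ∀ᶠ k in (hyperfilter ℕ : Filter ℕ),
      genericColour c r (l ++ [k]) = genericColour c (r + 1) l :=
  Classical.choose_spec (exists_eventually_eq_of_finite fun k => genericColour c r (l ++ [k]))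

theorem finite_setOf_bounded_list (b n : ℕ) :
    {l : List ℕ | (∀ y ∈ l, y ≤ b) ∧ l.length < n}.Finite := by
  refine ((List.finite_length_lt (Fin (b + 1)) n).image (List.map Fin.val)).subset ?_
  rintro l ⟨hl, hn⟩
  refine ⟨l.map (Fin.ofNat (b + 1)), by simpa using hn, ?_⟩
  rw [List.map_map]
  refine (List.map_congr_left fun y hy => ?_).trans (List.map_id l)
  simp [Nat.mod_eq_of_lt (Nat.lt_succ_of_le (hl y hy))]

/-- A diagonal form of Ramsey's theorem: a subsequence is monochromatic for countably many finite
colourings, the `n`-th one being a colouring of `n`-tuples and tested from the `n`-th term on. -/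
theorem exists_monochromatic_subsequence (κ : ℕ → Type) [∀ n, Finite (κ n)]
    (c : ∀ n, List ℕ → κ n) :
    ∃ χ : ℕ → ℕ, StrictMono χ ∧ ∀ n, ∃ y : κ n, ∀ k : Fin n → ℕ, StrictMono k →
      (∀ i, n ≤ k i + 1) → c n (List.ofFn (χ ∘ k)) = y := by
  -- `a` is generic over `b`: appending `a` to a short list with entries at most `b` does not change
  -- its generic colour. For given `b` only finitely many lists and values of `n` are involved, so
  -- almost every `a` qualifies.
  let r : ℕ → ℕ → Prop := fun b a => b < a ∧ ∀ n ∈ Set.Iic (b + 1),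
    ∀ l ∈ {l : List ℕ | (∀ y ∈ l, y ≤ b) ∧ l.length < n},
      genericColour (c n) (n - l.length - 1) (l ++ [a]) =
        genericColour (c n) (n - l.length - 1 + 1) l
  have hr : ∀ b, ∀ᶠ a in (hyperfilter ℕ : Filter ℕ), r b a := fun b =>
    (eventually_ge_hyperfilter (b + 1)).and
      ((Filter.eventually_all_finite (Set.finite_Iic _)).2 fun n _ =>
        (Filter.eventually_all_finite (finite_setOf_bounded_list b n)).2 fun l _ =>
          eventually_genericColour (c n) _ l)
  obtain ⟨f, -, hf⟩ := exists_seq_of_forall_finset_exists (fun _ : ℕ => True) r fun s _ =>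
    (((Filter.eventually_all_finset s).2 fun b _ => hr b).exists).imp fun a ha => ⟨trivial, ha⟩
  have hmono : StrictMono f := fun i j hij => (hf i j hij).1
  -- The shift by one makes `f (k j)` available as the bound `b` for the entry `f (k j + 1)`: all
  -- earlier entries are at most `f (k j)`, and `n ≤ k j + 1 ≤ f (k j) + 1`.
  refine ⟨fun m => f (m + 1), fun i j hij => hmono (by omega), fun n =>
    ⟨genericColour (c n) n [], fun k hk hn => ?_⟩⟩
  set L := List.ofFn ((fun m => f (m + 1)) ∘ k)
  have hlen : L.length = n := List.length_ofFn
  have key : ∀ j ≤ n, genericColour (c n) (n - j) (L.take j) = genericColour (c n) n [] := by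
    intro j
    induction j with
    | zero => intro _; rfl
    | succ j ih =>
      intro hj
      have hjn : j < n := hj
      have hLj : L[j]'(by omega) = f (k ⟨j, hjn⟩ + 1) := by simp [L]
      rw [← List.take_concat_get' L j (by omega), hLj, ← ih hjn.le]
      have h1 := (hf (k ⟨j, hjn⟩) (k ⟨j, hjn⟩ + 1) (Nat.lt_succ_self _)).2 n
        (Set.mem_Iic.2 ((hn ⟨j, hjn⟩).trans (Nat.add_le_add_right (hmono.id_le _) 1)))
        (L.take j) ⟨?_, by rw [List.length_take]; omega⟩
      · rw [List.length_take, min_eq_left (by omega)] at h1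
        have e1 : n - j - 1 = n - (j + 1) := by omega
        have e2 : n - (j + 1) + 1 = n - j := by omega
        rwa [e1, e2] at h1
      · intro y hy
        obtain ⟨i, hi, rfl⟩ := List.getElem_of_mem hy
        have hij : i < j := by rw [List.length_take] at hi; omega
        have hLi : (L.take j)[i] = f (k ⟨i, by omega⟩ + 1) := by simp [L]
        rw [hLi]
        exact hmono.monotone (hk (show (⟨i, by omega⟩ : Fin n) < ⟨j, hjn⟩ from hij))
  have := key n le_rfl
  rw [Nat.sub_self, List.take_of_length_le hlen.le] at this
  exact this

theorem exists_grid_point {M : ℕ} (hM : 0 < M) {a : ℝ} (ha : |a| ≤ 1) :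
    ∃ t : Fin (2 * M + 1), |a - ((t : ℕ) / M - 1)| ≤ 1 / M := by
  have hM' : (0 : ℝ) < M := by exact_mod_cast hM
  obtain ⟨h1, h2⟩ := abs_le.1 ha
  have h0 : 0 ≤ M * (a + 1) := mul_nonneg hM'.le (by linarith)
  have hle := Nat.floor_le h0
  have hlt := Nat.lt_floor_add_one (M * (a + 1))
  refine ⟨⟨⌊M * (a + 1)⌋₊, ?_⟩, ?_⟩
  · have h3 : (⌊M * (a + 1)⌋₊ : ℝ) ≤ ((2 * M : ℕ) : ℝ) := by
      push_cast
      nlinarith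
    exact Nat.lt_succ_of_le (by exact_mod_cast h3)
  · have e : a - ((⌊M * (a + 1)⌋₊ : ℝ) / M - 1) = (M * (a + 1) - ⌊M * (a + 1)⌋₊) / M := by
      field_simp
      ring
    change |a - ((⌊M * (a + 1)⌋₊ : ℝ) / M - 1)| ≤ _
    rw [e, abs_of_nonneg (div_nonneg (by linarith) hM'.le)]
    gcongr
    linarith

theorem abs_norm_sum_sub_le {E : Type*} [NormedAddCommGroup E] [NormedSpace ℝ E] {n : ℕ}
    {u : Fin n → E} (hu : ∀ i, ‖u i‖ ≤ 1) {a b : Fin n → ℝ} {η : ℝ} (h : ∀ i, |a i - b i| ≤ η) :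
    |‖∑ i, a i • u i‖ - ‖∑ i, b i • u i‖| ≤ n * η := by
  refine (abs_norm_sub_norm_le _ _).trans ?_
  rw [← Finset.sum_sub_distrib]
  refine (norm_sum_le _ _).trans ?_
  calc ∑ i, ‖a i • u i - b i • u i‖ ≤ ∑ _i : Fin n, η := Finset.sum_le_sum fun i _ => by
        rw [← sub_smul, norm_smul, Real.norm_eq_abs]
        exact (mul_le_of_le_one_right (abs_nonneg _) (hu i)).trans (h i)
    _ = n * η := by simp

/-- An `n`-tuple is coloured by the rounded norms of its combinations over a finite grid of
coefficients. On a monochromatic subsequence these norms agree up to rounding, and the grid is fine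
enough to reach all coefficients. -/
theorem exists_subsequence_norm_oscillation {E : Type*} [NormedAddCommGroup E] [NormedSpace ℝ E]
    {y : ℕ → E} (hy : ∀ k, ‖y k‖ ≤ 1) :
    ∃ χ : ℕ → ℕ, StrictMono χ ∧ ∀ (n : ℕ) (k k' : Fin n → ℕ), StrictMono k → StrictMono k' →
      (∀ i, n ≤ k i + 1) → (∀ i, n ≤ k' i + 1) → ∀ a : Fin n → ℝ, (∀ i, |a i| ≤ 1) →
        |‖∑ i, a i • y (χ (k i))‖ - ‖∑ i, a i • y (χ (k' i))‖| ≤ 2 / (n + 1) := by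
  -- Passing to the grid costs `n / M` twice and rounding the norm `1 / M`; in total `(2 * n + 1) /
  -- (n + 1) ^ 2 ≤ 2 / (n + 1)`.
  let M : ℕ → ℕ := fun n => (n + 1) ^ 2
  have hM : ∀ n, 0 < M n := fun n => by positivity
  let grid : ∀ n, (Fin n → Fin (2 * M n + 1)) → Fin n → ℝ := fun n t i => (t i : ℕ) / M n - 1
  -- The cap `n * M n` and the default entry 0 only serve to have a finite colour set and a total
  -- function: on genuine `n`-tuples the norms are at most `n`.
  let c : ∀ n, List ℕ → (Fin n → Fin (2 * M n + 1)) → Fin (n * M n + 1) := fun n l t =>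
    ⟨min ⌊M n * ‖∑ i, grid n t i • y (l.getD i 0)‖⌋₊ (n * M n), by omega⟩
  obtain ⟨χ, hχ, hc⟩ := exists_monochromatic_subsequence _ c
  refine ⟨χ, hχ, fun n k k' hk hk' hn hn' a ha => ?_⟩
  obtain ⟨col, hcol⟩ := hc n
  have hMn : (0 : ℝ) < M n := by exact_mod_cast hM n
  choose t ht using fun i => exists_grid_point (hM n) (ha i)
  have hgrid : ∀ i, |grid n t i| ≤ 1 := by
    intro i
    have h1 : ((t i : ℕ) : ℝ) ≤ 2 * M n := by exact_mod_cast Nat.lt_succ_iff.1 (t i).2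
    have h2 : (0 : ℝ) ≤ ((t i : ℕ) : ℝ) / M n := by positivity
    have h3 : ((t i : ℕ) : ℝ) / M n ≤ 2 := by rwa [div_le_iff₀ hMn]
    rw [abs_le]
    constructor <;> simp only [grid] <;> linarith
  have hbound : ∀ κ : Fin n → ℕ, ‖∑ i, grid n t i • y (χ (κ i))‖ ≤ n := fun κ => by
    refine (norm_sum_le _ _).trans ?_
    refine (Finset.sum_le_sum (g := fun _ => (1 : ℝ)) fun i _ => ?_).trans (by simp)
    rw [norm_smul, Real.norm_eq_abs]
    exact mul_le_one₀ (hgrid i) (norm_nonneg _) (hy _)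
  have hfloor : ∀ κ : Fin n → ℕ, StrictMono κ → (∀ i, n ≤ κ i + 1) →
      ⌊M n * ‖∑ i, grid n t i • y (χ (κ i))‖⌋₊ = (col t : ℕ) := by
    intro κ h1 h2
    rw [← hcol κ h1 h2]
    have h3 : ∀ i : Fin n, (List.ofFn (χ ∘ κ)).getD i 0 = χ (κ i) := fun i => by
      rw [List.getD_eq_getElem _ _ (by simp)]
      simp
    simp only [c, h3]
    refine (min_eq_left ?_).symm
    refine Nat.floor_le_of_le ?_
    push_cast
    rw [mul_comm]
    exact mul_le_mul_of_nonneg_right (hbound κ) hMn.le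
  have hclose : |‖∑ i, grid n t i • y (χ (k i))‖ - ‖∑ i, grid n t i • y (χ (k' i))‖| ≤
      1 / M n := by
    have e := (hfloor k hk hn).trans (hfloor k' hk' hn').symm
    have h1 := Nat.floor_le (mul_nonneg hMn.le (norm_nonneg (∑ i, grid n t i • y (χ (k i)))))
    have h2 := Nat.lt_floor_add_one (M n * ‖∑ i, grid n t i • y (χ (k i))‖)
    have h3 := Nat.floor_le (mul_nonneg hMn.le (norm_nonneg (∑ i, grid n t i • y (χ (k' i)))))
    have h4 := Nat.lt_floor_add_one (M n * ‖∑ i, grid n t i • y (χ (k' i))‖)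
    rw [e] at h1 h2
    rw [abs_le, ← neg_div, div_le_iff₀ hMn, le_div_iff₀ hMn]
    constructor <;> linarith
  have h1 := abs_norm_sum_sub_le (fun i => hy (χ (k i))) ht
  have h2 := abs_norm_sum_sub_le (fun i => hy (χ (k' i))) ht
  have h3 : (n : ℝ) * (1 / M n) + 1 / M n + n * (1 / M n) ≤ 2 / (n + 1) := by
    have : ((M n : ℕ) : ℝ) = (n + 1) ^ 2 := by simp [M]
    rw [this, ← sub_nonneg]
    have e : (2 : ℝ) / (n + 1) - (n * (1 / (n + 1) ^ 2) + 1 / (n + 1) ^ 2 + n * (1 / (n + 1) ^ 2))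
        = 1 / (n + 1) ^ 2 := by
      field_simp
      ring
    rw [e]
    positivity
  rw [abs_le] at h1 h2 hclose ⊢
  simp only [grid] at hclose
  constructor <;> linarith [h1.1, h1.2, h2.1, h2.2, hclose.1, hclose.2]

theorem linearCombination_eq_sum_fin {E : Type*} [AddCommGroup E] [Module ℝ E] (v : ℕ → E)
    {a : ℕ →₀ ℝ} {n : ℕ} (ha : ∀ i ∈ a.support, i < n) :
    Finsupp.linearCombination ℝ v a = ∑ i : Fin n, a i • v i := by
  rw [Finsupp.linearCombination_apply, Finsupp.sum_of_support_subset a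
    (s := Finset.range n) (fun i hi => Finset.mem_range.2 (ha i hi)) _ (by simp),
    Finset.sum_range]

/-- Every bounded sequence has a subsequence that generates a spreading model. -/
theorem exists_generatesSpreadingModel {E : Type} [NormedAddCommGroup E] [NormedSpace ℝ E]
    {y : ℕ → E} (hy : ∀ k, ‖y k‖ ≤ 1) :
    ∃ (χ : ℕ → ℕ) (N : Seminorm ℝ (ℕ →₀ ℝ)), StrictMono χ ∧
      GeneratesSpreadingModel (fun k => y (χ k)) N ∧
      ∀ a, Tendsto (fun m => ‖Finsupp.linearCombination ℝ (fun i => y (χ (m + i))) a‖) atTop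
        (𝓝 (N a)) := by
  obtain ⟨χ, hχ, hosc⟩ := exists_subsequence_norm_oscillation hy
  let T : ℕ → (ℕ →₀ ℝ) →ₗ[ℝ] E := fun m => Finsupp.linearCombination ℝ fun i => y (χ (m + i))
  have hshift : ∀ n m : ℕ, StrictMono fun i : Fin n => m + (i : ℕ) := fun n m i j hij =>
    Nat.add_lt_add_left hij m
  have hT : ∀ (a : ℕ →₀ ℝ) (n : ℕ), (∀ i ∈ a.support, i < n) → (∀ i, |a i| ≤ 1) →
      ∀ m ≥ n, ∀ m' ≥ n, |‖T m a‖ - ‖T m' a‖| ≤ 2 / (n + 1) := by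
    intro a n hn ha m hm m' hm'
    simp only [T]
    rw [linearCombination_eq_sum_fin _ hn, linearCombination_eq_sum_fin _ hn]
    exact hosc n (fun i => m + i) (fun i => m' + i) (hshift n m) (hshift n m')
      (fun i => by omega) (fun i => by omega) (fun i => a i) fun i => ha i
  have hcauchy₁ : ∀ a : ℕ →₀ ℝ, (∀ i, |a i| ≤ 1) → CauchySeq fun m => ‖T m a‖ := by
    intro a ha
    rw [Metric.cauchySeq_iff']
    intro ε hε
    obtain ⟨n₀, hn₀⟩ : ∃ n₀, ∀ i ∈ a.support, i < n₀ :=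
      ⟨a.support.sup id + 1, fun i hi => Nat.lt_succ_of_le (Finset.le_sup (f := id) hi)⟩
    obtain ⟨n₁, hn₁⟩ := exists_nat_gt (2 / ε)
    refine ⟨n₀ + n₁, fun m hm => ?_⟩
    rw [Real.dist_eq]
    refine (hT a (n₀ + n₁) (fun i hi => (hn₀ i hi).trans_le (Nat.le_add_right _ _)) ha m hm _
      le_rfl).trans_lt ?_
    rw [div_lt_iff₀ (by positivity)]
    rw [div_lt_iff₀ hε] at hn₁
    push_cast
    have : (0 : ℝ) ≤ n₀ := by positivity
    nlinarith
  have hconv : ∀ a : ℕ →₀ ℝ, ∃ L, Tendsto (fun m => ‖T m a‖) atTop (𝓝 L) := by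
    intro a
    -- The oscillation bound is for coefficients in `[-1, 1]`; dividing by `A` reduces to them.
    let A : ℝ := 1 + ∑ i ∈ a.support, |a i|
    have hA : 0 < A := by
      have := Finset.sum_nonneg (s := a.support) fun i _ => abs_nonneg (a i)
      simp only [A]; linarith
    have hle : ∀ i, |(A⁻¹ • a) i| ≤ 1 := by
      intro i
      rw [Finsupp.smul_apply, smul_eq_mul, abs_mul, abs_of_pos (inv_pos.2 hA), inv_mul_le_iff₀ hA,
        mul_one]
      by_cases hi : i ∈ a.support
      · have := Finset.single_le_sum (f := fun i => |a i|) (fun i _ => abs_nonneg _) hi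
        simp only [A]; linarith
      · rw [Finsupp.notMem_support_iff.1 hi, abs_zero]
        exact hA.le
    obtain ⟨L, hL⟩ := cauchySeq_tendsto_of_complete (hcauchy₁ _ hle)
    refine ⟨A * L, (hL.const_mul A).congr fun m => ?_⟩
    rw [map_smul, norm_smul, Real.norm_eq_abs, abs_of_pos (inv_pos.2 hA), mul_inv_cancel_left₀ hA.ne']
  choose N hN using hconv
  let Ns : Seminorm ℝ (ℕ →₀ ℝ) := Seminorm.of N
    (fun a b => le_of_tendsto_of_tendsto' (hN (a + b)) ((hN a).add (hN b)) fun m => by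
      rw [map_add]; exact norm_add_le _ _)
    (fun c a => tendsto_nhds_unique (hN (c • a)) (((hN a).const_mul ‖c‖).congr fun m => by
      rw [map_smul, norm_smul]))
  -- In the limit the oscillation bound gives `≤ 2 / (n + 1)`; the constant 3 makes the inequality
  -- strict.
  refine ⟨χ, Ns, hχ, ⟨fun n => 3 / (n + 1), fun n => by positivity, ?_, ?_, ?_⟩, hN⟩
  · intro n n' hn
    have : (n : ℝ) ≤ n' := by exact_mod_cast hn
    change (3 : ℝ) / (n' + 1) ≤ 3 / (n + 1)
    gcongr
  · have := tendsto_one_div_add_atTop_nhds_zero_nat (𝕜 := ℝ)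
    simpa [div_eq_mul_inv] using this.const_mul 3
  · intro n k hk hn a ha
    set b : ℕ →₀ ℝ := ∑ i : Fin n, Finsupp.single i.val (a i)
    have hb : ∀ m, T m b = ∑ i, a i • y (χ (m + i)) := fun m => by
      simp only [T, b, map_sum, Finsupp.linearCombination_single]
    have hlim : Tendsto (fun m => |‖∑ i, a i • y (χ (k i))‖ - ‖T m b‖|) atTop
        (𝓝 |‖∑ i, a i • y (χ (k i))‖ - Ns b|) := (tendsto_const_nhds.sub (hN b)).abs
    refine lt_of_le_of_lt (b := (2 : ℝ) / (n + 1)) (le_of_tendsto hlim ?_) ?_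
    · filter_upwards [eventually_ge_atTop n] with m hm
      rw [hb]
      exact hosc n k (fun i => m + i) hk (hshift n m) hn (fun i => by omega) a ha
    · change (2 : ℝ) / (n + 1) < 3 / (n + 1)
      gcongr
      norm_num

/-! ### Rapidly increasing subsequences -/

/-- The largest element of the support (zero for the zero vector). -/
def maxSupp (f : Vec) : ℕ := f.support.sup fun a => (a : ℕ)

theorem le_maxSupp {f : Vec} {a : ℕ+} (ha : a ∈ f.support) : (a : ℕ) ≤ maxSupp f :=
  Finset.le_sup (f := fun a : ℕ+ => (a : ℕ)) ha

theorem card_support_le_maxSupp (f : Vec) : f.support.card ≤ maxSupp f := by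
  have h : f.support.image (fun a : ℕ+ => (a : ℕ)) ⊆ Finset.Icc 1 (maxSupp f) := by
    intro n hn
    obtain ⟨a, ha, rfl⟩ := Finset.mem_image.1 hn
    exact Finset.mem_Icc.2 ⟨a.pos, le_maxSupp ha⟩
  have := Finset.card_le_card h
  rwa [Finset.card_image_of_injective _ PNat.coe_injective, Nat.card_Icc,
    Nat.add_sub_cancel] at this

theorem maxSupp_pos {f : Vec} (hf : f ≠ 0) : 0 < maxSupp f := by
  obtain ⟨a, ha⟩ := Finsupp.support_nonempty_iff.2 hf
  exact a.pos.trans_le (le_maxSupp ha)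

theorem IsBlock.maxSupp_mono {x : ℕ → Vec} (hx : IsBlock x) : Monotone fun k => maxSupp (x k) := by
  intro k l hkl
  rcases hkl.eq_or_lt with rfl | hlt
  · exact le_rfl
  · obtain ⟨b, hb⟩ := Finsupp.support_nonempty_iff.2 (hx.1 l)
    refine Finset.sup_le fun a ha => le_trans ?_ (le_maxSupp hb)
    have h : (a : ℕ) < b := hx.2 k l hlt a ha b hb
    exact h.le

theorem IsBlock.comp_strictMono {x : ℕ → Vec} (hx : IsBlock x) {φ : ℕ → ℕ} (hφ : StrictMono φ) :
    IsBlock fun k => x (φ k) :=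
  ⟨fun _ => hx.1 _, fun _ _ hij => hx.2 _ _ (hφ hij)⟩

theorem SmallOn.mono_right {avg : ℕ → Vec → Prop} {n K : ℕ} {ε ε' : ℝ} {z : Vec}
    (h : SmallOn avg n K ε z) (hε : ε ≤ ε') : SmallOn avg n K ε' z :=
  fun d u s hu hv ha E hE T hT => (h d u s hu hv ha E hE T hT).trans_le hε

theorem SmallOn.anti {avg avg' : ℕ → Vec → Prop} (havg : ∀ s f, avg' s f → avg s f) {n K : ℕ}
    {ε : ℝ} {z : Vec} (h : SmallOn avg n K ε z) : SmallOn avg' n K ε z :=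
  fun d u s hu => h d u s fun q => havg _ _ (hu q)

/-- The terms from the `k`-th one on are nearly annihilated by the admissible families of weight
below `J (k + 1)` consisting of averages whose sizes exceed the position of the `k`-th term. -/
def TailSmall (avg : ℕ → Vec → Prop) (z : ℕ → Vec) (J : ℕ → ℕ) : Prop :=
  ∀ k : ℕ, ∃ K : ℕ, (∀ b ∈ (z k).support, K ≤ (b : ℕ)) ∧ ∀ l ≥ k, ∀ m, 1 ≤ m → m < J (k + 1) →
    SmallOn avg m K (1 / (8 * (k + 1))) (z l)

/-- The properties of a subsequence from which the upper `c₀` estimate is derived. -/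
structure IsRapid (P : Setup) (z : ℕ → Vec) (J : ℕ → ℕ) : Prop where
  block : IsBlock z
  norm_le : ∀ k, P.normW (z k) ≤ 1
  strictMono : StrictMono J
  large : ∀ k, 8 * (k + 1) * maxSupp (z k) ^ 2 ≤ 2 ^ J (k + 2)
  alpha : TailSmall (IsAlphaAverage P.W) z J
  beta : TailSmall (IsBetaAverage P P.W) z J
  not_doubleHit : ∀ a k l, a < k → k < l →
    ¬P.DoubleHit (1 / ((a + 1) * maxSupp (z a))) (J (k + 1)) (z k) (z l)

theorem IndexZero.exists_smallOn_of_weight_lt {avg : ℕ → Vec → Prop}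
    (havg : ∀ s f, avg s f → ∀ E : Set ℕ+, E.OrdConnected → avg s (restrict E f))
    {x : ℕ → Vec} (hx : IsBlock x) (hzero : IndexZero avg x) (M : ℕ) {ε : ℝ} (hε : 0 < ε) :
    ∃ K, ∀ l ≥ K, ∀ m, 1 ≤ m → m < M → SmallOn avg m K ε (x l) := by
  choose! K hK using fun m (hm : 1 ≤ m) => IndexZero.exists_smallOn havg hx hzero hm hε
  refine ⟨∑ m ∈ Finset.range M, K m, fun l hl m hm hmM => ?_⟩
  have h : K m ≤ ∑ m ∈ Finset.range M, K m :=
    Finset.single_le_sum (f := K) (fun _ _ => Nat.zero_le _) (Finset.mem_range.2 hmM)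
  exact (hK m hm l (h.trans hl)).mono h

theorem Setup.DoubleHit.mono {P : Setup} {ε ε' : ℝ} {t t' : ℕ} {z z' : Vec}
    (h : P.DoubleHit ε t z z') (hε : ε' ≤ ε) (ht : t' ≤ t) : P.DoubleHit ε' t' z z' := by
  obtain ⟨d, f, g, w, p, q, hs, hpq, hq, htw, hp, hq'⟩ := h
  exact ⟨d, f, g, w, p, q, hs, hpq, hq, ht.trans htw, hp.anti hε, hq'.anti hε⟩

/-- A diagonal choice of pairs `(e, a)`: `a` is the index of the next term, and `e` sets both the
precision `1 / (e + 1)` and the weight range `e + 4` in force at that step. -/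
theorem Setup.exists_isRapid_subsequence {P : Setup} {x : ℕ → Vec} (hx : IsBlock x)
    (hle : ∀ k, P.normW (x k) ≤ 1) (hα : AlphaIndexZero P x) (hβ : BetaIndexZero P x)
    (hB : BranchIndexZero P x) :
    ∃ φ J : ℕ → ℕ, StrictMono φ ∧ IsRapid P (fun k => x (φ k)) J := by
  have hε : ∀ e : ℕ, (0 : ℝ) < 1 / (8 * (e + 1)) := fun e => by positivity
  choose K₁ hK₁ using fun e : ℕ => IndexZero.exists_smallOn_of_weight_lt
    (avg := IsAlphaAverage P.W) (fun _ _ hf _ hE => IsAlphaAverage.restrict hf hE) hx hα (e + 4) (hε e)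
  choose K₂ hK₂ using fun e : ℕ => IndexZero.exists_smallOn_of_weight_lt
    (avg := IsBetaAverage P P.W) (fun _ _ hf _ hE => IsBetaAverage.restrict hf hE) hx hβ (e + 4) (hε e)
  -- The summand 4 ensures `4 / 2 ^ (e + 4) < 1 / (e + 1)`, as required for the generic absence of
  -- double hits.
  let D : ℕ → ℕ → ℕ → Prop := fun e a b => P.DoubleHit (1 / (e + 1)) (e + 4) (x a) (x b)
  have hD : ∀ e, ∀ᶠ a in (hyperfilter ℕ : Filter ℕ), ∀ᶠ b in (hyperfilter ℕ : Filter ℕ),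
      ¬D e a b := fun e => by
    refine P.eventually_not_doubleHit hx hle hα hβ hB (by positivity) ?_
    rw [← mul_div_assoc, mul_one, div_lt_div_iff₀ (by positivity) (by positivity), pow_add]
    have h : (e : ℝ) < 2 ^ e := by exact_mod_cast Nat.lt_two_pow_self
    have h' : (1 : ℝ) ≤ 2 ^ e := one_le_pow₀ one_le_two
    linarith
  let good : ℕ × ℕ → Prop := fun s =>
    (K₁ s.1 ≤ s.2 ∧ K₂ s.1 ≤ s.2) ∧ ∀ᶠ b in (hyperfilter ℕ : Filter ℕ), ¬D s.1 s.2 b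
  let next : ℕ × ℕ → ℕ × ℕ → Prop := fun s s' =>
    s.1 + 8 * (s.2 + 1) * maxSupp (x s.2) ^ 2 < s'.1 ∧ s.2 < s'.2 ∧ ¬D s.1 s.2 s'.2
  obtain ⟨f, hgood, hnext⟩ := exists_seq_of_forall_finset_exists good next fun s hs => by
    -- The sum over all terms already chosen dominates each of them at once.
    let e := ∑ r ∈ s, (r.1 + 8 * (r.2 + 1) * maxSupp (x r.2) ^ 2) + 1
    have h1 : ∀ᶠ a in (hyperfilter ℕ : Filter ℕ), ∀ r ∈ s, r.2 < a ∧ ¬D r.1 r.2 a :=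
      (Filter.eventually_all_finset s).2 fun r hr =>
        (eventually_ge_hyperfilter (r.2 + 1)).and (hs r hr).2
    obtain ⟨a, ⟨h1, h2⟩, h3⟩ :=
      ((h1.and (hD e)).and (eventually_ge_hyperfilter (K₁ e + K₂ e))).exists
    refine ⟨(e, a), ⟨⟨by simp only; omega, by simp only; omega⟩, h2⟩, fun r hr =>
      ⟨?_, (h1 r hr).1, (h1 r hr).2⟩⟩
    exact Nat.lt_succ_of_le (Finset.single_le_sum
      (f := fun r : ℕ × ℕ => r.1 + 8 * (r.2 + 1) * maxSupp (x r.2) ^ 2)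
      (fun _ _ => Nat.zero_le _) hr)
  have hφ : StrictMono fun k => (f k).2 := fun i j hij => (hnext i j hij).2.1
  have he : StrictMono fun k => (f k).1 := fun i j hij =>
    (Nat.le_add_right _ _).trans_lt (hnext i j hij).1
  have hφk : ∀ k, k ≤ (f k).2 := hφ.id_le
  have hek : ∀ k, k ≤ (f k).1 := he.id_le
  -- `J (k + 1)` belongs to the term with index `k`, matching the condition `n ≤ k i + 1`; the value
  -- at 0 only has to be smaller than the rest.
  let J : ℕ → ℕ := fun n => Nat.casesOn n 0 fun k => (f k).1 + 4
  have hJ : ∀ k, J (k + 1) = (f k).1 + 4 := fun _ => rfl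
  have hJmono : StrictMono J := strictMono_nat_of_lt_succ fun n => by
    cases n with
    | zero => exact Nat.succ_pos _
    | succ n =>
      rw [hJ, hJ]
      exact Nat.add_lt_add_right (he (Nat.lt_succ_self n)) 4
  have htail : ∀ (avg : ℕ → Vec → Prop) (K : ℕ → ℕ), (∀ k, K (f k).1 ≤ (f k).2) →
      (∀ e, ∀ l ≥ K e, ∀ m, 1 ≤ m → m < e + 4 → SmallOn avg m (K e) (1 / (8 * (e + 1))) (x l)) →
      TailSmall avg (fun k => x (f k).2) J := by
    intro avg K hKf hK k
    refine ⟨K (f k).1, fun b hb => (hKf k).trans (hx.lt_of_mem_support _ hb).le,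
      fun l hl m hm hmJ => (hK _ _ ((hKf k).trans (hφ.monotone hl)) m hm hmJ).mono_right ?_⟩
    have : (k : ℝ) ≤ (f k).1 := by exact_mod_cast hek k
    gcongr
  refine ⟨fun k => (f k).2, J, hφ, hx.comp_strictMono hφ, fun k => hle _, hJmono, ?_,
    htail _ K₁ (fun k => (hgood k).1.1) hK₁, htail _ K₂ (fun k => (hgood k).1.2) hK₂, ?_⟩
  · intro k
    rw [hJ]
    have h1 := (hnext k (k + 1) (Nat.lt_succ_self k)).1
    have h2 : (f (k + 1)).1 + 4 < 2 ^ ((f (k + 1)).1 + 4) := Nat.lt_two_pow_self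
    have h3 : 8 * (k + 1) * maxSupp (x (f k).2) ^ 2 ≤
        8 * ((f k).2 + 1) * maxSupp (x (f k).2) ^ 2 := by
      gcongr
      exact hφk k
    exact (h3.trans (by omega)).trans h2.le
  · intro a k l hak hkl h
    -- The precision at step `k` was chosen after the earlier term `a`, so `(a + 1) * maxSupp (z a)
    -- ≤ (f k).1 + 1`.
    refine (hnext k l hkl).2.2 (h.mono ?_ (hJ k).ge)
    have hpos : 0 < maxSupp (x (f a).2) := maxSupp_pos (hx.1 _)
    have h1 := (hnext a k hak).1
    have h2 : (a + 1) * maxSupp (x (f a).2) ≤ (f k).1 + 1 := by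
      have h3 : (a + 1) * maxSupp (x (f a).2) ≤ 8 * ((f a).2 + 1) * maxSupp (x (f a).2) ^ 2 := by
        rw [pow_two, ← mul_assoc]
        refine (Nat.mul_le_mul_right _ ?_).trans (Nat.le_mul_of_pos_right _ hpos)
        have := hφk a
        omega
      omega
    have h4 : ((a : ℝ) + 1) * maxSupp (x (f a).2) ≤ (f k).1 + 1 := by exact_mod_cast h2
    have h5 : (0 : ℝ) < maxSupp (x (f a).2) := by exact_mod_cast hpos
    exact one_div_le_one_div_of_le (by positivity) h4

/-! ### The upper `c₀` estimate -/

/-- All restrictions of `f` are bounded by `4` on the sums of at most `min I + 1` terms. -/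
def BoundedOnSums (z : ℕ → Vec) (f : Vec) : Prop :=
  ∀ E : Set ℕ+, E.OrdConnected → ∀ (I : Finset ℕ) (c : ℕ → ℝ), (∀ i ∈ I, |c i| ≤ 1) →
    (∀ i ∈ I, I.card ≤ i + 1) → |act (restrict E f) (∑ i ∈ I, c i • z i)| ≤ 4

theorem act_sum_smul (f : Vec) (I : Finset ℕ) (c : ℕ → ℝ) (z : ℕ → Vec) :
    act f (∑ i ∈ I, c i • z i) = ∑ i ∈ I, c i * act f (z i) := by
  rw [act_sum_right]
  exact Finset.sum_congr rfl fun i _ => act_smul _ _ _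

theorem abs_sum_mul_le {I : Finset ℕ} {c r : ℕ → ℝ} {η : ℝ} (hc : ∀ i ∈ I, |c i| ≤ 1)
    (hr : ∀ i ∈ I, |r i| ≤ η) : |∑ i ∈ I, c i * r i| ≤ I.card * η := by
  refine (Finset.abs_sum_le_sum_abs _ _).trans ?_
  rw [← nsmul_eq_mul]
  refine Finset.sum_le_card_nsmul _ _ _ fun i hi => ?_
  rw [abs_mul]
  exact (mul_le_of_le_one_left (abs_nonneg _) (hc i hi)).trans (hr i hi)

namespace IsRapid

variable {P : Setup} {z : ℕ → Vec} {J : ℕ → ℕ}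

/-- The first average that reaches the terms is at most 4 by assumption; the others add at most `#I
/ (8 * (k + 1)) ≤ 1 / 8` with `k = min I`. The kind of average is left free so that the lemma serves
during the induction, for averages over the set being built, as well as afterwards for `W`. -/
theorem abs_act_le_of_weight_lt (hz : IsRapid P z J) {avg : ℕ → Vec → Prop}
    (havg : ∀ s f, avg s f → BoundedOnSums z f) (hsmall : TailSmall avg z J) {n : ℕ} {f : Vec}
    (hf : IsTypeI avg n f) {I : Finset ℕ} (hI : ∀ i ∈ I, n < J (i + 1)) {c : ℕ → ℝ}
    (hc : ∀ i ∈ I, |c i| ≤ 1) (hcard : ∀ i ∈ I, I.card ≤ i + 1) :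
    |act f (∑ i ∈ I, c i • z i)| ≤ 1 / 2 ^ n * (4 + 1 / 8) := by
  rcases I.eq_empty_or_nonempty with rfl | hne
  · rw [Finset.sum_empty, act_zero_right, abs_zero]
    positivity
  · set k := I.min' hne
    have hk : k ∈ I := I.min'_mem hne
    obtain ⟨K, hK, hsm⟩ := hsmall k
    have hKi : ∀ i ∈ I, ∀ b ∈ (z i).support, K ≤ (b : ℕ) := by
      intro i hi b hb
      rcases (I.min'_le i hi).eq_or_lt with hki | hki
      · exact hK b (by rwa [← hki] at hb)
      · obtain ⟨a, ha⟩ := Finsupp.support_nonempty_iff.2 (hz.block.1 k)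
        have h : (a : ℕ) < b := hz.block.2 k i hki a ha b hb
        exact (hK a ha).trans h.le
    refine (hf.abs_act_le_of_smallOn hKi
      (fun i hi => hsm i (I.min'_le i hi) n hf.1 (hI k hk)) hc (by norm_num : (0 : ℝ) ≤ 4)
      fun s u hu E hE => havg s u hu E hE I c hc hcard).trans ?_
    have h1 : (I.card : ℝ) ≤ k + 1 := by exact_mod_cast hcard k hk
    have h2 : (I.card : ℝ) * (1 / (8 * (k + 1))) ≤ 1 / 8 := by
      rw [mul_one_div, div_le_div_iff₀ (by positivity) (by norm_num)]
      linarith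
    gcongr

theorem two_pow_mul_card_le (hz : IsRapid P z J) {i n : ℕ} (hn : J (i + 2) ≤ n) :
    (1 : ℝ) / 2 ^ n * (z i).support.card ≤ 1 / (8 * (i + 1) * maxSupp (z i)) := by
  have hpos : (0 : ℝ) < maxSupp (z i) := by exact_mod_cast maxSupp_pos (hz.block.1 i)
  have h1 : (8 * (i + 1) * maxSupp (z i) ^ 2 : ℝ) ≤ 2 ^ n := by
    refine le_trans ?_ (pow_le_pow_right₀ one_le_two hn)
    exact_mod_cast hz.large i
  have h2 : ((z i).support.card : ℝ) ≤ maxSupp (z i) := by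
    exact_mod_cast card_support_le_maxSupp (z i)
  rw [one_div_mul_eq_div, div_le_div_iff₀ (by positivity) (by positivity), one_mul]
  refine le_trans ?_ h1
  calc ((z i).support.card : ℝ) * (8 * (i + 1) * maxSupp (z i))
      ≤ maxSupp (z i) * (8 * (i + 1) * maxSupp (z i)) := by gcongr
    _ = 8 * (i + 1) * maxSupp (z i) ^ 2 := by ring

/-- Terms late for the weight `n` contribute at most `(1 / 2) * (33 / 8)`, since `n ≥ 1`. The last
early term contributes at most 1 and the other early ones `1 / 8` together. The sum `51 / 16` is
below 4, so the induction closes. -/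
theorem abs_act_le_of_isTypeI (hz : IsRapid P z J) {avg : ℕ → Vec → Prop}
    (havg : ∀ s f, avg s f → f ∈ P.W ∧ BoundedOnSums z f) (hsmall : TailSmall avg z J) {n : ℕ}
    {f : Vec} (hf : IsTypeI avg n f) (hfW : f ∈ P.W) {I : Finset ℕ} {c : ℕ → ℝ}
    (hc : ∀ i ∈ I, |c i| ≤ 1) (hcard : ∀ i ∈ I, I.card ≤ i + 1) :
    |act f (∑ i ∈ I, c i • z i)| ≤ 4 := by
  classical
  have hsplit := Finset.sum_filter_add_sum_filter_not I (fun i => n < J (i + 1))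
    fun i => c i • z i
  rw [← hsplit, act_add]
  set L := I.filter fun i => n < J (i + 1)
  set Ea := I.filter fun i => ¬n < J (i + 1)
  have hLI : L ⊆ I := Finset.filter_subset _ _
  have hEI : Ea ⊆ I := Finset.filter_subset _ _
  have hlate : |act f (∑ i ∈ L, c i • z i)| ≤ 1 / 2 ^ n * (4 + 1 / 8) :=
    hz.abs_act_le_of_weight_lt (fun s u hu => (havg s u hu).2) hsmall hf
      (fun i hi => (Finset.mem_filter.1 hi).2) (fun i hi => hc i (hLI hi))
      fun i hi => (Finset.card_le_card hLI).trans (hcard i (hLI hi))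
  have hhalf : (1 : ℝ) / 2 ^ n ≤ 1 / 2 := by
    refine one_div_le_one_div_of_le (by norm_num) ?_
    simpa using pow_le_pow_right₀ (one_le_two (α := ℝ)) hf.1
  have hearly : |act f (∑ i ∈ Ea, c i • z i)| ≤ 1 + 1 / 8 := by
    rcases Ea.eq_empty_or_nonempty with h0 | hne
    · rw [h0, Finset.sum_empty, act_zero_right, abs_zero]
      norm_num
    · set k := Ea.max' hne
      have hk : k ∈ Ea := Ea.max'_mem hne
      have hcardpos : (0 : ℝ) < I.card := by
        exact_mod_cast Finset.card_pos.2 ⟨k, hEI hk⟩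
      rw [act_sum_smul, ← Finset.add_sum_erase _ _ hk]
      have h1 : |c k * act f (z k)| ≤ 1 := by
        rw [abs_mul]
        exact mul_le_one₀ (hc k (hEI hk)) (abs_nonneg _)
          ((P.abs_act_le hfW _).trans (hz.norm_le k))
      have h2 : |∑ i ∈ Ea.erase k, c i * act f (z i)| ≤ (Ea.erase k).card * (1 / (8 * I.card)) := by
        refine abs_sum_mul_le (fun i hi => hc i (hEI (Finset.mem_of_mem_erase hi))) fun i hi => ?_
        have hiE := Finset.mem_of_mem_erase hi
        have hik : i < k := lt_of_le_of_ne (Ea.le_max' i hiE) (Finset.ne_of_mem_erase hi)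
        -- An early term before the last early one is early by a full extra step of `J`, which is
        -- what the growth condition `large` needs; no such gain is available for the last one.
        have hJn : J (i + 2) ≤ n := (hz.strictMono.monotone (by omega)).trans
          (not_lt.1 (Finset.mem_filter.1 hk).2)
        have h3 := abs_act_le_mul_card
          (hf.abs_le_inv_two_pow fun s u hu => P.abs_le_one_of_mem_W (havg s u hu).1)
          (P.abs_apply_le_one (hz.norm_le i))
        refine (h3.trans (hz.two_pow_mul_card_le hJn)).trans ?_
        have h4 : (I.card : ℝ) ≤ i + 1 := by exact_mod_cast hcard i (hEI hiE)
        have h5 : (1 : ℝ) ≤ maxSupp (z i) := by exact_mod_cast maxSupp_pos (hz.block.1 i)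
        refine one_div_le_one_div_of_le (by positivity) ?_
        nlinarith
      have h3 : ((Ea.erase k).card : ℝ) ≤ I.card := by
        exact_mod_cast Finset.card_le_card ((Finset.erase_subset _ _).trans hEI)
      have h4 : ((Ea.erase k).card : ℝ) * (1 / (8 * I.card)) ≤ 1 / 8 := by
        rw [mul_one_div, div_le_div_iff₀ (by positivity) (by norm_num)]
        linarith
      exact (abs_add_le _ _).trans (add_le_add h1 (h2.trans h4))
  have := abs_add_le (act f (∑ i ∈ L, c i • z i)) (act f (∑ i ∈ Ea, c i • z i))
  nlinarith

end IsRapid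

/-! ### Summability over the weights of a special sequence. -/

theorem Setup.le_ell (P : Setup) (k : ℕ) : k ≤ P.ell k := by
  induction k with
  | zero => exact Nat.zero_le _
  | succ k ih =>
    have h1 := P.ell_succ k
    have h2 : 2 * P.ell k < 2 ^ (2 * P.ell k) := Nat.lt_two_pow_self
    omega

theorem Setup.sum_inv_two_pow_ell_le (P : Setup) (S : Finset ℕ) :
    ∑ k ∈ S, (1 : ℝ) / 2 ^ P.ell k ≤ 1 / 1000 := by
  have hsum : Summable fun k => (1 : ℝ) / 2 ^ P.ell k := by
    refine Summable.of_nonneg_of_le (fun k => by positivity) (fun k => ?_) summable_geometric_two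
    rw [one_div_pow]
    exact one_div_le_one_div_of_le (by positivity) (pow_le_pow_right₀ one_le_two (P.le_ell k))
  exact (hsum.sum_le_tsum S fun k _ => by positivity).trans P.ell_sum.le

theorem IsSpecial.sum_inv_two_pow_weight_le {P : Setup} {d : ℕ} {f g : ℕ → Vec} {w : ℕ → ℕ}
    (h : IsSpecial P P.W d f g w) {F : Finset ℕ} (hF : ∀ q ∈ F, q < d) :
    ∑ q ∈ F, (1 : ℝ) / 2 ^ w q ≤ 1 / 1000 := by
  classical
  have h1 : ∀ q, ∃ k, q ∈ F → P.ell k = w q := fun q => by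
    by_cases hq : q ∈ F
    · obtain ⟨k, hk⟩ := h.weight_mem_range (hF q hq)
      exact ⟨k, fun _ => hk⟩
    · exact ⟨0, fun hq' => absurd hq' hq⟩
  choose k hk using h1
  have hinj : Set.InjOn k F := fun p hp q hq hpq =>
    h.weight_injOn (hF p hp) (hF q hq) (by rw [← hk p hp, ← hk q hq, hpq])
  refine le_trans (le_of_eq ?_) (P.sum_inv_two_pow_ell_le (F.image k))
  rw [Finset.sum_image hinj]
  exact Finset.sum_congr rfl fun q hq => by rw [hk q hq]

namespace IsRapid

variable {P : Setup} {z : ℕ → Vec} {J : ℕ → ℕ}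

/-- Types II₊ and II₋ together; of the coefficients only `|b q| ≤ 1` is used. The bound is 1 for the
first term acted upon, 2 for at most two exceptional later terms (one cut by `E`, one hit by a pair
of high weight), and `1 / 2` for all the rest. -/
theorem abs_act_le_of_isSpecial (hz : IsRapid P z J) {G : Set Vec}
    (hGW : G ⊆ P.W) (hG : ∀ f ∈ G, BoundedOnSums z f) {d : ℕ} {f g u : ℕ → Vec} {w : ℕ → ℕ}
    (hs : IsSpecial P G d f g w) {F : Finset ℕ} (hF : ∀ q ∈ F, q < d)
    (hmin : ∀ q ∈ F, ∀ a ∈ (f q).support, 2 * F.card ≤ (a : ℕ)) {b : ℕ → ℝ}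
    (hb : ∀ q ∈ F, |b q| ≤ 1)
    (hu : (∀ q, u q = f q + g q) ∨ ∀ q, u q = f q - g q) {E : Set ℕ+} (hE : E.OrdConnected)
    (hW : restrict E ((1 / 2 : ℝ) • ∑ q ∈ F, b q • u q) ∈ P.W) {I : Finset ℕ} {c : ℕ → ℝ}
    (hc : ∀ i ∈ I, |c i| ≤ 1) (hcard : ∀ i ∈ I, I.card ≤ i + 1) :
    |act (restrict E ((1 / 2 : ℝ) • ∑ q ∈ F, b q • u q)) (∑ i ∈ I, c i • z i)| ≤ 4 := by
  classical
  set Φ := restrict E ((1 / 2 : ℝ) • ∑ q ∈ F, b q • u q) with hΦ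
  have hsW : IsSpecial P P.W d f g w := hs.mono hGW
  have hu_supp : ∀ q a, a ∈ (u q).support → a ∈ (f q).support ∨ a ∈ (g q).support := by
    intro q a ha
    by_contra hcon
    push Not at hcon
    have h1 := Finsupp.notMem_support_iff.1 hcon.1
    have h2 := Finsupp.notMem_support_iff.1 hcon.2
    rcases hu with hu | hu <;> exact Finsupp.mem_support_iff.1 ha (by rw [hu]; simp [h1, h2])
  have hΦz : ∀ i, |act Φ (z i)| ≤ 1 := fun i => (P.abs_act_le hW _).trans (hz.norm_le i)
  have hΦsum : ∀ x, act Φ x = 1 / 2 * ∑ q ∈ F, b q * act (restrict E (u q)) x := by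
    intro x
    rw [hΦ, restrict_smul, restrict_sum, act_smul_left, act_sum_left]
    congr 1
    exact Finset.sum_congr rfl fun q _ => by rw [restrict_smul, act_smul_left]
  by_cases hex : ∃ i ∈ I, act Φ (z i) ≠ 0
  swap
  · push Not at hex
    rw [act_sum_smul, Finset.sum_eq_zero fun i hi => by rw [hex i hi, mul_zero], abs_zero]
    norm_num
  let S := I.filter fun i => act Φ (z i) ≠ 0
  have hSne : S.Nonempty := by
    obtain ⟨i, hi, h⟩ := hex
    exact ⟨i, Finset.mem_filter.2 ⟨hi, h⟩⟩
  set k := S.min' hSne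
  have hkS : k ∈ S := S.min'_mem hSne
  have hkI : k ∈ I := (Finset.mem_filter.1 hkS).1
  have hknot : ∀ i ∈ I, i < k → act Φ (z i) = 0 := fun i hi hik => by
    by_contra hne
    exact not_lt.2 (S.min'_le i (Finset.mem_filter.2 ⟨hi, hne⟩)) hik
  obtain ⟨a, haΦ, haz⟩ := exists_mem_support_of_act_ne_zero (Finset.mem_filter.1 hkS).2
  obtain ⟨haE, haψ⟩ := mem_support_restrict.1 haΦ
  -- The functional acts on `z k`, so some pair has a support point there, and all its support
  -- points are at least `2 * F.card`.
  have hFcard : 2 * F.card ≤ maxSupp (z k) := by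
    refine le_trans ?_ (le_maxSupp haz)
    obtain ⟨q, hq, haq⟩ : ∃ q ∈ F, a ∈ (u q).support := by
      by_contra hcon
      push Not at hcon
      refine Finsupp.mem_support_iff.1 haψ ?_
      rw [Finsupp.smul_apply, Finsupp.finsetSum_apply, Finset.sum_eq_zero, smul_zero]
      intro q hq
      rw [Finsupp.smul_apply, Finsupp.notMem_support_iff.1 (hcon q hq), smul_zero]
    rcases hu_supp q a haq with h | h
    · exact hmin q hq a h
    · obtain ⟨a', ha'⟩ := Finsupp.support_nonempty_iff.2 (hsW.ne_zero (hF q hq)).1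
      have h1 : (a' : ℕ) < a := (hsW.2.1 q (hF q hq)).2.2 a' ha' a h
      exact (hmin q hq a' ha').trans h1.le
  have hm : (1 : ℝ) ≤ maxSupp (z k) := by exact_mod_cast maxSupp_pos (hz.block.1 k)
  -- At most `k + 1` terms and at most `maxSupp (z k) / 2` pairs occur, so actions below `η` add up
  -- to at most `1 / 2`.
  set η : ℝ := 1 / ((k + 1) * maxSupp (z k)) with hη
  have hηpos : 0 < η := by positivity
  -- The terms after the `k`-th one that are cut by `E`, and those hit by some pair.
  let cut : ℕ → Prop := fun i => (∃ a ∈ (z i).support, a ∉ E) ∧ ∃ a ∈ (z i).support, a ∈ E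
  let hit : ℕ → Prop := fun i => ∃ q ∈ F, J (i + 1) ≤ w q ∧ HitsAt η (z i) f g q
  let X := I.filter fun i => k < i
  have hXI : X ⊆ I := Finset.filter_subset _ _
  have hkX : ∀ i ∈ X, k < i := fun i hi => (Finset.mem_filter.1 hi).2
  -- As `E` already meets the support of `z k`, only its right end can cut a later term.
  have hcut_lt : ∀ i ∈ X, ∀ i' ∈ X, cut i → cut i' → ¬i < i' := by
    rintro i hi i' - ⟨⟨a₁, ha₁, ha₁E⟩, -⟩ ⟨-, a₂, ha₂, ha₂E⟩ hlt
    exact ha₁E (hE.out haE ha₂E ⟨(hz.block.2 k i (hkX i hi) a haz a₁ ha₁).le,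
      (hz.block.2 i i' hlt a₁ ha₁ a₂ ha₂).le⟩)
  -- Increasing places give a forbidden double hit, and decreasing ones contradict the order of the
  -- terms. If one pair hits both, its weight is at least `J (i' + 1) ≥ J (i + 2)`, too high for it
  -- to act on `z i` by more than `η / 4`.
  have hhit_lt : ∀ i ∈ X, ∀ i' ∈ X, hit i → hit i' → ¬i < i' := by
    rintro i hi i' - ⟨q, hq, hwq, hh⟩ ⟨q', hq', hwq', hh'⟩ hlt
    rcases lt_trichotomy q q' with hqq | rfl | hqq
    · exact hz.not_doubleHit k i i' (hkX i hi) hlt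
        ⟨d, f, g, w, q, q', hsW, hqq, hF q' hq', hwq, hh, hh'⟩
    · have hJ : J (i + 2) ≤ w q := (hz.strictMono.monotone (by omega)).trans hwq'
      have hI := hsW.2.2.2.1 q (hF q hq)
      have h1 := (hI.1.abs_act_le_card (hz.norm_le i)).trans (hz.two_pow_mul_card_le hJ)
      have h2 := (hI.2.abs_act_le_card (hz.norm_le i)).trans (hz.two_pow_mul_card_le hJ)
      have h3 := hh.le_of_abs_le h1 h2
      have h4 : (maxSupp (z k) : ℝ) ≤ maxSupp (z i) := by
        exact_mod_cast hz.block.maxSupp_mono (hkX i hi).le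
      have h5 : (k : ℝ) ≤ i := by exact_mod_cast (hkX i hi).le
      have h6 : (1 : ℝ) / ((i + 1) * maxSupp (z i)) ≤ η := by
        rw [hη]
        gcongr
      have h7 : 2 * ((1 : ℝ) / (8 * (i + 1) * maxSupp (z i))) =
          1 / ((i + 1) * maxSupp (z i)) / 4 := by
        field_simp
        norm_num
      rw [h7] at h3
      linarith
    · obtain ⟨a₁, ha₁, ha₁'⟩ := hh.exists_mem_support hηpos
      obtain ⟨a₂, ha₂, ha₂'⟩ := hh'.exists_mem_support hηpos
      exact (hsW.lt_of_mem_support hqq (hF q hq) ha₂' ha₁').asymm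
        (hz.block.2 i i' hlt a₁ ha₁ a₂ ha₂)
  have hcard_le_one : ∀ (p : ℕ → Prop) [DecidablePred p], (∀ i ∈ X, ∀ i' ∈ X, p i → p i' → ¬i < i') →
      (X.filter p).card ≤ 1 := fun p _ hp => by
    rw [Finset.card_le_one]
    intro i hi i' hi'
    obtain ⟨hiX, hpi⟩ := Finset.mem_filter.1 hi
    obtain ⟨hiX', hpi'⟩ := Finset.mem_filter.1 hi'
    exact le_antisymm (not_lt.1 (hp i' hiX' i hiX hpi' hpi)) (not_lt.1 (hp i hiX i' hiX' hpi hpi'))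
  let B := X.filter fun i => cut i ∨ hit i
  let R := X.filter fun i => ¬(cut i ∨ hit i)
  have hBI : B ⊆ I := (Finset.filter_subset _ _).trans hXI
  have hRI : R ⊆ I := (Finset.filter_subset _ _).trans hXI
  have hBcard : (B.card : ℝ) ≤ 2 := by
    have h1 : B = X.filter cut ∪ X.filter hit := Finset.filter_or _ _ _
    have h2 := Finset.card_union_le (X.filter cut) (X.filter hit)
    rw [← h1] at h2
    have h3 := h2.trans (Nat.add_le_add (hcard_le_one cut hcut_lt) (hcard_le_one hit hhit_lt))
    exact_mod_cast h3
  -- Terms late for `w q` give `33 / 8` times `1 / 2 ^ w q` for each of `f q` and `g q`. Each of the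
  -- others is not hit by the pair and lies inside or outside `E`, so it gives at most `η`.
  have hR : ∀ q ∈ F, |act (restrict E (u q)) (∑ i ∈ R, c i • z i)| ≤
      33 / 4 * (1 / 2 ^ w q) + 1 / maxSupp (z k) := by
    intro q hq
    have hsplit := Finset.sum_filter_add_sum_filter_not R (fun i => w q < J (i + 1))
      fun i => c i • z i
    rw [← hsplit, act_add]
    set L := R.filter fun i => w q < J (i + 1)
    set H := R.filter fun i => ¬w q < J (i + 1)
    have hLI : L ⊆ I := (Finset.filter_subset _ _).trans hRI
    have hHR : H ⊆ R := Finset.filter_subset _ _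
    have hlow : ∀ v, IsTypeIAlpha G (w q) v →
        |act (restrict E v) (∑ i ∈ L, c i • z i)| ≤ 1 / 2 ^ w q * (4 + 1 / 8) := fun v hv =>
      hz.abs_act_le_of_weight_lt (avg := IsAlphaAverage G) (fun s u hu => hG u hu.2.1)
        (fun k => by
          obtain ⟨K, h1, h2⟩ := hz.alpha k
          exact ⟨K, h1, fun l hl m hm hmJ => (h2 l hl m hm hmJ).anti fun _ _ h => h.mono hGW⟩)
        (IsTypeI.restrict hv hE) (fun i hi => (Finset.mem_filter.1 hi).2)
        (fun i hi => hc i (hLI hi))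
        fun i hi => (Finset.card_le_card hLI).trans (hcard i (hLI hi))
    have h1 := hlow _ (hs.2.2.2.1 q (hF q hq)).1
    have h2 := hlow _ (hs.2.2.2.1 q (hF q hq)).2
    have hL : |act (restrict E (u q)) (∑ i ∈ L, c i • z i)| ≤ 33 / 4 * (1 / 2 ^ w q) := by
      rcases hu with hu | hu
      · rw [hu, restrict_add, act_add_left]
        refine (abs_add_le _ _).trans ?_
        linarith
      · rw [hu, sub_eq_add_neg, restrict_add, restrict_neg, act_add_left, act_neg_left,
          ← sub_eq_add_neg]
        refine (abs_sub _ _).trans ?_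
        linarith
    have hH : |act (restrict E (u q)) (∑ i ∈ H, c i • z i)| ≤ 1 / maxSupp (z k) := by
      rw [act_sum_smul]
      refine (abs_sum_mul_le (η := η) (fun i hi => hc i (hRI (hHR hi))) fun i hi => ?_).trans ?_
      · obtain ⟨-, hnot⟩ := Finset.mem_filter.1 (hHR hi)
        push Not at hnot
        have hact : |act (u q) (z i)| ≤ η := by
          by_contra hlt
          refine hnot.2 ⟨q, hq, not_lt.1 (Finset.mem_filter.1 hi).2, fun a ha => ?_, ?_⟩
          · have := hmin q hq a ha
            have := Finset.card_pos.2 ⟨q, hq⟩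
            omega
          · rw [not_le] at hlt
            rcases hu with hu | hu
            · exact Or.inl (by rw [← hu]; exact hlt.le)
            · exact Or.inr (by rw [← hu]; exact hlt.le)
        by_cases hin : ∃ a ∈ (z i).support, a ∈ E
        · rw [act_restrict_of_subset fun a ha => ?_]
          · exact hact
          · by_contra haE
            exact hnot.1 ⟨⟨a, ha, haE⟩, hin⟩
        · push Not at hin
          rw [act_restrict_eq_zero hin, abs_zero]
          exact hηpos.le
      · have h3 : (H.card : ℝ) ≤ k + 1 := by
          exact_mod_cast (Finset.card_le_card (hHR.trans hRI)).trans (hcard k hkI)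
        rw [hη, mul_one_div, div_le_div_iff₀ (by positivity) (by positivity), one_mul]
        exact mul_le_mul_of_nonneg_right h3 (by positivity)
    exact (abs_add_le _ _).trans (add_le_add hL hH)
  have hRsum : |act Φ (∑ i ∈ R, c i • z i)| ≤ 1 / 2 := by
    rw [hΦsum, abs_mul, abs_of_pos (by norm_num : (0 : ℝ) < 1 / 2)]
    have h1 : |∑ q ∈ F, b q * act (restrict E (u q)) (∑ i ∈ R, c i • z i)| ≤
        ∑ q ∈ F, (33 / 4 * (1 / 2 ^ w q) + 1 / (maxSupp (z k) : ℝ)) := by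
      refine (Finset.abs_sum_le_sum_abs _ _).trans (Finset.sum_le_sum fun q hq => ?_)
      rw [abs_mul]
      exact (mul_le_of_le_one_left (abs_nonneg _) (hb q hq)).trans (hR q hq)
    have h2 : ∑ q ∈ F, (33 / 4 * (1 / 2 ^ w q) + 1 / (maxSupp (z k) : ℝ)) ≤
        33 / 4 * (1 / 1000) + 1 / 2 := by
      rw [Finset.sum_add_distrib, ← Finset.mul_sum, Finset.sum_const, nsmul_eq_mul]
      have h3 := hsW.sum_inv_two_pow_weight_le hF
      have h4 : (2 : ℝ) * F.card ≤ maxSupp (z k) := by exact_mod_cast hFcard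
      have h5 : (F.card : ℝ) * (1 / maxSupp (z k)) ≤ 1 / 2 := by
        rw [mul_one_div, div_le_div_iff₀ (by positivity) (by norm_num)]
        linarith
      linarith
    linarith
  have hsplit : ∑ i ∈ I, c i * act Φ (z i) =
      c k * act Φ (z k) + (∑ i ∈ B, c i * act Φ (z i) + ∑ i ∈ R, c i * act Φ (z i)) := by
    rw [Finset.sum_filter_add_sum_filter_not]
    have hkX' : k ∉ X := fun h => lt_irrefl k (hkX k h)
    rw [← Finset.sum_insert (f := fun i => c i * act Φ (z i)) hkX']
    refine (Finset.sum_subset (Finset.insert_subset hkI hXI) fun i hi hni => ?_).symm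
    rw [Finset.mem_insert, not_or] at hni
    rw [hknot i hi ?_, mul_zero]
    refine lt_of_le_of_ne (not_lt.1 fun hki => hni.2 (Finset.mem_filter.2 ⟨hi, hki⟩)) hni.1
  rw [act_sum_smul] at hRsum ⊢
  rw [hsplit]
  have h1 : |c k * act Φ (z k)| ≤ 1 := by
    rw [abs_mul]
    exact mul_le_one₀ (hc k hkI) (abs_nonneg _) (hΦz k)
  have h2 : |∑ i ∈ B, c i * act Φ (z i)| ≤ 2 :=
    (abs_sum_mul_le (fun i hi => hc i (hBI hi)) fun i _ => hΦz i).trans (by linarith)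
  refine (abs_add_le _ _).trans ?_
  have := abs_add_le (∑ i ∈ B, c i * act Φ (z i)) (∑ i ∈ R, c i * act Φ (z i))
  linarith

theorem abs_act_le_of_isSignedRestriction {E : Set ℕ+} {f g x : Vec}
    (h : IsSignedRestriction E f g) (hg : g ∈ P.W) {r : ℝ}
    (hle : restrict E f ∈ P.W → |act (restrict E f) x| ≤ r) : |act g x| ≤ r := by
  rcases h.2 with rfl | rfl
  · exact hle hg
  · rw [act_neg_left, abs_neg]
    exact hle (by simpa using P.isClosedUnderOps_W.neg_mem _ hg)

/-- The induction over `W`. Membership in `W` is carried along because the smallness conditions and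
the coding arguments are known only for functionals of `W`. -/
theorem isClosedUnderOps_boundedOnSums (hz : IsRapid P z J) :
    IsClosedUnderOps P {f | f ∈ P.W ∧ BoundedOnSums z f} := by
  have hW := P.isClosedUnderOps_W
  set G : Set Vec := {f | f ∈ P.W ∧ BoundedOnSums z f} with hGdef
  have hGW : G ⊆ P.W := fun f hf => hf.1
  have hα : TailSmall (IsAlphaAverage G) z J := fun k => by
    obtain ⟨K, h1, h2⟩ := hz.alpha k
    exact ⟨K, h1, fun l hl m hm hmJ => (h2 l hl m hm hmJ).anti fun _ _ h => h.mono hGW⟩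
  have hβ : TailSmall (IsBetaAverage P G) z J := fun k => by
    obtain ⟨K, h1, h2⟩ := hz.beta k
    exact ⟨K, h1, fun l hl m hm hmJ => (h2 l hl m hm hmJ).anti fun _ _ h => h.mono hGW⟩
  refine ⟨?_, ?_, ?_, ?_, ?_, ?_, ?_, ?_⟩
  · refine fun n => ⟨P.single_mem_W n, fun E _ I c hc _ => ?_⟩
    by_cases hn : n ∈ E
    · have h1 : act (restrict E (Finsupp.single n 1)) (∑ i ∈ I, c i • z i) =
          (∑ i ∈ I, c i • z i) n := by
        have h2 : restrict E (Finsupp.single n 1) = Finsupp.single n 1 := by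
          ext a
          by_cases ha : a ∈ E
          · rw [restrict_apply_of_mem ha]
          · rw [restrict_apply_of_notMem ha, Finsupp.single_eq_of_ne]
            rintro rfl
            exact ha hn
        rw [h2]
        simp [act]
      rw [h1]
      refine (abs_sum_le_one_of_disjoint I (fun i => c i • z i) n ?_ ?_).trans (by norm_num)
      · intro i _ j _ hij hne
        simp only [Finsupp.smul_apply, smul_eq_mul, ne_eq, mul_eq_zero, not_or] at hne ⊢
        rcases lt_or_gt_of_ne hij with h | h
        · exact Or.inr ((hz.block.2 i j h).apply_eq_zero hne.2)
        · exact Or.inr ((hz.block.2 j i h).apply_eq_zero' hne.2)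
      · intro i hi
        rw [Finsupp.smul_apply, smul_eq_mul, abs_mul]
        exact mul_le_one₀ (hc i hi) (abs_nonneg _) (P.abs_apply_le_one (hz.norm_le i) n)
    · have h1 : restrict E (Finsupp.single n 1) = 0 := by
        ext a
        by_cases ha : a ∈ E
        · rw [restrict_apply_of_mem ha, Finsupp.single_eq_of_ne, Finsupp.zero_apply]
          rintro rfl
          exact hn ha
        · rw [restrict_apply_of_notMem ha, Finsupp.zero_apply]
      rw [h1, act_zero_left, abs_zero]
      norm_num
  · rintro f ⟨hf, hfb⟩
    refine ⟨hW.neg_mem f hf, fun E hE I c hc hcard => ?_⟩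
    rw [restrict_neg, act_neg_left, abs_neg]
    exact hfb E hE I c hc hcard
  · rintro f ⟨hf, hfb⟩ E hE
    refine ⟨hW.restrict_mem f hf E hE, fun E' hE' I c hc hcard => ?_⟩
    rw [restrict_restrict]
    exact hfb _ (hE'.inter hE) I c hc hcard
  · rintro f ⟨hf, hfb⟩ g ⟨hg, hgb⟩ r h0 h1
    refine ⟨hW.convex_mem f hf g hg r h0 h1, fun E hE I c hc hcard => ?_⟩
    have h0' : (0 : ℝ) ≤ r := by exact_mod_cast h0
    have h1' : (r : ℝ) ≤ 1 := by exact_mod_cast h1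
    have hf' := abs_le.1 (hfb E hE I c hc hcard)
    have hg' := abs_le.1 (hgb E hE I c hc hcard)
    rw [restrict_add, restrict_smul, restrict_smul, act_add_left, act_smul_left, act_smul_left,
      abs_le]
    constructor <;> nlinarith
  · intro n f hf
    have hfW := hW.alpha_mem n f (hf.mono hGW)
    exact ⟨hfW, fun E hE I c hc hcard => hz.abs_act_le_of_isTypeI (avg := IsAlphaAverage G)
      (fun s u hu => hu.2.1) hα (IsTypeI.restrict hf hE) (hW.restrict_mem f hfW E hE) hc hcard⟩
  · intro n f hf
    have hfW := hW.beta_mem n f (hf.mono hGW)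
    exact ⟨hfW, fun E hE I c hc hcard => hz.abs_act_le_of_isTypeI (avg := IsBetaAverage P G)
      (fun s u hu => hu.2.1) hβ (IsTypeI.restrict hf hE) (hW.restrict_mem f hfW E hE) hc hcard⟩
  · intro A h hh
    have hhW := hW.plus_mem A h (hh.mono hGW)
    refine ⟨hhW, fun E hE I c hc hcard => ?_⟩
    obtain ⟨d, f, g, w, F, E', hs, -, hF, hmin, hE', -⟩ := hh
    have hres := hE'.restrict hE
    refine abs_act_le_of_isSignedRestriction hres (hW.restrict_mem h hhW E hE) fun hmem => ?_
    have := hz.abs_act_le_of_isSpecial hGW (fun f hf => hf.2) hs hF hmin (b := fun _ => 1)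
      (u := fun q => f q + g q) (by simp) (Or.inl fun _ => rfl) hres.1 (I := I) (c := c)
    simp only [one_smul] at this
    exact this hmem hc hcard
  · intro A h hh
    have hhW := hW.minus_mem A h (hh.mono hGW)
    refine ⟨hhW, fun E hE I c hc hcard => ?_⟩
    obtain ⟨d, f, g, w, F, e, E', hs, -, hF, hmin, he, hE', -⟩ := hh
    have hres := hE'.restrict hE
    exact abs_act_le_of_isSignedRestriction hres (hW.restrict_mem h hhW E hE) fun hmem =>
      hz.abs_act_le_of_isSpecial hGW (fun f hf => hf.2) hs hF hmin (b := fun q => (e q : ℝ))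
        (u := fun q => f q - g q) (fun q hq => he.abs_le_one hq) (Or.inr fun _ => rfl) hres.1 hmem
        hc hcard

/-! ### Estimates for sums along a rapid subsequence. -/

theorem boundedOnSums (hz : IsRapid P z J) {f : Vec} (hf : f ∈ P.W) : BoundedOnSums z f :=
  (P.W_subset hz.isClosedUnderOps_boundedOnSums hf).2

theorem exists_sum_eq {n : ℕ} {k : Fin n → ℕ} (hk : StrictMono k) (hn : ∀ i, n ≤ k i + 1)
    {a : Fin n → ℝ} (ha : ∀ i, |a i| ≤ 1) (z : ℕ → Vec) :
    ∃ (I : Finset ℕ) (c : ℕ → ℝ), (∀ i ∈ I, n ≤ i + 1) ∧ (∀ i ∈ I, |c i| ≤ 1) ∧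
      (∀ i ∈ I, I.card ≤ i + 1) ∧ ∑ i, a i • z (k i) = ∑ i ∈ I, c i • z i := by
  classical
  have hcard : (Finset.univ.image k).card ≤ n := Finset.card_image_le.trans (by simp)
  refine ⟨Finset.univ.image k, Function.extend k a 0, ?_, ?_, ?_, ?_⟩
  · intro i hi
    obtain ⟨j, -, rfl⟩ := Finset.mem_image.1 hi
    exact hn j
  · intro i hi
    obtain ⟨j, -, rfl⟩ := Finset.mem_image.1 hi
    rw [hk.injective.extend_apply]
    exact ha j
  · intro i hi
    obtain ⟨j, -, rfl⟩ := Finset.mem_image.1 hi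
    exact hcard.trans (hn j)
  · rw [Finset.sum_image fun i _ j _ hij => hk.injective hij]
    exact Finset.sum_congr rfl fun i _ => by rw [hk.injective.extend_apply]

theorem normW_sum_le (hz : IsRapid P z J) {n : ℕ} {k : Fin n → ℕ} (hk : StrictMono k)
    (hn : ∀ i, n ≤ k i + 1) {a : Fin n → ℝ} (ha : ∀ i, |a i| ≤ 1) :
    P.normW (∑ i, a i • z (k i)) ≤ 4 := by
  obtain ⟨I, c, -, hc, hcard, he⟩ := exists_sum_eq hk hn ha z
  rw [he]
  refine P.normW_le fun f hf => (le_abs_self _).trans ?_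
  have := hz.boundedOnSums hf Set.univ Set.ordConnected_univ I c hc hcard
  rwa [restrict_univ] at this

/-- For `m < J n` every term used is late, so nothing remains but the estimate `(4 + 1 / 8) / 2 ^
m`. -/
theorem abs_act_sum_lt (hz : IsRapid P z J) {n : ℕ} {k : Fin n → ℕ} (hk : StrictMono k)
    (hn : ∀ i, n ≤ k i + 1) {m : ℕ} {f : Vec} (hf : IsTypeIAlpha P.W m f) (hm : m < J n) :
    |act f (∑ i, z (k i))| < 5 / 2 ^ m := by
  obtain ⟨I, c, hI, hc, hcard, he⟩ := exists_sum_eq hk hn (a := fun _ => 1) (by simp) z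
  simp only [one_smul] at he
  rw [he]
  refine (hz.abs_act_le_of_weight_lt (avg := IsAlphaAverage P.W)
    (fun s u hu => hz.boundedOnSums hu.2.1) hz.alpha hf
    (fun i hi => hm.trans_le (hz.strictMono.monotone (hI i hi))) hc hcard).trans_lt ?_
  rw [one_div_mul_eq_div]
  gcongr
  norm_num

end IsRapid

/-! ### The main result -/

/-- The inclusion of `c₀₀` in `𝔛` as a linear map. -/
noncomputable def Setup.inclLinear (P : Setup) : Vec →ₗ[ℝ] P.X where
  toFun := P.incl
  map_add' := P.incl_add
  map_smul' := P.incl_smul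

theorem Setup.incl_sum (P : Setup) {ι : Type*} (s : Finset ι) (f : ι → Vec) :
    P.incl (∑ i ∈ s, f i) = ∑ i ∈ s, P.incl (f i) := map_sum P.inclLinear f s

/-- Restricting a functional to the range of one block isolates that term and stays in `W`. This is
the source of the lower `c₀` estimate. -/
theorem Setup.normW_term_le {P : Setup} {z : ℕ → Vec} (hz : IsBlock z) {s : Finset ℕ} (c : ℕ → ℝ)
    {i : ℕ} (hi : i ∈ s) : P.normW (c i • z i) ≤ P.normW (∑ j ∈ s, c j • z j) := by
  refine P.normW_le fun f hf => ?_
  have h1 : act f (c i • z i) = act (restrict (ran (z i)) f) (∑ j ∈ s, c j • z j) := by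
    rw [act_sum_smul, Finset.sum_eq_single_of_mem i hi fun j _ hji => ?_,
      act_restrict_of_subset fun a ha => mem_ran_of_mem_support ha, act_smul]
    rw [act_restrict_eq_zero fun a ha har => ?_, mul_zero]
    rcases lt_or_gt_of_ne hji with h | h
    · exact lt_irrefl a ((hz.2 j i h).le_ran (mem_ran_of_mem_support ha) har)
    · exact lt_irrefl a ((hz.2 i j h).le_ran har (mem_ran_of_mem_support ha))
  rw [h1]
  exact (le_abs_self _).trans
    (P.abs_act_le (P.isClosedUnderOps_W.restrict_mem f hf _ (ordConnected_ran _)) _)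

theorem bddAbove_range_abs (a : ℕ →₀ ℝ) : BddAbove (Set.range fun i => |a i|) := by
  refine ⟨∑ i ∈ a.support, |a i|, ?_⟩
  rintro _ ⟨i, rfl⟩
  by_cases hi : i ∈ a.support
  · exact Finset.single_le_sum (f := fun i => |a i|) (fun i _ => abs_nonneg _) hi
  · simp only [Finsupp.notMem_support_iff.1 hi, abs_zero]
    exact Finset.sum_nonneg fun i _ => abs_nonneg _

theorem abs_le_supNorm (a : ℕ →₀ ℝ) (i : ℕ) : |a i| ≤ supNorm a :=
  le_ciSup (bddAbove_range_abs a) i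

theorem seminorm_le_mul_supNorm {N : Seminorm ℝ (ℕ →₀ ℝ)} {C : ℝ}
    (h : ∀ a : ℕ →₀ ℝ, (∀ i, |a i| ≤ 1) → N a ≤ C) (a : ℕ →₀ ℝ) : N a ≤ C * supNorm a := by
  have h0 : 0 ≤ supNorm a := (abs_nonneg _).trans (abs_le_supNorm a 0)
  rcases h0.eq_or_lt with h0 | hpos
  · have : a = 0 := by
      ext i
      exact abs_nonpos_iff.1 ((abs_le_supNorm a i).trans h0.ge)
    rw [← h0, this, map_zero, mul_zero]
  · have h1 := h ((supNorm a)⁻¹ • a) fun i => by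
      rw [Finsupp.smul_apply, smul_eq_mul, abs_mul, abs_of_pos (inv_pos.2 hpos),
        inv_mul_le_iff₀ hpos, mul_one]
      exact abs_le_supNorm a i
    rw [map_smul_eq_mul, Real.norm_eq_abs, abs_of_pos (inv_pos.2 hpos), inv_mul_le_iff₀ hpos] at h1
    linarith

theorem mainTheorem9 (P : Setup) (x : ℕ → Vec) (hblock : IsBlock x)
    (hsemi : ∃ c : ℝ, 0 < c ∧ ∀ k, c ≤ ‖P.incl (x k)‖) (hle : ∀ k, ‖P.incl (x k)‖ ≤ 1)
    (hα : AlphaIndexZero P x) (hβ : BetaIndexZero P x) (hB : BranchIndexZero P x) :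
    ∃ φ : ℕ → ℕ, StrictMono φ ∧
      GeneratesC0SpreadingModel (fun k => P.incl (x (φ k))) ∧
      (∀ (n : ℕ) (k : Fin n → ℕ), StrictMono k → (∀ i, n ≤ k i + 1) →
        ‖∑ i, P.incl (x (φ (k i)))‖ ≤ 5) ∧
      ∃ j : ℕ → ℕ, StrictMono j ∧
        ∀ (n : ℕ) (k : Fin n → ℕ), StrictMono k → (∀ i, n ≤ k i + 1) →
          ∀ (m : ℕ) (f : Vec), IsTypeIAlpha P.W m f → m < j n →
            |act f (∑ i, x (φ (k i)))| < 5 / 2 ^ m := by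
  have hle' : ∀ k, P.normW (x k) ≤ 1 := fun k => (P.norm_incl _).symm.trans_le (hle k)
  obtain ⟨c, hc, hcx⟩ := hsemi
  obtain ⟨φ, J, hφ, hz⟩ := P.exists_isRapid_subsequence hblock hle' hα hβ hB
  obtain ⟨χ, N, hχ, hgen, hlim⟩ := exists_generatesSpreadingModel
    (y := fun k => P.incl (x (φ k))) fun k => hle _
  -- As `χ` moves indices to the right, the estimates for the rapid subsequence pass to the further
  -- one with the same `J`.
  have hn : ∀ {n : ℕ} {k : Fin n → ℕ}, (∀ i, n ≤ k i + 1) → ∀ i, n ≤ χ (k i) + 1 :=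
    fun h i => (h i).trans (Nat.add_le_add_right (hχ.id_le _) 1)
  refine ⟨fun k => φ (χ k), hφ.comp hχ, ⟨N, hgen, c, 4, hc, fun a => ⟨?_, ?_⟩⟩, ?_, J,
    hz.strictMono, ?_⟩
  · refine ge_of_tendsto' (hlim a) fun m => ?_
    have hN0 : 0 ≤ ‖Finsupp.linearCombination ℝ (fun i => P.incl (x (φ (χ (m + i))))) a‖ :=
      norm_nonneg _
    -- The constant is moved to the other side so that the supremum in `supNorm` stands alone and
    -- can be bounded coordinate by coordinate.
    rw [mul_comm, ← le_div_iff₀ hc]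
    refine ciSup_le fun i => ?_
    rw [le_div_iff₀ hc]
    by_cases hi : i ∈ a.support
    · have hblock' : IsBlock fun i => x (φ (χ (m + i))) :=
        hblock.comp_strictMono (hφ.comp (hχ.comp fun i j hij => Nat.add_lt_add_left hij m))
      have h1 := P.normW_term_le hblock' a hi
      have h2 : Finsupp.linearCombination ℝ (fun i => P.incl (x (φ (χ (m + i))))) a =
          P.incl (∑ i ∈ a.support, a i • x (φ (χ (m + i)))) := by
        rw [P.incl_sum, Finsupp.linearCombination_apply]
        exact Finset.sum_congr rfl fun i _ => (P.incl_smul _ _).symm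
      rw [h2, P.norm_incl]
      refine le_trans ?_ h1
      rw [P.normW_smul]
      refine mul_le_mul_of_nonneg_left ?_ (abs_nonneg _)
      rw [← P.norm_incl]
      exact hcx _
    · rw [Finsupp.notMem_support_iff.1 hi, abs_zero, zero_mul]
      exact hN0
  · refine seminorm_le_mul_supNorm (fun a ha => ?_) a
    refine le_of_tendsto (hlim a) ?_
    obtain ⟨n, hn₀⟩ : ∃ n, ∀ i ∈ a.support, i < n :=
      ⟨a.support.sup id + 1, fun i hi => Nat.lt_succ_of_le (Finset.le_sup (f := id) hi)⟩
    filter_upwards [eventually_ge_atTop n] with m hm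
    rw [linearCombination_eq_sum_fin _ hn₀]
    have h1 := hz.normW_sum_le (n := n) (k := fun i => χ (m + i))
      (fun i j hij => hχ (Nat.add_lt_add_left hij m)) (hn fun i => by omega) (a := fun i => a i)
      fun i => ha i
    rw [← P.norm_incl, P.incl_sum] at h1
    simpa only [P.incl_smul] using h1
  · intro n k hk hnk
    have h1 := hz.normW_sum_le (hχ.comp hk) (hn hnk) (a := fun _ => 1) (by simp)
    rw [← P.norm_incl, P.incl_sum] at h1
    simp only [one_smul, Function.comp_apply] at h1
    linarith
  · intro n k hk hnk m f hf hm
    exact hz.abs_act_sum_lt (hχ.comp hk) (hn hnk) hf hm
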